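/- Let $X\in\mathbb R^{N\times d}$ be a fixed matrix without zero columns, $y\in\mathbb R^N$ a fixed vector, and $p\in(0,1)$. Let $(D_k)_{k\in\mathbb Z}$ be i.i.d. random diagonal $d\times d$ matrices whose diagonal entries are i.i.d. Bernoulli$(p)$. Put $f_{\alpha,D}(u)=u+\alpha DX^\top(y-XDu)$. Let $s\ge 1$, let $\alpha_1,\dots,\alpha_s\in(0,2/\|X^\top X\|)$, where $\|\cdot\|$ is the spectral norm, and let $\tilde\beta_0(\alpha_1),\dots,\tilde\beta_0(\alpha_s)\in\mathbb R^d$ be arbitrary fixed initial vectors, one for each of the $s$ runs. For each run $l$ let $\tilde\beta_k(\alpha_l)=f_{\alpha_l,D_k}(\tilde\beta_{k-1}(\alpha_l))$ for $k\ge1$ (all runs use the same matrices $D_k$), and $\bar\beta_n^{\mathrm{gd}}(\alpha_l)=\frac1n\sum_{k=1}^n\tilde\beta_k(\alpha_l)$. Let $\tilde\beta=\big(p\,X^\top X+(1-p)\,\mathrm{Diag}(X^\top X)\big)^{-1}X^\top y$, where $\mathrm{Diag}(A)$ is the diagonal matrix with the same main diagonal as $A$. Then $\tilde\beta$ is the unique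 minimizer over $b\in\mathbb R^d$ of $\mathbb E\big[\tfrac12\|y-XD_1b\|_2^2\big]$. Moreover, for all $l$ and all $k\in\mathbb Z$ the limit $$\tilde\beta_k^\circ(\alpha_l)=\lim_{m\to\infty}f_{\alpha_l,D_k}\circ f_{\alpha_l,D_{k-1}}\circ\cdots\circ f_{\alpha_l,D_{k-m}}(b)$$ exists almost surely for every $b\in\mathbb R^d$, does not depend on $b$, and is square integrable. With $\mathrm{vec}(u_1,\dots,u_s)=(u_1^\top,\dots,u_s^\top)^\top\in\mathbb R^{ds}$, the series $$\Sigma^{\mathrm{vec}}=\sum_{k=-\infty}^{\infty}\mathrm{Cov}\Big(\mathrm{vec}\big(\tilde\beta_0^\circ(\alpha_1),\dots,\tilde\beta_0^\circ(\alpha_s)\big),\ \mathrm{vec}\big(\tilde\beta_k^\circ(\alpha_1),\dots,\tilde\beta_k^\circ(\alpha_s)\big)\Big)$$ converges absolutely (entry by entry) to a positive semidefinite matrix, and, as $n\to\infty$, $$\sqrt n\cdot\mathrm{vec}\big(\bar\beta_n^{\mathrm{gd}}(\alpha_1)-\tilde\beta,\dots,\bar\beta_n^{\mathrm{gd}}(\alpha_s)-\tilde\beta\big)\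 \Rightarrow\ \mathcal N(0,\Sigma^{\mathrm{vec}})\quad\text{in distribution.}$$ -/

import Mathlib

open MeasureTheory ProbabilityTheory Filter Topology
open scoped Matrix Matrix.Norms.L2Operator

noncomputable section

namespace DropoutGD

/-- `Diag(A)`: the diagonal matrix with the same main diagonal as `A`. -/
def diagPart {d : ℕ} (A : Matrix (Fin d) (Fin d) ℝ) : Matrix (Fin d) (Fin d) ℝ :=
  Matrix.diagonal A.diag

/-- `A_p = p A + (1 - p) Diag(A)`. -/
def rescale {d : ℕ} (p : ℝ) (A : Matrix (Fin d) (Fin d) ℝ) : Matrix (Fin d) (Fin d) ℝ :=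
  p • A + (1 - p) • diagPart A

/-- A `p`-dropout matrix: a random diagonal matrix whose diagonal entries are
i.i.d. Bernoulli(`p`). -/
structure IsDropoutMatrix {Ω : Type*} [MeasurableSpace Ω] {d : ℕ} (p : unitInterval)
    (D : Ω → Matrix (Fin d) (Fin d) ℝ) (P : Measure Ω) : Prop where
  isDiag : ∀ ω, (D ω).IsDiag
  law : ∀ i, HasLaw (fun ω => D ω i i) (bernoulliMeasure (1 : ℝ) 0 p) P
  indep : iIndepFun (fun (i : Fin d) ω => D ω i i) P

/-- An i.i.d. two-sided sequence of `p`-dropout matrices. As the matrices are diagonal, their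
independence is the independence of the vectors of their diagonal entries. -/
structure IsIIDDropout {Ω : Type*} [MeasurableSpace Ω] {d : ℕ} (p : unitInterval)
    (D : ℤ → Ω → Matrix (Fin d) (Fin d) ℝ) (P : Measure Ω) : Prop where
  isDropoutMatrix : ∀ k, IsDropoutMatrix p (D k) P
  indep : iIndepFun (fun (k : ℤ) ω => (D k ω).diag) P

/-- The squared loss with dropout, averaged over the dropout matrix `D` only:
`b ↦ E_D[(1/2) ‖y - X D b‖₂²]`. -/
def dropoutLoss {Ω : Type*} [MeasurableSpace Ω] {N d : ℕ} (P : Measure Ω)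
    (X : Matrix (Fin N) (Fin d) ℝ) (y : Fin N → ℝ) (D : Ω → Matrix (Fin d) (Fin d) ℝ)
    (b : Fin d → ℝ) : ℝ :=
  ∫ ω, (1 / 2 : ℝ) * ‖WithLp.toLp 2 (y - X *ᵥ (D ω *ᵥ b))‖ ^ 2 ∂P

/-- The regularized least-squares estimator `(XᵀX)_p⁻¹ Xᵀ y`. -/
def regEstimator {N d : ℕ} (p : ℝ) (X : Matrix (Fin N) (Fin d) ℝ) (y : Fin N → ℝ) :
    Fin d → ℝ :=
  (rescale p (Xᵀ * X))⁻¹ *ᵥ (Xᵀ *ᵥ y)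

/-- One gradient step with dropout matrix `D`: `f_D(u) = u + α D Xᵀ (y - X D u)`. -/
def gdStep {N d : ℕ} (X : Matrix (Fin N) (Fin d) ℝ) (y : Fin N → ℝ) (α : ℝ)
    (D : Matrix (Fin d) (Fin d) ℝ) (u : Fin d → ℝ) : Fin d → ℝ :=
  u + α • (D *ᵥ (Xᵀ *ᵥ (y - X *ᵥ (D *ᵥ u))))

/-- The iterates `β_k = f_{D_k}(β_{k-1})`, `k ≥ 1`, started at `β₀`. -/
def gdIterate {N d : ℕ} (X : Matrix (Fin N) (Fin d) ℝ) (y : Fin N → ℝ) (α : ℝ)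
    (D : ℤ → Matrix (Fin d) (Fin d) ℝ) (β₀ : Fin d → ℝ) : ℕ → Fin d → ℝ
  | 0 => β₀
  | k + 1 => gdStep X y α (D ((k : ℤ) + 1)) (gdIterate X y α D β₀ k)

/-- The averaged iterate `(1/n) ∑_{k=1}^n β_k`. -/
def avgIterate {N d : ℕ} (X : Matrix (Fin N) (Fin d) ℝ) (y : Fin N → ℝ) (α : ℝ)
    (D : ℤ → Matrix (Fin d) (Fin d) ℝ) (β₀ : Fin d → ℝ) (n : ℕ) : Fin d → ℝ :=
  (n : ℝ)⁻¹ • ∑ k ∈ Finset.Icc 1 n, gdIterate X y α D β₀ k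

/-- The backward composition `f_{D_k} ∘ f_{D_{k-1}} ∘ ⋯ ∘ f_{D_{k-m}}` evaluated at `u`. -/
def backwardIterate {N d : ℕ} (X : Matrix (Fin N) (Fin d) ℝ) (y : Fin N → ℝ) (α : ℝ)
    (D : ℤ → Matrix (Fin d) (Fin d) ℝ) (k : ℤ) : ℕ → (Fin d → ℝ) → Fin d → ℝ
  | 0, u => gdStep X y α (D k) u
  | m + 1, u => backwardIterate X y α D k m (gdStep X y α (D (k - ((m : ℤ) + 1))) u)

/-- The stationary iterate `β_k° = lim_{m → ∞} f_{D_k} ∘ ⋯ ∘ f_{D_{k-m}}(0)`, `k ∈ ℤ`. -/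
def stationaryIterate {N d : ℕ} (X : Matrix (Fin N) (Fin d) ℝ) (y : Fin N → ℝ) (α : ℝ)
    (D : ℤ → Matrix (Fin d) (Fin d) ℝ) (k : ℤ) : Fin d → ℝ :=
  limUnder atTop (fun m : ℕ => backwardIterate X y α D k m 0)

/-- `vec(u_1, …, u_s)`: the vectors `u_1, …, u_s` stacked on top of each other; the coordinate
`(l, i)` is the `i`-th coordinate of `u_l`. -/
def vecs {s d : ℕ} (u : Fin s → Fin d → ℝ) : Fin s × Fin d → ℝ :=
  Matrix.vec (Matrix.of fun (i : Fin d) (l : Fin s) => u l i)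

/-- `vec(β_k°(α_1), …, β_k°(α_s))`, all components driven by the same dropout matrices. -/
def stationaryVec {N d s : ℕ} (X : Matrix (Fin N) (Fin d) ℝ) (y : Fin N → ℝ) (α : Fin s → ℝ)
    (D : ℤ → Matrix (Fin d) (Fin d) ℝ) (k : ℤ) : Fin s × Fin d → ℝ :=
  vecs fun l => stationaryIterate X y (α l) D k

/-- The cross-covariance matrix `Cov(U, V)` with entries `Cov(U_a, V_b)`. -/
def crossCov {Ω ι : Type*} [MeasurableSpace Ω] (P : Measure Ω) (U V : Ω → ι → ℝ) :
    Matrix ι ι ℝ :=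
  Matrix.of fun a b => covariance (fun ω => U ω a) (fun ω => V ω b) P

/-- The long-run covariance matrix `∑_{k ∈ ℤ} Cov(Z_0, Z_k)`, entry by entry. -/
def longRunCov {Ω ι : Type*} [MeasurableSpace Ω] (P : Measure Ω) (Z : ℤ → Ω → ι → ℝ) :
    Matrix ι ι ℝ :=
  Matrix.of fun a b => ∑' k : ℤ, crossCov P (Z 0) (Z k) a b

end DropoutGD

end

noncomputable section

set_option linter.unusedSectionVars false

/-! Centred at `β̃ = regEstimator p X y` and stacked over the runs, the iteration is a random affine
recursion `u_k = M(D_k) u_{k-1} + e(D_k)`. Its linear part is block diagonal with blocks `I - α_l D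
XᵀX D`. For a 0-1 mask the second moments give `E[D A D] = p A_p`, where `A_p` is `rescale p A`.
This identity has three consequences. The expected loss is a quadratic with Hessian `p (XᵀX)_p`,
which is positive definite because `X` has no zero column, so `β̃` is its only minimizer. The normal
equations `(XᵀX)_p β̃ = Xᵀy` say exactly that `E e = 0` (`sum_stepNoise`). Finally `E‖M v‖² ≤ ρ
‖v‖²` with `ρ < 1` (`exists_isMeanContractive`). A single step need not contract, since a zero mask
gives the identity, so every estimate is made in mean square.

The contraction makes backward compositions forget their starting point at rate `ρ^n` in mean
square. They therefore converge almost surely to a stationary solution in `L²`, and the forward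
iterates can be compared with versions of finite memory.

For the central limit theorem let `L` be the adjoint of the mean of `M` and `R = (1 - L)⁻¹`. Since
`t = Rt - LRt`, the sum of `⟪t, u_k⟫` equals a sum of martingale differences `⟪Rt, u_{k+1}⟫ - ⟪LRt,
u_k⟫` plus a boundary term bounded in `L²` (`sum_inner_fwd`). Truncating the memory after `m` steps
makes the differences bounded, stationary and finitely dependent. The characteristic function of
their normalized sums converges by a direct argument (`tendsto_integral_exp_martingale`), and the
mean-square cost of the replacement is `O(1/n + ρ^m)` (`exists_integral_sq_sub_le`).

With `Γ` the stationary covariance form, the variance of the stationary martingale difference is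
`Γ(Rt, Rt) - Γ(LRt, LRt)`. Summing the geometric series of autocovariances gives the same form
(`hasSum_longRunForm`). This identifies the Gaussian limit, and it shows absolute convergence and
positive semidefiniteness at once. -/

namespace RandomAffine

/-! ### Compositions of affine maps along a two-sided sequence -/

section Composition

variable {T H : Type*} [NormedAddCommGroup H] [NormedSpace ℝ H]

/-- The composition of the `n` random affine maps `u ↦ M (x j) u + e (x j)`, `k - n < j ≤ k`,
the map with index `k` being applied last. -/
def bwd (M : T → H →L[ℝ] H) (e : T → H) (x : ℤ → T) : ℕ → ℤ → H → H
  | 0, _, u => u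
  | n + 1, k, u => M (x k) (bwd M e x n (k - 1) u) + e (x k)

variable {M : T → H →L[ℝ] H} {e : T → H} {x : ℤ → T}

@[simp] lemma bwd_zero (k : ℤ) (u : H) : bwd M e x 0 k u = u := rfl

lemma bwd_succ (n : ℕ) (k : ℤ) (u : H) :
    bwd M e x (n + 1) k u = M (x k) (bwd M e x n (k - 1) u) + e (x k) := rfl

lemma bwd_add (n j : ℕ) (k : ℤ) (u : H) :
    bwd M e x (n + j) k u = bwd M e x n k (bwd M e x j (k - n) u) := by
  induction n generalizing k with
  | zero => simp
  | succ n ih =>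
    rw [show n + 1 + j = n + j + 1 by ring, bwd_succ, bwd_succ, ih]
    push_cast
    rw [show k - 1 - (n : ℤ) = k - (n + 1) by ring]

/-- The additive parts cancel in a difference, so two trajectories driven by the same maps differ by
the homogeneous recursion. All forgetting estimates rest on this. -/
lemma bwd_sub (n : ℕ) (k : ℤ) (u v : H) :
    bwd M e x n k u - bwd M e x n k v = bwd M 0 x n k (u - v) := by
  induction n generalizing k with
  | zero => simp
  | succ n ih => simp [bwd_succ, ← ih]

lemma bwd_shift (n : ℕ) (k j : ℤ) (u : H) :
    bwd M e (fun i => x (i + j)) n k u = bwd M e x n (k + j) u := by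
  induction n generalizing k with
  | zero => simp
  | succ n ih => simp [bwd_succ, ih, show k - 1 + j = k + j - 1 by ring]

end Composition

/-! ### Independent noise with values in a finite space -/

section Independence

variable {Ω T : Type*} [MeasurableSpace Ω] [MeasurableSpace T]

/-- An i.i.d. sequence in a finite space `T`, with point masses `w`. -/
structure IsIIDSeq (η : ℤ → Ω → T) (w : T → ℝ) (P : Measure Ω) : Prop where
  meas : ∀ k, Measurable (η k)
  indep : iIndepFun η P
  weight : ∀ k t, P.real (η k ⁻¹' {t}) = w t

/-- The σ-algebra generated by the `η j`, `j ∈ S`. -/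
@[reducible] def sigmaOn (η : ℤ → Ω → T) (S : Set ℤ) : MeasurableSpace Ω :=
  ⨆ j ∈ S, MeasurableSpace.comap (η j) inferInstance

variable {η : ℤ → Ω → T} {w : T → ℝ} {P : Measure Ω}

lemma sigmaOn_mono {S S' : Set ℤ} (h : S ⊆ S') : sigmaOn η S ≤ sigmaOn η S' :=
  biSup_mono h

lemma measurable_sigmaOn {S : Set ℤ} {j : ℤ} (hj : j ∈ S) : Measurable[sigmaOn η S] (η j) :=
  Measurable.mono (comap_measurable (η j)) (le_biSup (fun j => MeasurableSpace.comap (η j) _) hj)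
    le_rfl

namespace IsIIDSeq

lemma sigmaOn_le (hη : IsIIDSeq η w P) (S : Set ℤ) : sigmaOn η S ≤ ‹MeasurableSpace Ω› :=
  iSup₂_le fun j _ => (hη.meas j).comap_le

lemma weight_nonneg (hη : IsIIDSeq η w P) (t : T) : 0 ≤ w t :=
  (hη.weight 0 t) ▸ measureReal_nonneg

lemma indep_sigmaOn (hη : IsIIDSeq η w P) {S S' : Set ℤ} (h : Disjoint S S') :
    Indep (sigmaOn η S) (sigmaOn η S') P :=
  indep_iSup_of_disjoint (fun j => (hη.meas j).comap_le) hη.indep h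

variable [Fintype T] [DiscreteMeasurableSpace T] [IsProbabilityMeasure P]

lemma sum_weight (hη : IsIIDSeq η w P) : ∑ t, w t = 1 := by
  rw [← probReal_univ (μ := P), ← Set.preimage_univ (f := η 0), ← Finset.coe_univ,
    ← sum_measureReal_preimage_singleton]
  · simp [hη.weight]
  · exact fun t _ => hη.meas 0 (measurableSet_singleton t)

variable {E : Type*} [NormedAddCommGroup E] [NormedSpace ℝ E] [CompleteSpace E]

/-- Integrating out a noise variable which is independent of everything else. -/
lemma integral_freeze (hη : IsIIDSeq η w P) {S : Set ℤ} {k : ℤ} (hk : k ∉ S) {g : T → Ω → E}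
    (hg : ∀ t, StronglyMeasurable[sigmaOn η S] (g t)) (hgi : ∀ t, Integrable (g t) P) :
    ∫ ω, g (η k ω) ω ∂P = ∑ t, w t • ∫ ω, g t ω ∂P := by
  classical
  -- Partition according to the finitely many values of the noise `η k`.
  have : (fun ω => g (η k ω) ω) = fun ω => ∑ t, (η k ⁻¹' {t}).indicator (g t) ω := by
    ext ω
    rw [Finset.sum_eq_single (η k ω)]
    · simp
    · intro t _ ht
      simp [ht.symm]
    · simp
  rw [this, integral_finsetSum _ fun t _ =>
    (hgi t).indicator (hη.meas k (measurableSet_singleton t))]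
  refine Finset.sum_congr rfl fun t _ => ?_
  have hle := hη.sigmaOn_le {k}
  have hms : MeasurableSet[sigmaOn η {k}] (η k ⁻¹' {t}) :=
    measurable_sigmaOn (Set.mem_singleton k) (measurableSet_singleton t)
  -- On `{η k = t}` replace `g t` by its conditional expectation given `η k`, which by independence
  -- is the constant `E[g t]`.
  rw [integral_indicator (hle _ hms), ← setIntegral_condExp hle (hgi t) hms,
    setIntegral_congr_ae (g := fun _ => ∫ ω, g t ω ∂P) (hle _ hms), setIntegral_const, hη.weight]
  filter_upwards [condExp_indep_eq (hη.sigmaOn_le S) hle (hg t)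
    (hη.indep_sigmaOn (Set.disjoint_singleton_right.2 hk))] with ω hω _
  exact hω

end IsIIDSeq

end Independence

/-! ### Mean-square contraction and forgetting of the starting point -/

section Moments

variable {Ω T H : Type*} [MeasurableSpace Ω] [MeasurableSpace T] [Fintype T]
  [DiscreteMeasurableSpace T] [NormedAddCommGroup H] [NormedSpace ℝ H]
  [FiniteDimensional ℝ H] [MeasurableSpace H] [BorelSpace H]
  {η : ℤ → Ω → T} {w : T → ℝ} {P : Measure Ω} {M : T → H →L[ℝ] H} {e : T → H} {ρ : ℝ}

/-- Contraction in mean square of a finite family of linear maps with weights `w`. -/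
structure IsMeanContractive (M : T → H →L[ℝ] H) (w : T → ℝ) (ρ : ℝ) : Prop where
  pos : 0 < ρ
  lt_one : ρ < 1
  bound : ∀ v, ∑ t, w t * ‖M t v‖ ^ 2 ≤ ρ * ‖v‖ ^ 2

lemma measurable_step {m : MeasurableSpace Ω} {f : Ω → T} {W : Ω → H} (hf : Measurable f)
    (hW : Measurable W) : Measurable fun ω => M (f ω) (W ω) + e (f ω) := by
  have : Measurable fun q : T × H => M q.1 q.2 + e q.1 :=
    measurable_from_prod_countable_right fun t =>
      (M t).continuous.measurable.add_const (e t)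
  exact this.comp (hf.prodMk hW)

lemma measurable_bwd_sigmaOn {S : Set ℤ} {n : ℕ} {k : ℤ} (hS : Set.Ioc (k - n) k ⊆ S)
    {W : Ω → H} (hW : Measurable[sigmaOn η S] W) :
    Measurable[sigmaOn η S] fun ω => bwd M e (η · ω) n k (W ω) := by
  induction n generalizing k with
  | zero => simpa using hW
  | succ n ih =>
    refine measurable_step (measurable_sigmaOn (hS ?_)) (ih fun i hi => hS ?_)
    · simp
    · simp at hi ⊢; omega

lemma measurable_bwd_path (n : ℕ) (k : ℤ) (u : H) :
    Measurable fun x : ℤ → T => bwd M e x n k u := by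
  induction n generalizing k with
  | zero => simp
  | succ n ih => exact measurable_step (measurable_pi_apply k) (ih (k - 1))

lemma IsIIDSeq.measurable_path (hη : IsIIDSeq η w P) : Measurable fun ω (j : ℤ) => η j ω :=
  measurable_pi_lambda _ hη.meas

lemma IsIIDSeq.measurable_bwd (hη : IsIIDSeq η w P) (n : ℕ) (k : ℤ) (u : H) :
    Measurable fun ω => bwd M e (η · ω) n k u :=
  (measurable_bwd_path n k u).comp hη.measurable_path

lemma memLp_step (hη : IsIIDSeq η w P) [IsFiniteMeasure P] {k : ℤ} {W : Ω → H} (hW : MemLp W 2 P) :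
    MemLp (fun ω => M (η k ω) (W ω) + e (η k ω)) 2 P := by
  have h1 : ∀ t, MemLp (fun ω => M t (W ω) + e t) 2 P := fun t =>
    ((M t).comp_memLp' hW).add (memLp_const _)
  have : (fun ω => M (η k ω) (W ω) + e (η k ω)) =
      fun ω => ∑ t, (η k ⁻¹' {t}).indicator (fun ω => M t (W ω) + e t) ω := by
    classical
    ext ω
    rw [Finset.sum_eq_single (η k ω)]
    · simp
    · intro t _ ht
      simp [ht.symm]
    · simp
  rw [this]
  exact memLp_finsetSum _ fun t _ => (h1 t).indicator (hη.meas k (measurableSet_singleton t))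

lemma memLp_bwd (hη : IsIIDSeq η w P) [IsFiniteMeasure P] {n : ℕ} {k : ℤ} {W : Ω → H}
    (hW : MemLp W 2 P) :
    MemLp (fun ω => bwd M e (η · ω) n k (W ω)) 2 P := by
  induction n generalizing k with
  | zero => simpa using hW
  | succ n ih => exact memLp_step hη ih

variable [IsProbabilityMeasure P]

/-- The fresh noise is independent of `W`, so it can be averaged out for frozen `W`, and the
contraction bound then applies pointwise. -/
lemma integral_norm_sq_map_le (hη : IsIIDSeq η w P) (hM : IsMeanContractive M w ρ) {S : Set ℤ}
    {k : ℤ} (hk : k ∉ S) {W : Ω → H} (hWm : Measurable[sigmaOn η S] W) (hW : MemLp W 2 P) :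
    ∫ ω, ‖M (η k ω) (W ω)‖ ^ 2 ∂P ≤ ρ * ∫ ω, ‖W ω‖ ^ 2 ∂P := by
  have hi : ∀ t, Integrable (fun ω => ‖M t (W ω)‖ ^ 2) P := fun t =>
    ((M t).comp_memLp' hW).integrable_norm_pow (by simp)
  have hm : ∀ t, StronglyMeasurable[sigmaOn η S] (fun ω => ‖M t (W ω)‖ ^ 2) := fun t =>
    Measurable.stronglyMeasurable
      (Measurable.comp (g := fun v => ‖M t v‖ ^ 2) (by fun_prop) hWm)
  rw [hη.integral_freeze (g := fun t ω => ‖M t (W ω)‖ ^ 2) hk hm hi]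
  simp_rw [smul_eq_mul, ← integral_const_mul]
  rw [← integral_finsetSum _ fun t _ => (hi t).const_mul _]
  exact integral_mono (integrable_finsetSum _ fun t _ => (hi t).const_mul _)
    ((hW.integrable_norm_pow (by simp)).const_mul _) fun ω => hM.bound (W ω)

lemma integral_norm_sq_linear_le (hη : IsIIDSeq η w P) (hM : IsMeanContractive M w ρ)
    (n : ℕ) (k : ℤ) {W : Ω → H} (hWm : Measurable[sigmaOn η (Set.Iic (k - n))] W)
    (hW : MemLp W 2 P) :
    ∫ ω, ‖bwd M 0 (η · ω) n k (W ω)‖ ^ 2 ∂P ≤ ρ ^ n * ∫ ω, ‖W ω‖ ^ 2 ∂P := by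
  induction n generalizing k with
  | zero => simp
  | succ n ih =>
    have h1 : sigmaOn η (Set.Iic (k - (n + 1 : ℕ))) = sigmaOn η (Set.Iic (k - 1 - n)) := by
      push_cast
      rw [show k - ((n : ℤ) + 1) = k - 1 - n by ring]
    rw [h1] at hWm
    have h2 := integral_norm_sq_map_le (k := k) (S := Set.Iic (k - 1)) hη hM (by simp)
      (measurable_bwd_sigmaOn (M := M) (e := 0) (n := n) (k := k - 1) (fun i hi => hi.2)
        (hWm.mono (sigmaOn_mono (Set.Iic_subset_Iic.2 (by omega))) le_rfl))
      (memLp_bwd hη hW)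
    simp only [bwd_succ, Pi.zero_apply, add_zero]
    calc _ ≤ _ := h2
      _ ≤ ρ * (ρ ^ n * ∫ ω, ‖W ω‖ ^ 2 ∂P) := by gcongr; exacts [hM.pos.le, ih _ hWm]
      _ = _ := by ring

lemma norm_add_sq_le_weighted (a b : H) {δ : ℝ} (hδ : 0 < δ) :
    ‖a + b‖ ^ 2 ≤ (1 + δ) * ‖a‖ ^ 2 + (1 + δ⁻¹) * ‖b‖ ^ 2 := by
  have h1 : ‖a + b‖ ^ 2 ≤ (‖a‖ + ‖b‖) ^ 2 := by gcongr; exact norm_add_le a b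
  have h2 : 0 ≤ δ⁻¹ * (δ * ‖a‖ - ‖b‖) ^ 2 := by positivity
  have h3 : δ⁻¹ * (δ * ‖a‖ - ‖b‖) ^ 2 = δ * ‖a‖ ^ 2 - 2 * ‖a‖ * ‖b‖ + δ⁻¹ * ‖b‖ ^ 2 := by
    field_simp
    ring
  nlinarith

/-- The second moments satisfy `m_{n+1} ≤ q m_n + const` with `q < 1`. The noise need not be
centred, since the cross term is absorbed by a weighted Young inequality. -/
lemma exists_integral_norm_sq_bwd_le (hη : IsIIDSeq η w P) (hM : IsMeanContractive M w ρ)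
    (e : T → H) (v : H) :
    ∃ K, 0 ≤ K ∧ ∀ (n : ℕ) (k : ℤ), ∫ ω, ‖bwd M e (η · ω) n k v‖ ^ 2 ∂P ≤ K := by
  obtain ⟨hρ0, hρ1⟩ := hM.pos, hM.lt_one
  -- Chosen so that `(1 + δ) ρ = (1 + ρ) / 2`, halfway between `ρ` and `1`.
  set δ : ℝ := (1 - ρ) / (2 * ρ) with hδ
  have hδ0 : 0 < δ := by positivity [sub_pos.2 hρ1]
  have hδρ : (1 + δ) * ρ = (1 + ρ) / 2 := by rw [hδ]; field_simp; ring
  set C : ℝ := ∑ t, ‖e t‖ ^ 2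
  have hC : 0 ≤ C := by positivity
  -- The second summand is the fixed point of `z ↦ (1 + ρ)/2 · z + (1 + δ⁻¹) C`; adding `‖v‖²`
  -- covers the start and keeps the bound invariant.
  set K : ℝ := ‖v‖ ^ 2 + (1 + δ⁻¹) * C / ((1 - ρ) / 2)
  have hK : 0 ≤ K := by positivity [sub_pos.2 hρ1]
  have hK2 : (1 + ρ) / 2 * K + (1 + δ⁻¹) * C ≤ K := by
    have : (1 - ρ) / 2 * ((1 + δ⁻¹) * C / ((1 - ρ) / 2)) = (1 + δ⁻¹) * C := by
      field_simp [sub_ne_zero.2 hρ1.ne']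
    have h2 : 0 ≤ (1 - ρ) / 2 * ‖v‖ ^ 2 := by positivity [sub_pos.2 hρ1]
    have h3 : K = ‖v‖ ^ 2 + (1 + δ⁻¹) * C / ((1 - ρ) / 2) := rfl
    have h4 : (1 - ρ) / 2 * K = (1 - ρ) / 2 * ‖v‖ ^ 2 + (1 + δ⁻¹) * C := by rw [h3, mul_add, this]
    linarith
  refine ⟨K, hK, fun n => ?_⟩
  induction n with
  | zero =>
    intro k
    simp only [bwd_zero, integral_const, probReal_univ, one_smul]
    exact le_add_of_nonneg_right (by positivity [sub_pos.2 hρ1])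
  | succ n ih =>
    intro k
    have hmem : MemLp (fun ω => bwd M e (η · ω) n (k - 1) v) 2 P := memLp_bwd hη (memLp_const v)
    have hmem' : MemLp (fun ω => M (η k ω) (bwd M e (η · ω) n (k - 1) v)) 2 P := by
      simpa using memLp_step (e := 0) hη (k := k) hmem
    have h1 := integral_norm_sq_map_le (k := k) (S := Set.Iic (k - 1)) hη hM (by simp)
      (measurable_bwd_sigmaOn (M := M) (e := e) (n := n) (k := k - 1) (fun i hi => hi.2)
        measurable_const) hmem
    have h2 : ∀ ω, ‖bwd M e (η · ω) (n + 1) k v‖ ^ 2 ≤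
        (1 + δ) * ‖M (η k ω) (bwd M e (η · ω) n (k - 1) v)‖ ^ 2 + (1 + δ⁻¹) * C := by
      intro ω
      refine (norm_add_sq_le_weighted _ _ hδ0).trans ?_
      gcongr
      exact Finset.single_le_sum (f := fun t => ‖e t‖ ^ 2) (fun t _ => by positivity)
        (Finset.mem_univ _)
    calc _ ≤ ∫ ω, ((1 + δ) * ‖M (η k ω) (bwd M e (η · ω) n (k - 1) v)‖ ^ 2
            + (1 + δ⁻¹) * C) ∂P :=
          integral_mono ((memLp_bwd hη (memLp_const v)).integrable_norm_pow (by simp))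
            (((hmem'.integrable_norm_pow (by simp)).const_mul _).add (integrable_const _)) h2
      _ = (1 + δ) * ∫ ω, ‖M (η k ω) (bwd M e (η · ω) n (k - 1) v)‖ ^ 2 ∂P + (1 + δ⁻¹) * C := by
          rw [integral_add ((hmem'.integrable_norm_pow (by simp)).const_mul _)
            (integrable_const _), integral_const_mul]
          simp
      _ ≤ (1 + δ) * (ρ * K) + (1 + δ⁻¹) * C := by
          gcongr
          exact h1.trans (by gcongr; exact ih _)
      _ ≤ K := by rw [← mul_assoc, hδρ]; exact hK2

lemma integral_norm_sub_sq_le {f g : Ω → H} (hf : MemLp f 2 P) (hg : MemLp g 2 P) :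
    ∫ ω, ‖f ω - g ω‖ ^ 2 ∂P ≤ 2 * ∫ ω, ‖f ω‖ ^ 2 ∂P + 2 * ∫ ω, ‖g ω‖ ^ 2 ∂P := by
  have hf' := (hf.integrable_norm_pow (p := 2) (by simp)).const_mul 2
  have hg' := (hg.integrable_norm_pow (p := 2) (by simp)).const_mul 2
  rw [← integral_const_mul, ← integral_const_mul, ← integral_add hf' hg']
  refine integral_mono ((hf.sub hg).integrable_norm_pow (by simp)) (hf'.add hg') fun ω => ?_
  have := norm_add_sq_le_weighted (f ω) (-g ω) one_pos
  rw [norm_neg] at this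
  simp only [sub_eq_add_neg]
  linarith

/-- The longer composition is the shorter one applied to a random point that depends only on noise
up to `k - n`. The difference is thus the homogeneous recursion over `n` steps, which contracts by
`ρ^n`, started from a point with bounded second moment. -/
lemma exists_integral_norm_bwd_sub_sq_le_of_le (hη : IsIIDSeq η w P)
    (hM : IsMeanContractive M w ρ) (e : T → H) (v v' : H) :
    ∃ C, 0 ≤ C ∧ ∀ (n m : ℕ) (k : ℤ), n ≤ m →
      ∫ ω, ‖bwd M e (η · ω) n k v - bwd M e (η · ω) m k v'‖ ^ 2 ∂P ≤ C * ρ ^ n := by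
  obtain ⟨K, hK0, hK⟩ := exists_integral_norm_sq_bwd_le hη hM e v'
  refine ⟨2 * ‖v‖ ^ 2 + 2 * K, by positivity, fun n m k hnm => ?_⟩
  obtain ⟨j, rfl⟩ := Nat.exists_eq_add_of_le hnm
  simp_rw [bwd_add, bwd_sub]
  have hm : Measurable[sigmaOn η (Set.Iic (k - n))] fun ω => v - bwd M e (η · ω) j (k - n) v' :=
    Measurable.comp (g := fun u => v - u) (by fun_prop)
      (measurable_bwd_sigmaOn (fun i hi => hi.2) measurable_const)
  have hL : MemLp (fun ω => bwd M e (η · ω) j (k - n) v') 2 P := memLp_bwd hη (memLp_const v')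
  refine (integral_norm_sq_linear_le hη hM n k hm ((memLp_const v).sub hL)).trans ?_
  rw [mul_comm]
  have := hM.pos
  gcongr
  refine (integral_norm_sub_sq_le (memLp_const v) hL).trans ?_
  simp only [integral_const, probReal_univ, one_smul]
  gcongr
  exact hK _ _

lemma exists_integral_norm_bwd_sub_sq_le (hη : IsIIDSeq η w P)
    (hM : IsMeanContractive M w ρ) (e : T → H) (v v' : H) :
    ∃ C, 0 ≤ C ∧ ∀ (n m : ℕ) (k : ℤ),
      ∫ ω, ‖bwd M e (η · ω) n k v - bwd M e (η · ω) m k v'‖ ^ 2 ∂P ≤ C * (ρ ^ n + ρ ^ m) := by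
  obtain ⟨C, hC0, hC⟩ := exists_integral_norm_bwd_sub_sq_le_of_le hη hM e v v'
  obtain ⟨C', hC0', hC'⟩ := exists_integral_norm_bwd_sub_sq_le_of_le hη hM e v' v
  have hρ := hM.pos
  refine ⟨C + C', by positivity, fun n m k => ?_⟩
  have h1 : 0 ≤ C * ρ ^ m := by positivity
  have h2 : 0 ≤ C' * ρ ^ n := by positivity
  have h3 : 0 ≤ C * ρ ^ n := by positivity
  have h4 : 0 ≤ C' * ρ ^ m := by positivity
  rcases le_total n m with h | h
  · have := hC n m k h
    linarith
  · have := hC' m n k h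
    simp_rw [norm_sub_rev (bwd M e _ m k v')] at this
    linarith

end Moments

end RandomAffine

namespace RandomAffine

/-! ### The stationary solution as an almost sure backward limit -/

section Stationary

lemma eLpNorm_two_le_ofReal_iff {Ω H : Type*} [MeasurableSpace Ω] [NormedAddCommGroup H]
    {P : Measure Ω} {f : Ω → H} (hf : MemLp f 2 P) {c : ℝ} (hc : 0 ≤ c) :
    eLpNorm f 2 P ≤ ENNReal.ofReal c ↔ ∫ ω, ‖f ω‖ ^ 2 ∂P ≤ c ^ 2 := by
  rw [hf.eLpNorm_eq_integral_rpow_norm (by simp) (by simp), ENNReal.ofReal_le_ofReal_iff hc]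
  have h0 : 0 ≤ ∫ ω, ‖f ω‖ ^ 2 ∂P := integral_nonneg fun ω => by positivity
  simp only [ENNReal.toReal_ofNat, Real.rpow_ofNat]
  rw [Real.rpow_inv_le_iff_of_pos h0 hc (by norm_num)]
  simp

variable {Ω T H : Type*} [MeasurableSpace Ω] [MeasurableSpace T] [Fintype T]
  [DiscreteMeasurableSpace T] [NormedAddCommGroup H] [NormedSpace ℝ H]
  [FiniteDimensional ℝ H] [MeasurableSpace H] [BorelSpace H]
  {η : ℤ → Ω → T} {w : T → ℝ} {P : Measure Ω} [IsProbabilityMeasure P]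
  {M : T → H →L[ℝ] H} {e : T → H} {ρ : ℝ}

/-- The limit of the backward compositions, started at `0`. -/
def stat (M : T → H →L[ℝ] H) (e : T → H) (x : ℤ → T) (k : ℤ) : H :=
  limUnder atTop fun n => bwd M e x n k 0

lemma stat_shift (x : ℤ → T) (k j : ℤ) :
    stat M e (fun i => x (i + j)) k = stat M e x (k + j) := by
  simp [stat, bwd_shift]

/-- The backward compositions are Cauchy in `L²` at a geometric, hence summable, rate, and this
forces almost sure convergence. -/
lemma ae_exists_tendsto_bwd (hη : IsIIDSeq η w P) (hM : IsMeanContractive M w ρ) (k : ℤ) (v : H) :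
    ∀ᵐ ω ∂P, ∃ l, Tendsto (fun n => bwd M e (η · ω) n k v) atTop (𝓝 l) := by
  have : CompleteSpace H := FiniteDimensional.complete ℝ H
  obtain ⟨C, hC0, hC⟩ := exists_integral_norm_bwd_sub_sq_le hη hM e v v
  have hρ := hM.pos
  have hr1 : √ρ < 1 := by rw [Real.sqrt_lt' one_pos]; simpa using hM.lt_one
  refine Lp.ae_tendsto_of_cauchy_eLpNorm (p := 2)
    -- The `+ 1` turns the available estimate into the strict inequality that is required.
    (B := fun N => ENNReal.ofReal ((√(2 * C) + 1) * √ρ ^ N))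
    (fun n => (hη.measurable_bwd n k v).aestronglyMeasurable) (by norm_num) ?_ ?_
  · exact (Summable.tsum_ofReal_lt_top
      ((summable_geometric_of_lt_one (by positivity) hr1).mul_left _)).ne
  · intro N n m hn hm
    have h1 : ∫ ω, ‖bwd M e (η · ω) n k v - bwd M e (η · ω) m k v‖ ^ 2 ∂P ≤
        (√(2 * C) * √ρ ^ N) ^ 2 := by
      refine (hC n m k).trans ?_
      rw [mul_pow, Real.sq_sqrt (by positivity), ← pow_mul, mul_comm N 2, pow_mul,
        Real.sq_sqrt hρ.le]
      have h1 : ρ ^ n ≤ ρ ^ N := pow_le_pow_of_le_one hρ.le hM.lt_one.le hn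
      have h2 : ρ ^ m ≤ ρ ^ N := pow_le_pow_of_le_one hρ.le hM.lt_one.le hm
      nlinarith
    refine lt_of_le_of_lt ((eLpNorm_two_le_ofReal_iff
      ((memLp_bwd hη (memLp_const v)).sub (memLp_bwd hη (memLp_const v))) (by positivity)).2 h1) ?_
    rw [ENNReal.ofReal_lt_ofReal_iff (by positivity)]
    have : 0 < √ρ ^ N := by positivity
    linarith

/-- The expectations of the squared norms are summable, so almost surely the squared norms are
summable and tend to zero. -/
lemma ae_tendsto_linear_zero (hη : IsIIDSeq η w P) (hM : IsMeanContractive M w ρ) (k : ℤ) (v : H) :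
    ∀ᵐ ω ∂P, Tendsto (fun n => bwd M 0 (η · ω) n k v) atTop (𝓝 0) := by
  have hρ := hM.pos
  have hint : ∀ n, Integrable (fun ω => ‖bwd M 0 (η · ω) n k v‖ ^ 2) P := fun n =>
    (memLp_bwd hη (memLp_const v)).integrable_norm_pow (by simp)
  have h1 : ∀ n : ℕ, ∫⁻ ω, ENNReal.ofReal (‖bwd M 0 (η · ω) n k v‖ ^ 2) ∂P ≤
      ENNReal.ofReal (ρ ^ n * ‖v‖ ^ 2) := by
    intro n
    rw [← ofReal_integral_eq_lintegral_ofReal (hint n) (ae_of_all _ fun ω => by positivity)]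
    refine ENNReal.ofReal_le_ofReal ?_
    simpa using integral_norm_sq_linear_le hη hM n k (W := fun _ => v) measurable_const
      (memLp_const v)
  have h2 : ∫⁻ ω, ∑' n, ENNReal.ofReal (‖bwd M 0 (η · ω) n k v‖ ^ 2) ∂P ≠ ⊤ := by
    rw [lintegral_tsum fun n => ((hint n).1.aemeasurable).ennreal_ofReal]
    refine ne_top_of_le_ne_top ?_ (ENNReal.tsum_le_tsum h1)
    exact (Summable.tsum_ofReal_lt_top
      ((summable_geometric_of_lt_one hρ.le hM.lt_one).mul_right _)).ne
  filter_upwards [ae_lt_top' (AEMeasurable.tsum fun n =>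
    ((hint n).1.aemeasurable).ennreal_ofReal) h2] with ω hω
  have h3 := (ENNReal.tendsto_toReal ENNReal.zero_ne_top).comp
    (ENNReal.tendsto_atTop_zero_of_tsum_ne_top hω.ne)
  rw [tendsto_zero_iff_norm_tendsto_zero]
  have h4 : Tendsto (fun n => ‖bwd M 0 (η · ω) n k v‖ ^ 2) atTop (𝓝 0) := by
    simpa [Function.comp_def] using h3
  have h5 := (Real.continuous_sqrt.tendsto 0).comp h4
  simpa [Function.comp_def] using h5

lemma bwd_linear_add (x : ℤ → T) (n : ℕ) (k : ℤ) (u v : H) :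
    bwd M 0 x n k (u + v) = bwd M 0 x n k u + bwd M 0 x n k v := by
  induction n generalizing k with
  | zero => simp
  | succ n ih => simp [bwd_succ, ih]

lemma bwd_linear_smul (x : ℤ → T) (n : ℕ) (k : ℤ) (c : ℝ) (v : H) :
    bwd M 0 x n k (c • v) = c • bwd M 0 x n k v := by
  induction n generalizing k with
  | zero => simp
  | succ n ih => simp [bwd_succ, ih]

lemma bwd_linear_zero (x : ℤ → T) (n : ℕ) (k : ℤ) : bwd M 0 x n k 0 = 0 := by
  simpa using bwd_linear_smul (M := M) x n k 0 0

/-- Almost surely the backward compositions converge, for all starting points at once. -/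
theorem ae_tendsto_bwd (hη : IsIIDSeq η w P) (hM : IsMeanContractive M w ρ) (e : T → H) (k : ℤ) :
    ∀ᵐ ω ∂P, ∀ v, Tendsto (fun n => bwd M e (η · ω) n k v) atTop (𝓝 (stat M e (η · ω) k)) := by
  let b := Module.finBasis ℝ H
  -- Only finitely many null sets are discarded, one for each basis vector and one for the start
  -- `0`; linearity then reaches every starting point outside them.
  have hb : ∀ᵐ ω ∂P, ∀ i, Tendsto (fun n => bwd M 0 (η · ω) n k (b i)) atTop (𝓝 0) :=
    ae_all_iff.2 fun i => ae_tendsto_linear_zero hη hM k (b i)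
  filter_upwards [hb, ae_exists_tendsto_bwd (e := e) hη hM k 0] with ω hω h0 v
  have h0' : Tendsto (fun n => bwd M e (η · ω) n k 0) atTop (𝓝 (stat M e (η · ω) k)) :=
    tendsto_nhds_limUnder h0
  have hlin : Tendsto (fun n => bwd M 0 (η · ω) n k v) atTop (𝓝 0) := by
    rw [← b.sum_repr v]
    have h1 : ∀ n, bwd M 0 (η · ω) n k (∑ i, b.repr v i • b i) =
        ∑ i, b.repr v i • bwd M 0 (η · ω) n k (b i) := by
      intro n
      let A : H →+ H := ⟨⟨bwd M 0 (η · ω) n k, bwd_linear_zero _ _ _⟩, bwd_linear_add _ _ _⟩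
      refine (map_sum A _ _).trans (Finset.sum_congr rfl fun i _ => bwd_linear_smul _ _ _ _ _)
    simp_rw [h1]
    simpa using tendsto_finsetSum (Finset.univ) fun i _ => (hω i).const_smul (b.repr v i)
  have h2 : ∀ n, bwd M e (η · ω) n k v = bwd M e (η · ω) n k 0 + bwd M 0 (η · ω) n k v := by
    intro n
    rw [← sub_eq_iff_eq_add', bwd_sub, sub_zero]
  simp_rw [h2]
  simpa using h0'.add hlin

lemma measurable_stat_sigmaOn (k : ℤ) {S : Set ℤ} (hS : Set.Iic k ⊆ S) :
    Measurable[sigmaOn η S] fun ω => stat M e (η · ω) k := by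
  have : CompleteSpace H := FiniteDimensional.complete ℝ H
  have h : ∀ n, StronglyMeasurable[sigmaOn η S] fun ω => bwd M e (η · ω) n k 0 := fun n =>
    Measurable.stronglyMeasurable
      (measurable_bwd_sigmaOn (fun i hi => hS hi.2) measurable_const)
  exact (@StronglyMeasurable.limUnder _ _ _ (sigmaOn η S) _ _ _ _ _ _ _ h).measurable

lemma measurable_stat_path (k : ℤ) : Measurable fun x : ℤ → T => stat M e x k := by
  have : CompleteSpace H := FiniteDimensional.complete ℝ H
  exact (StronglyMeasurable.limUnder fun n =>
    (measurable_bwd_path n k 0).stronglyMeasurable).measurable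

lemma measurable_stat (hη : IsIIDSeq η w P) (k : ℤ) : Measurable fun ω => stat M e (η · ω) k :=
  (measurable_stat_path k).comp hη.measurable_path

/-- Fatou's lemma carries the Cauchy estimate to the limit. It is stated with `eLpNorm` because
square integrability of `stat` is not yet known: the case `n = 0` is what proves it in `memLp_stat`.
-/
lemma exists_eLpNorm_stat_sub_le (hη : IsIIDSeq η w P) (hM : IsMeanContractive M w ρ) (e : T → H)
    (v : H) :
    ∃ C, 0 ≤ C ∧ ∀ (n : ℕ) (k : ℤ),
      eLpNorm (fun ω => stat M e (η · ω) k - bwd M e (η · ω) n k v) 2 P ≤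
        ENNReal.ofReal √(C * ρ ^ n) := by
  obtain ⟨C, hC0, hC⟩ := exists_integral_norm_bwd_sub_sq_le hη hM e v v
  have hρ := hM.pos
  refine ⟨2 * C, by positivity, fun n k => ?_⟩
  refine (Lp.eLpNorm_lim_le_liminf_eLpNorm (p := 2)
    (f := fun m ω => bwd M e (η · ω) m k v - bwd M e (η · ω) n k v)
    (fun m => ((hη.measurable_bwd m k v).sub (hη.measurable_bwd n k v)).aestronglyMeasurable) _
    ?_).trans ?_
  · filter_upwards [ae_tendsto_bwd hη hM e k] with ω hω
    exact (hω v).sub_const _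
  · refine liminf_le_of_frequently_le' (Eventually.frequently ?_)
    filter_upwards [eventually_ge_atTop n] with m hm
    refine (eLpNorm_two_le_ofReal_iff
      ((memLp_bwd hη (memLp_const v)).sub (memLp_bwd hη (memLp_const v))) (by positivity)).2 ?_
    rw [Real.sq_sqrt (by positivity)]
    refine (hC m n k).trans ?_
    have h1 : ρ ^ m ≤ ρ ^ n := pow_le_pow_of_le_one hρ.le hM.lt_one.le hm
    nlinarith

lemma memLp_stat (hη : IsIIDSeq η w P) (hM : IsMeanContractive M w ρ) (e : T → H) (k : ℤ) :
    MemLp (fun ω => stat M e (η · ω) k) 2 P := by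
  obtain ⟨C, hC0, hC⟩ := exists_eLpNorm_stat_sub_le hη hM e 0
  have h1 : MemLp (fun ω => stat M e (η · ω) k - bwd M e (η · ω) 0 k 0) 2 P :=
    ⟨((measurable_stat hη k).sub (hη.measurable_bwd 0 k 0)).aestronglyMeasurable,
      (hC 0 k).trans_lt ENNReal.ofReal_lt_top⟩
  simpa using h1

lemma exists_integral_norm_stat_sub_sq_le (hη : IsIIDSeq η w P) (hM : IsMeanContractive M w ρ)
    (e : T → H) (v : H) :
    ∃ C, 0 ≤ C ∧ ∀ (n : ℕ) (k : ℤ),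
      ∫ ω, ‖stat M e (η · ω) k - bwd M e (η · ω) n k v‖ ^ 2 ∂P ≤ C * ρ ^ n := by
  obtain ⟨C, hC0, hC⟩ := exists_eLpNorm_stat_sub_le hη hM e v
  have hρ := hM.pos
  refine ⟨C, hC0, fun n k => ?_⟩
  have := (eLpNorm_two_le_ofReal_iff ((memLp_stat hη hM e k).sub (memLp_bwd hη (memLp_const v)))
    (by positivity)).1 (hC n k)
  rwa [Real.sq_sqrt (by positivity)] at this

/-- Pass to the limit in the recursion by continuity of the affine map. The identity holds only
almost surely, since `limUnder` is arbitrary where the limit fails to exist. -/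
lemma ae_stat_eq_step (hη : IsIIDSeq η w P) (hM : IsMeanContractive M w ρ) (e : T → H) (k : ℤ) :
    ∀ᵐ ω ∂P, stat M e (η · ω) k = M (η k ω) (stat M e (η · ω) (k - 1)) + e (η k ω) := by
  filter_upwards [ae_tendsto_bwd hη hM e k, ae_tendsto_bwd hη hM e (k - 1)] with ω h1 h2
  refine tendsto_nhds_unique ((h1 0).comp (tendsto_add_atTop_nat 1)) ?_
  exact (((M (η k ω)).continuous.tendsto _).comp (h2 0)).add_const _

/-- An i.i.d. sequence is stationary. -/
lemma IsIIDSeq.identDistrib_shift (hη : IsIIDSeq η w P) (j : ℤ) :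
    IdentDistrib (fun ω i => η (i + j) ω) (fun ω i => η i ω) P P where
  aemeasurable_fst := (measurable_pi_lambda _ fun i => hη.meas (i + j)).aemeasurable
  aemeasurable_snd := hη.measurable_path.aemeasurable
  map_eq := by
    rw [hη.indep.map_fun_eq_infinitePi_map hη.meas,
      iIndepFun.map_fun_eq_infinitePi_map (X := fun i => η (i + j)) (fun i => hη.meas _)
        (hη.indep.precomp (add_left_injective j))]
    congr 1
    ext1 i
    have := fun k => Measure.isProbabilityMeasure_map (μ := P) (hη.meas k).aemeasurable
    refine Measure.ext_of_singleton fun t => ?_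
    rw [← measureReal_eq_measureReal_iff, map_measureReal_apply (hη.meas _) (.singleton t),
      map_measureReal_apply (hη.meas _) (.singleton t), hη.weight, hη.weight]

lemma IsIIDSeq.integral_shift (hη : IsIIDSeq η w P) (j : ℤ) {F : (ℤ → T) → ℝ}
    (hF : Measurable F) : ∫ ω, F (fun i => η (i + j) ω) ∂P = ∫ ω, F (η · ω) ∂P :=
  ((hη.identDistrib_shift j).comp hF).integral_eq

end Stationary

end RandomAffine

namespace RandomAffine

/-! ### Martingale increments and the long-run covariance -/

section LongRun

open scoped RealInnerProductSpace

variable {Ω T H : Type*} [MeasurableSpace Ω] [MeasurableSpace T] [Fintype T]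
  [DiscreteMeasurableSpace T] [NormedAddCommGroup H] [InnerProductSpace ℝ H]
  [FiniteDimensional ℝ H] [CompleteSpace H] [MeasurableSpace H] [BorelSpace H]
  {η : ℤ → Ω → T} {w : T → ℝ} {P : Measure Ω} [IsProbabilityMeasure P]
  {M : T → H →L[ℝ] H} {e : T → H} {ρ : ℝ}

/-- The adjoint of the mean of the random linear map. -/
def meanAdj (M : T → H →L[ℝ] H) (w : T → ℝ) : H →L[ℝ] H :=
  ∑ t, w t • (M t).adjoint

lemma inner_meanAdj (a v : H) : ⟪meanAdj M w a, v⟫ = ∑ t, w t * ⟪a, M t v⟫ := by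
  simp [meanAdj, sum_inner, real_inner_smul_left, ContinuousLinearMap.adjoint_inner_left]

/-- For `v = L a` one has `‖v‖² = E⟪a, M v⟫ ≤ ‖a‖ E‖M v‖`, and Jensen bounds `E‖M v‖` by `√ρ ‖v‖`.
Mean-square contraction thus makes the mean map a contraction, and the Neumann series is available.
-/
lemma norm_meanAdj_lt_one (hη : IsIIDSeq η w P) (hM : IsMeanContractive M w ρ) :
    ‖meanAdj M w‖ < 1 := by
  have hr1 : √ρ < 1 := by rw [Real.sqrt_lt' one_pos]; simpa using hM.lt_one
  refine lt_of_le_of_lt (ContinuousLinearMap.opNorm_le_bound _ (Real.sqrt_nonneg ρ) fun a => ?_) hr1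
  set v := meanAdj M w a with hv
  have h1 : (∑ t, w t * ‖M t v‖) ^ 2 ≤ ∑ t, w t * ‖M t v‖ ^ 2 :=
    Real.pow_arith_mean_le_arith_mean_pow _ _ _ (fun t _ => hη.weight_nonneg t) hη.sum_weight
      (fun t _ => norm_nonneg _) 2
  have h2 : ∑ t, w t * ‖M t v‖ ≤ √ρ * ‖v‖ := by
    refine (Real.le_sqrt_of_sq_le (h1.trans (hM.bound v))).trans ?_
    rw [Real.sqrt_mul hM.pos.le, Real.sqrt_sq (norm_nonneg v)]
  have h3 : ‖v‖ ^ 2 ≤ ‖a‖ * (√ρ * ‖v‖) := by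
    rw [← real_inner_self_eq_norm_sq]
    nth_rw 1 [hv]
    rw [inner_meanAdj]
    calc ∑ t, w t * ⟪a, M t v⟫ ≤ ∑ t, w t * (‖a‖ * ‖M t v‖) := by
          gcongr with t
          · exact hη.weight_nonneg t
          · exact real_inner_le_norm _ _
      _ = ‖a‖ * ∑ t, w t * ‖M t v‖ := by rw [Finset.mul_sum]; congr 1; ext t; ring
      _ ≤ _ := by gcongr
  rcases (norm_nonneg v).eq_or_lt with h | h
  · rw [← h]; positivity
  · nlinarith

/-- The resolvent `(1 - L)⁻¹ = ∑ Lⁿ` of the adjoint mean map. -/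
def resolvent (M : T → H →L[ℝ] H) (w : T → ℝ) : H →L[ℝ] H := ∑' n : ℕ, meanAdj M w ^ n

lemma resolvent_sub (hL : ‖meanAdj M w‖ < 1) (a : H) :
    resolvent M w a - meanAdj M w (resolvent M w a) = a := by
  have h := mul_neg_geom_series (meanAdj M w) hL
  have h2 := congrArg (fun A : H →L[ℝ] H => A a) h
  simpa [sub_mul, resolvent] using h2

lemma hasSum_resolvent (hL : ‖meanAdj M w‖ < 1) (a : H) :
    HasSum (fun n : ℕ => (meanAdj M w ^ n) a) (resolvent M w a) :=
  ((ContinuousLinearMap.apply ℝ H a).hasSum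
    (summable_geometric_of_norm_lt_one hL).hasSum)

/-- The increment `⟪a, M t u + e t⟫ - ⟪L a, u⟫`, which is centred when `t` is random. -/
def incr (M : T → H →L[ℝ] H) (e : T → H) (w : T → ℝ) (a : H) (t : T) (u : H) : ℝ :=
  ⟪a, M t u + e t⟫ - ⟪meanAdj M w a, u⟫

lemma sum_weight_mul_incr (hη : IsIIDSeq η w P) (he : ∑ t, w t • e t = 0) (a u : H) :
    ∑ t, w t * incr M e w a t u = 0 := by
  have h1 : ∑ t, w t * ⟪a, e t⟫ = 0 := by
    have := congrArg (fun v => ⟪a, v⟫) he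
    simpa [inner_sum, real_inner_smul_right] using this
  simp only [incr, inner_add_right, mul_sub, mul_add, Finset.sum_sub_distrib,
    Finset.sum_add_distrib, h1, ← Finset.sum_mul, hη.sum_weight, one_mul, add_zero]
  rw [inner_meanAdj, sub_self]

lemma measurable_incr {m : MeasurableSpace Ω} {f : Ω → T} {W : Ω → H} (a : H)
    (hf : Measurable f) (hW : Measurable W) : Measurable fun ω => incr M e w a (f ω) (W ω) :=
  ((measurable_step hf hW).const_inner).sub hW.const_inner

lemma exists_abs_incr_sub_le (M : T → H →L[ℝ] H) (e : T → H) (w : T → ℝ) (a : H) :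
    ∃ c, 0 ≤ c ∧ ∀ t u v, |incr M e w a t u - incr M e w a t v| ≤ c * ‖u - v‖ := by
  refine ⟨∑ t, ‖a‖ * ‖M t‖ + ‖meanAdj M w a‖, by positivity, fun t u v => ?_⟩
  have h1 : incr M e w a t u - incr M e w a t v =
      ⟪a, M t (u - v)⟫ - ⟪meanAdj M w a, u - v⟫ := by
    simp only [incr, inner_add_right, map_sub, inner_sub_right]
    ring
  rw [h1]
  refine (abs_sub _ _).trans ?_
  rw [add_mul]
  refine add_le_add ((abs_real_inner_le_norm _ _).trans ?_) (abs_real_inner_le_norm _ _)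
  calc ‖a‖ * ‖M t (u - v)‖ ≤ ‖a‖ * (‖M t‖ * ‖u - v‖) := by gcongr; exact (M t).le_opNorm _
    _ = (‖a‖ * ‖M t‖) * ‖u - v‖ := by ring
    _ ≤ _ := by
      gcongr
      exact Finset.single_le_sum (f := fun t => ‖a‖ * ‖M t‖) (fun t _ => by positivity)
        (Finset.mem_univ t)

lemma exists_abs_incr_le (M : T → H →L[ℝ] H) (e : T → H) (w : T → ℝ) (a : H) :
    ∃ c, 0 ≤ c ∧ ∀ t u, |incr M e w a t u| ≤ c * (1 + ‖u‖) := by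
  obtain ⟨c, hc0, hc⟩ := exists_abs_incr_sub_le M e w a
  refine ⟨c + ∑ t, |incr M e w a t 0|, by positivity, fun t u => ?_⟩
  have h1 := hc t u 0
  have h2 : |incr M e w a t 0| ≤ ∑ t, |incr M e w a t 0| :=
    Finset.single_le_sum (f := fun t => |incr M e w a t 0|) (fun t _ => abs_nonneg _)
        (Finset.mem_univ t)
  have h3 : |incr M e w a t u| ≤ |incr M e w a t u - incr M e w a t 0| + |incr M e w a t 0| := by
    simpa using abs_add_le (incr M e w a t u - incr M e w a t 0) (incr M e w a t 0)
  have h4 : 0 ≤ (∑ t, |incr M e w a t 0|) * ‖u‖ := by positivity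
  rw [sub_zero] at h1
  linarith

/-- The increments are martingale differences. -/
lemma integral_incr_smul_eq_zero {E : Type*} [NormedAddCommGroup E] [NormedSpace ℝ E]
    [CompleteSpace E] (hη : IsIIDSeq η w P) (he : ∑ t, w t • e t = 0) {S : Set ℤ} {k : ℤ}
    (hk : k ∉ S) (a : H) {W : Ω → H} (hWm : Measurable[sigmaOn η S] W) {Y : Ω → E}
    (hYm : StronglyMeasurable[sigmaOn η S] Y) (hY : Integrable Y P)
    (hWY : Integrable (fun ω => ‖W ω‖ • Y ω) P) :
    ∫ ω, incr M e w a (η k ω) (W ω) • Y ω ∂P = 0 := by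
  obtain ⟨c, hc0, hc⟩ := exists_abs_incr_le M e w a
  have hle := hη.sigmaOn_le S
  have hm : ∀ t, StronglyMeasurable[sigmaOn η S] fun ω => incr M e w a t (W ω) • Y ω := fun t =>
    (measurable_incr a measurable_const hWm).stronglyMeasurable.smul hYm
  have hi : ∀ t, Integrable (fun ω => incr M e w a t (W ω) • Y ω) P := by
    intro t
    refine ((hY.norm.add hWY.norm).const_mul c).mono' ((hm t).mono hle).aestronglyMeasurable
      (ae_of_all _ fun ω => ?_)
    simp only [norm_smul, Pi.add_apply, abs_norm, Real.norm_eq_abs]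
    calc _ ≤ c * (1 + ‖W ω‖) * ‖Y ω‖ := by gcongr; exact hc t (W ω)
      _ = _ := by ring
  rw [hη.integral_freeze (g := fun t ω => incr M e w a t (W ω) • Y ω) hk hm hi]
  simp_rw [← integral_smul]
  have hi' : ∀ t ∈ Finset.univ, Integrable (fun ω => w t • incr M e w a t (W ω) • Y ω) P :=
    fun t _ => (hi t).smul (w t)
  rw [← integral_finsetSum _ hi']
  simp_rw [smul_smul, ← Finset.sum_smul, sum_weight_mul_incr hη he, zero_smul, integral_zero]

lemma memLp_incr (hη : IsIIDSeq η w P) (a : H) {k : ℤ} {W : Ω → H} (hW : MemLp W 2 P) :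
    MemLp (fun ω => incr M e w a (η k ω) (W ω)) 2 P :=
  ((memLp_step hη hW).const_inner a).sub (hW.const_inner _)

/-- Against a variable of the past the increment integrates to zero, so one step back in time
replaces `a` by `L a`. Iterating this gives all autocovariances. -/
lemma integral_mul_incr_stat (hη : IsIIDSeq η w P) (hM : IsMeanContractive M w ρ)
    (he : ∑ t, w t • e t = 0) (k : ℤ) (a : H) {Y : Ω → ℝ}
    (hYm : Measurable[sigmaOn η (Set.Iic (k - 1))] Y) (hY : MemLp Y 2 P) :
    ∫ ω, ⟪a, stat M e (η · ω) k⟫ * Y ω ∂P =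
      ∫ ω, ⟪meanAdj M w a, stat M e (η · ω) (k - 1)⟫ * Y ω ∂P := by
  have hst := memLp_stat hη hM e
  have h1 := integral_incr_smul_eq_zero (M := M) (e := e) (k := k) (S := Set.Iic (k - 1)) hη he
    (by simp) a (measurable_stat_sigmaOn (M := M) (e := e) (k - 1) subset_rfl)
    hYm.stronglyMeasurable (hY.integrable (by norm_num)) ((hst (k - 1)).norm.integrable_mul hY)
  have i1 : Integrable (fun ω => ⟪a, stat M e (η · ω) k⟫ * Y ω) P :=
    ((hst k).const_inner a).integrable_mul hY
  have i2 : Integrable (fun ω => ⟪meanAdj M w a, stat M e (η · ω) (k - 1)⟫ * Y ω) P :=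
    ((hst (k - 1)).const_inner _).integrable_mul hY
  rw [← sub_eq_zero, ← integral_sub i1 i2, ← h1]
  refine integral_congr_ae ?_
  filter_upwards [ae_stat_eq_step hη hM e k] with ω hω
  rw [hω]
  simp only [incr, smul_eq_mul]
  ring

lemma integral_stat_shift (hη : IsIIDSeq η w P) (k : ℤ) {F : H → ℝ} (hF : Measurable F) :
    ∫ ω, F (stat M e (η · ω) k) ∂P = ∫ ω, F (stat M e (η · ω) 0) ∂P := by
  rw [← hη.integral_shift k (F := fun x => F (stat M e x 0)) (hF.comp (measurable_stat_path 0))]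
  refine integral_congr_ae (ae_of_all _ fun ω => ?_)
  have := stat_shift (M := M) (e := e) (fun i => η i ω) 0 k
  rw [zero_add] at this
  exact congrArg F this.symm

/-- By stationarity the mean functional takes the same value at `b` and `L b`. Taking `b = R a` it
vanishes at `R a - L R a = a`. -/
lemma integral_inner_stat (hη : IsIIDSeq η w P) (hM : IsMeanContractive M w ρ)
    (he : ∑ t, w t • e t = 0) (k : ℤ) (a : H) : ∫ ω, ⟪a, stat M e (η · ω) k⟫ ∂P = 0 := by
  rw [integral_stat_shift hη k (F := fun u => ⟪a, u⟫) (by fun_prop)]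
  have hL := norm_meanAdj_lt_one hη hM
  have key : ∀ b, ∫ ω, ⟪b, stat M e (η · ω) 0⟫ ∂P =
      ∫ ω, ⟪meanAdj M w b, stat M e (η · ω) 0⟫ ∂P := by
    intro b
    have := integral_mul_incr_stat hη hM he 0 b (Y := fun _ => 1) measurable_const (memLp_const 1)
    simp only [mul_one] at this
    rw [this, integral_stat_shift hη (0 - 1) (F := fun u => ⟪meanAdj M w b, u⟫) (by fun_prop)]
  have hi : ∀ b, Integrable (fun ω => ⟪b, stat M e (η · ω) 0⟫) P := fun b =>
    ((memLp_stat hη hM e 0).const_inner b).integrable (by norm_num)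
  have h2 := key (resolvent M w a)
  rw [← sub_eq_zero, ← integral_sub (hi _) (hi _)] at h2
  simp_rw [← inner_sub_left, resolvent_sub hL] at h2
  exact h2

/-- The covariance form of the stationary variable. -/
def covForm (hη : IsIIDSeq η w P) (hM : IsMeanContractive M w ρ) (e : T → H) : H →ₗ[ℝ] H →ₗ[ℝ] ℝ :=
  have hi : ∀ a b : H, Integrable (fun ω => ⟪a, stat M e (η · ω) 0⟫ * ⟪b, stat M e (η · ω) 0⟫) P :=
    fun a b => ((memLp_stat hη hM e 0).const_inner a).integrable_mul
      ((memLp_stat hη hM e 0).const_inner b)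
  LinearMap.mk₂ ℝ (fun a b => ∫ ω, ⟪a, stat M e (η · ω) 0⟫ * ⟪b, stat M e (η · ω) 0⟫ ∂P)
    (fun a a' b => by simp_rw [inner_add_left, add_mul]; exact integral_add (hi _ _) (hi _ _))
    (fun c a b => by
      simp_rw [real_inner_smul_left, mul_assoc, integral_const_mul, smul_eq_mul])
    (fun a b b' => by simp_rw [inner_add_left, mul_add]; exact integral_add (hi _ _) (hi _ _))
    (fun c a b => by
      simp_rw [real_inner_smul_left, mul_left_comm _ c, integral_const_mul, smul_eq_mul])

lemma covForm_apply (hη : IsIIDSeq η w P) (hM : IsMeanContractive M w ρ) (a b : H) :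
    covForm hη hM e a b = ∫ ω, ⟪a, stat M e (η · ω) 0⟫ * ⟪b, stat M e (η · ω) 0⟫ ∂P := rfl

lemma covForm_comm (hη : IsIIDSeq η w P) (hM : IsMeanContractive M w ρ) (a b : H) :
    covForm hη hM e a b = covForm hη hM e b a := by
  simp_rw [covForm_apply, mul_comm]

lemma continuous_covForm (hη : IsIIDSeq η w P) (hM : IsMeanContractive M w ρ) (b : H) :
    Continuous fun a => covForm hη hM e a b :=
  ((covForm hη hM e).flip b).continuous_of_finiteDimensional

lemma hasSum_covForm (hη : IsIIDSeq η w P) (hM : IsMeanContractive M w ρ) (b : H) {f : ℕ → H}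
    {a : H} (hf : HasSum f a) :
    HasSum (fun n => covForm hη hM e (f n) b) (covForm hη hM e a b) := by
  have hc := continuous_covForm (e := e) hη hM b
  generalize covForm hη hM e = B at hc ⊢
  exact hf.map (B.flip b) hc

lemma integral_inner_mul_inner_stat (hη : IsIIDSeq η w P) (hM : IsMeanContractive M w ρ)
    (he : ∑ t, w t • e t = 0) (j : ℤ) (n : ℕ) (a b : H) :
    ∫ ω, ⟪a, stat M e (η · ω) (j + n)⟫ * ⟪b, stat M e (η · ω) j⟫ ∂P =
      covForm hη hM e ((meanAdj M w ^ n) a) b := by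
  induction n generalizing a with
  | zero =>
    rw [covForm_apply]
    simpa using integral_stat_shift (M := M) (e := e) hη j (F := fun u => ⟪a, u⟫ * ⟪b, u⟫)
      (by fun_prop)
  | succ n ih =>
    rw [integral_mul_incr_stat hη hM he (j + (n + 1 : ℕ)) a (Y := fun ω => ⟪b, stat M e (η · ω) j⟫)
      (Measurable.const_inner (measurable_stat_sigmaOn j
        (Set.Iic_subset_Iic.2 (by push_cast; omega))))
      ((memLp_stat hη hM e j).const_inner b)]
    have h1 : j + ((n + 1 : ℕ) : ℤ) - 1 = j + n := by push_cast; ring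
    rw [h1, ih, pow_succ]
    rfl

/-- The long-run covariance form. -/
def longRunForm (hη : IsIIDSeq η w P) (hM : IsMeanContractive M w ρ) (e : T → H) :
    H →ₗ[ℝ] H →ₗ[ℝ] ℝ :=
  (covForm hη hM e).compl₁₂ (resolvent M w).toLinearMap (resolvent M w).toLinearMap -
    (covForm hη hM e).compl₁₂ (meanAdj M w ∘L resolvent M w).toLinearMap
      (meanAdj M w ∘L resolvent M w).toLinearMap

lemma longRunForm_apply (hη : IsIIDSeq η w P) (hM : IsMeanContractive M w ρ) (a b : H) :
    longRunForm hη hM e a b = covForm hη hM e (resolvent M w a) (resolvent M w b) -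
      covForm hη hM e (meanAdj M w (resolvent M w a)) (meanAdj M w (resolvent M w b)) := rfl

lemma longRunForm_comm (hη : IsIIDSeq η w P) (hM : IsMeanContractive M w ρ) (a b : H) :
    longRunForm hη hM e a b = longRunForm hη hM e b a := by
  rw [longRunForm_apply, longRunForm_apply, covForm_comm hη hM (resolvent M w a),
    covForm_comm hη hM (meanAdj M w (resolvent M w a))]

/-- Substitute `a = Ra - LRa` and `b = Rb - LRb`; by symmetry the mixed terms cancel. The two
summands on the left are the sums over nonnegative and over negative lags. -/
lemma covForm_resolvent_add (hη : IsIIDSeq η w P) (hM : IsMeanContractive M w ρ) (a b : H) :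
    covForm hη hM e (resolvent M w b) a + covForm hη hM e (resolvent M w a - a) b =
      longRunForm hη hM e a b := by
  have hL := norm_meanAdj_lt_one hη hM
  rw [longRunForm_apply, covForm_comm hη hM _ a]
  have ha := resolvent_sub hL a
  have hb := resolvent_sub hL b
  generalize covForm hη hM e = B
  generalize resolvent M w a = a' at *
  generalize resolvent M w b = b' at *
  generalize meanAdj M w a' = La at *
  generalize meanAdj M w b' = Lb at *
  subst ha hb
  simp only [map_sub, LinearMap.sub_apply]
  ring

/-- The autocovariance at lag `n ≥ 0` is the covariance form evaluated at `L^n b` and `a`, so each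
half of the two-sided series is geometric and sums to a resolvent. -/
theorem hasSum_longRunForm (hη : IsIIDSeq η w P) (hM : IsMeanContractive M w ρ)
    (he : ∑ t, w t • e t = 0) (a b : H) :
    HasSum (fun k : ℤ => ∫ ω, ⟪a, stat M e (η · ω) 0⟫ * ⟪b, stat M e (η · ω) k⟫ ∂P)
      (longRunForm hη hM e a b) := by
  have hL := norm_meanAdj_lt_one hη hM
  have h1 : HasSum (fun n : ℕ =>
      ∫ ω, ⟪a, stat M e (η · ω) 0⟫ * ⟪b, stat M e (η · ω) (n : ℤ)⟫ ∂P)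
      (covForm hη hM e (resolvent M w b) a) := by
    have heq : ∀ n : ℕ, ∫ ω, ⟪a, stat M e (η · ω) 0⟫ * ⟪b, stat M e (η · ω) (n : ℤ)⟫ ∂P =
        covForm hη hM e ((meanAdj M w ^ n) b) a := by
      intro n
      have h4 := integral_inner_mul_inner_stat hη hM he 0 n b a
      rw [zero_add] at h4
      rw [← h4]
      simp_rw [mul_comm]
    simp_rw [heq]
    exact hasSum_covForm hη hM a (hasSum_resolvent hL b)
  have h2 : HasSum (fun n : ℕ =>
      ∫ ω, ⟪a, stat M e (η · ω) 0⟫ * ⟪b, stat M e (η · ω) (-((n : ℤ) + 1))⟫ ∂P)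
      (covForm hη hM e (resolvent M w a - a) b) := by
    -- Lag zero belongs to the first half, so the negative half starts at `L a` and sums to `R a -
    -- a`.
    have h3 : HasSum (fun n : ℕ => (meanAdj M w ^ (n + 1)) a) (resolvent M w a - a) := by
      have := (hasSum_nat_add_iff' 1).2 (hasSum_resolvent hL a)
      simpa using this
    have heq : ∀ n : ℕ, ∫ ω, ⟪a, stat M e (η · ω) 0⟫ * ⟪b, stat M e (η · ω) (-((n : ℤ) + 1))⟫ ∂P =
        covForm hη hM e ((meanAdj M w ^ (n + 1)) a) b := by
      intro n
      have h4 := integral_inner_mul_inner_stat hη hM he (-((n : ℤ) + 1)) (n + 1) a b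
      have h5 : -((n : ℤ) + 1) + ((n + 1 : ℕ) : ℤ) = 0 := by push_cast; ring
      rwa [h5] at h4
    simp_rw [heq]
    exact hasSum_covForm hη hM b h3
  have h5 := HasSum.of_nat_of_neg_add_one
    (f := fun k : ℤ => ∫ ω, ⟪a, stat M e (η · ω) 0⟫ * ⟪b, stat M e (η · ω) k⟫ ∂P) h1 h2
  rwa [covForm_resolvent_add hη hM] at h5

/-- Expand the square; the mixed term is reduced by `integral_mul_incr_stat` to the variance at `L
a`, so it changes the sign of that term. -/
lemma integral_incr_stat_sq (hη : IsIIDSeq η w P) (hM : IsMeanContractive M w ρ)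
    (he : ∑ t, w t • e t = 0) (k : ℤ) (a : H) :
    ∫ ω, incr M e w a (η k ω) (stat M e (η · ω) (k - 1)) ^ 2 ∂P =
      covForm hη hM e a a - covForm hη hM e (meanAdj M w a) (meanAdj M w a) := by
  have hst := memLp_stat hη hM e
  set b := meanAdj M w a with hb
  have i1 : Integrable (fun ω => ⟪a, stat M e (η · ω) k⟫ * ⟪a, stat M e (η · ω) k⟫) P :=
    ((hst k).const_inner a).integrable_mul ((hst k).const_inner a)
  have i2 : Integrable (fun ω => ⟪b, stat M e (η · ω) (k - 1)⟫ * ⟪b, stat M e (η · ω) (k - 1)⟫) P :=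
    ((hst (k - 1)).const_inner b).integrable_mul ((hst (k - 1)).const_inner b)
  have i3 : Integrable (fun ω => ⟪a, stat M e (η · ω) k⟫ * ⟪b, stat M e (η · ω) (k - 1)⟫) P :=
    ((hst k).const_inner a).integrable_mul ((hst (k - 1)).const_inner b)
  have h1 : ∫ ω, incr M e w a (η k ω) (stat M e (η · ω) (k - 1)) ^ 2 ∂P =
      ∫ ω, (⟪a, stat M e (η · ω) k⟫ * ⟪a, stat M e (η · ω) k⟫ +
        ⟪b, stat M e (η · ω) (k - 1)⟫ * ⟪b, stat M e (η · ω) (k - 1)⟫ -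
        2 * (⟪a, stat M e (η · ω) k⟫ * ⟪b, stat M e (η · ω) (k - 1)⟫)) ∂P := by
    refine integral_congr_ae ?_
    filter_upwards [ae_stat_eq_step hη hM e k] with ω hω
    rw [hω, incr]
    ring
  have i4 : Integrable (fun ω => ⟪a, stat M e (η · ω) k⟫ * ⟪a, stat M e (η · ω) k⟫ +
      ⟪b, stat M e (η · ω) (k - 1)⟫ * ⟪b, stat M e (η · ω) (k - 1)⟫) P := i1.add i2
  have h2 := integral_mul_incr_stat hη hM he k a
    (Y := fun ω => ⟪b, stat M e (η · ω) (k - 1)⟫)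
    (Measurable.const_inner (measurable_stat_sigmaOn (k - 1) subset_rfl))
    ((hst (k - 1)).const_inner b)
  rw [← hb] at h2
  have h3 := integral_stat_shift (M := M) (e := e) hη k (F := fun u => ⟪a, u⟫ * ⟪a, u⟫)
    (by fun_prop)
  have h4 := integral_stat_shift (M := M) (e := e) hη (k - 1) (F := fun u => ⟪b, u⟫ * ⟪b, u⟫)
    (by fun_prop)
  rw [h1, integral_sub i4 (i3.const_mul 2), integral_add i1 i2, integral_const_mul, h2,
    covForm_apply, covForm_apply, h3, h4]
  ring

lemma integral_incr_resolvent_sq (hη : IsIIDSeq η w P) (hM : IsMeanContractive M w ρ)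
    (he : ∑ t, w t • e t = 0) (k : ℤ) (a : H) :
    ∫ ω, incr M e w (resolvent M w a) (η k ω) (stat M e (η · ω) (k - 1)) ^ 2 ∂P =
      longRunForm hη hM e a a := by
  rw [integral_incr_stat_sq hη hM he, longRunForm_apply]

lemma longRunForm_self_nonneg (hη : IsIIDSeq η w P) (hM : IsMeanContractive M w ρ)
    (he : ∑ t, w t • e t = 0) (a : H) : 0 ≤ longRunForm hη hM e a a := by
  rw [← integral_incr_resolvent_sq hη hM he 0 a]
  exact integral_nonneg fun ω => by positivity

end LongRun

end RandomAffine

namespace RandomAffine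

/-! ### A central limit theorem for bounded martingale differences -/

section BoundedMartingale

variable {Ω : Type*} [MeasurableSpace Ω] {P : Measure Ω} [IsProbabilityMeasure P]

lemma integral_abs_le_sqrt {f : Ω → ℝ} (hf : MemLp f 2 P) :
    ∫ ω, |f ω| ∂P ≤ √(∫ ω, f ω ^ 2 ∂P) := by
  have hi : Integrable (fun ω => |f ω|) P := (hf.integrable (by norm_num)).abs
  have h2 : Integrable (fun ω => f ω ^ 2) P := hf.integrable_sq
  refine Real.le_sqrt_of_sq_le ?_
  -- The inequality is the nonnegativity of the variance of `|f|`.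
  set c := ∫ ω, |f ω| ∂P with hc
  have h0 : 0 ≤ ∫ ω, (f ω ^ 2 - 2 * c * |f ω| + c ^ 2) ∂P :=
    integral_nonneg fun ω => by
      have : f ω ^ 2 - 2 * c * |f ω| + c ^ 2 = (|f ω| - c) ^ 2 := by rw [← sq_abs (f ω)]; ring
      simp only [Pi.zero_apply, this]
      positivity
  have i1 : Integrable (fun ω => f ω ^ 2 - 2 * c * |f ω|) P := h2.sub (hi.const_mul _)
  rw [integral_add i1 (integrable_const _), integral_sub h2 (hi.const_mul _), integral_const_mul,
    ← hc] at h0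
  simp only [integral_const, probReal_univ, one_smul] at h0
  linarith

/-- A law of large numbers for bounded sequences with a finite correlation range. -/
lemma tendsto_integral_abs_average {z : ℕ → Ω → ℝ} (hz : ∀ k, Measurable (z k)) {B : ℝ}
    (hB : ∀ k ω, |z k ω| ≤ B) {m : ℕ}
    (hcov : ∀ j k, j + m < k → ∫ ω, z j ω * z k ω ∂P = 0) :
    Tendsto (fun n : ℕ => ∫ ω, |(n : ℝ)⁻¹ * ∑ k ∈ Finset.range n, z k ω| ∂P) atTop (𝓝 0) := by
  obtain ⟨ω₀⟩ := nonempty_of_isProbabilityMeasure P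
  have hB0 : 0 ≤ B := (abs_nonneg _).trans (hB 0 ω₀)
  have hmem : ∀ k, MemLp (z k) 2 P := fun k =>
    MemLp.of_bound (hz k).aestronglyMeasurable B (ae_of_all _ (hB k))
  have hint : ∀ j k, Integrable (fun ω => z j ω * z k ω) P := fun j k =>
    (hmem j).integrable_mul (hmem k)
  have hpair : ∀ j k, ∫ ω, z j ω * z k ω ∂P ≤
      if k ∈ Finset.Icc (j - m) (j + m) then B ^ 2 else 0 := by
    intro j k
    split_ifs with h
    · calc ∫ ω, z j ω * z k ω ∂P ≤ ∫ _, B ^ 2 ∂P := by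
            refine integral_mono (hint j k) (integrable_const _) fun ω => ?_
            calc z j ω * z k ω ≤ |z j ω * z k ω| := le_abs_self _
              _ = |z j ω| * |z k ω| := abs_mul _ _
              _ ≤ B * B := by gcongr <;> exact hB _ _
              _ = B ^ 2 := by ring
        _ = B ^ 2 := by simp
    · rw [Finset.mem_Icc, not_and_or] at h
      rcases h with h | h
      · simp_rw [mul_comm (z j _)]
        exact (hcov k j (by omega)).le
      · exact (hcov j k (by omega)).le
  -- Each index correlates with at most `2m + 1` others, itself included, so the second moment of
  -- the sum grows linearly and that of the average is `O(1/n)`.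
  have hsq : ∀ n : ℕ, ∫ ω, (∑ k ∈ Finset.range n, z k ω) ^ 2 ∂P ≤ n * ((2 * m + 1) * B ^ 2) := by
    intro n
    simp_rw [sq (∑ k ∈ Finset.range n, z k _), Finset.sum_mul_sum]
    rw [integral_finsetSum _ fun j _ => integrable_finsetSum _ fun k _ => hint j k]
    simp_rw [integral_finsetSum _ fun k (_ : k ∈ Finset.range n) => hint _ k]
    calc _ ≤ ∑ j ∈ Finset.range n, ∑ k ∈ Finset.range n,
          (if k ∈ Finset.Icc (j - m) (j + m) then B ^ 2 else 0) :=
          Finset.sum_le_sum fun j _ => Finset.sum_le_sum fun k _ => hpair j k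
      _ ≤ ∑ j ∈ Finset.range n, (2 * m + 1) * B ^ 2 := by
          refine Finset.sum_le_sum fun j _ => ?_
          rw [← Finset.sum_filter, Finset.sum_const, nsmul_eq_mul]
          gcongr
          have h1 : (Finset.range n).filter (fun k => k ∈ Finset.Icc (j - m) (j + m)) ⊆
              Finset.Icc (j - m) (j + m) := fun k hk => (Finset.mem_filter.1 hk).2
          have h2 := Finset.card_le_card h1
          rw [Nat.card_Icc] at h2
          have h3 : (Finset.filter (fun k => k ∈ Finset.Icc (j - m) (j + m))
            (Finset.range n)).card ≤ 2 * m + 1 := by omega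
          exact_mod_cast h3
      _ = _ := by simp
  have hsum : ∀ n : ℕ, MemLp (fun ω => (n : ℝ)⁻¹ * ∑ k ∈ Finset.range n, z k ω) 2 P := fun n =>
    (memLp_finsetSum _ fun k _ => hmem k).const_mul _
  have hlim : Tendsto (fun n : ℕ => √((n : ℝ)⁻¹ * ((2 * m + 1) * B ^ 2))) atTop (𝓝 0) := by
    have h1 : Tendsto (fun n : ℕ => (n : ℝ)⁻¹ * ((2 * m + 1) * B ^ 2)) atTop (𝓝 0) := by
      simpa using (tendsto_inv_atTop_nhds_zero_nat (𝕜 := ℝ)).mul_const ((2 * m + 1) * B ^ 2)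
    have h2 := (Real.continuous_sqrt.tendsto 0).comp h1
    rwa [Real.sqrt_zero] at h2
  refine squeeze_zero (fun n => integral_nonneg fun ω => abs_nonneg _) (fun n => ?_) hlim
  refine (integral_abs_le_sqrt (hsum n)).trans (Real.sqrt_le_sqrt ?_)
  simp_rw [mul_pow]
  rw [integral_const_mul]
  rcases Nat.eq_zero_or_pos n with rfl | hn
  · simp
  calc _ ≤ ((n : ℝ)⁻¹) ^ 2 * (n * ((2 * m + 1) * B ^ 2)) := by gcongr; exact hsq n
    _ = _ := by field_simp

lemma abs_exp_neg_sub_exp_neg_le {a b : ℝ} (ha : 0 ≤ a) (hb : 0 ≤ b) :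
    |Real.exp (-a) - Real.exp (-b)| ≤ |a - b| := by
  wlog hab : a ≤ b generalizing a b
  · rw [abs_sub_comm, abs_sub_comm a]
    exact this hb ha (le_of_not_ge hab)
  rw [abs_of_nonneg (sub_nonneg.2 (Real.exp_le_exp.2 (neg_le_neg hab))), abs_sub_comm,
    abs_of_nonneg (sub_nonneg.2 hab)]
  have h1 : Real.exp (-b) = Real.exp (-a) * Real.exp (-(b - a)) := by
    rw [← Real.exp_add]; ring_nf
  have h2 := Real.add_one_le_exp (-(b - a))
  have h3 : Real.exp (-a) ≤ 1 := Real.exp_le_one_iff.2 (by linarith)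
  have h4 := Real.exp_pos (-a)
  rw [h1]
  nlinarith

open Complex in
/-- The exponential `exp (i y + y² / 2)` agrees with `1 + i y` up to third order. -/
lemma norm_exp_sub_one_sub_le {y : ℝ} (hy : |y| ≤ 1) :
    ‖cexp (I * y + (y : ℂ) ^ 2 / 2) - 1 - I * y‖ ≤ (27 / 8 * Real.exp (3 / 2) + 1) * |y| ^ 3 := by
  set z : ℂ := I * y + (y : ℂ) ^ 2 / 2 with hz
  have hy2 : |y| ^ 2 ≤ |y| := by nlinarith [abs_nonneg y]
  have hzn : ‖z‖ ≤ 3 / 2 * |y| := by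
    refine (norm_add_le _ _).trans ?_
    simp only [norm_mul, norm_I, one_mul, norm_real, norm_div, norm_pow, Real.norm_eq_abs,
      RCLike.norm_ofNat]
    linarith
  have h1 := Complex.norm_exp_sub_sum_le_norm_mul_exp z 3
  have h2 : ‖z‖ ^ 3 * Real.exp ‖z‖ ≤ (3 / 2 * |y|) ^ 3 * Real.exp (3 / 2) := by
    gcongr
    linarith
  -- The compensator `y²/2` cancels the quadratic term `(iy)²/2` of the expansion, leaving only
  -- terms of order at least three.
  have h3 : cexp z - 1 - I * y = (cexp z - ∑ m ∈ Finset.range 3, z ^ m / (m.factorial : ℂ)) +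
      (I * (y : ℂ) ^ 3 / 2 + (y : ℂ) ^ 4 / 8) := by
    simp only [Finset.sum_range_succ, Finset.range_zero, Finset.sum_empty, Nat.factorial]
    rw [hz]
    push_cast
    linear_combination ((y : ℂ) ^ 2 / 2) * I_sq
  have h4 : ‖I * (y : ℂ) ^ 3 / 2 + (y : ℂ) ^ 4 / 8‖ ≤ |y| ^ 3 := by
    refine (norm_add_le _ _).trans ?_
    simp only [norm_mul, norm_I, one_mul, norm_real, norm_div, norm_pow, Real.norm_eq_abs,
      RCLike.norm_ofNat]
    have : |y| ^ 4 ≤ |y| ^ 3 := pow_le_pow_of_le_one (abs_nonneg y) hy (by norm_num)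
    have : 0 ≤ |y| ^ 3 := by positivity
    linarith
  rw [h3]
  refine (norm_add_le _ _).trans ?_
  calc _ ≤ (3 / 2 * |y|) ^ 3 * Real.exp (3 / 2) + |y| ^ 3 := add_le_add (h1.trans h2) h4
    _ = _ := by ring

open Complex in
/-- The central limit theorem for bounded martingale differences, in terms of characteristic
functions. The martingale property is expressed by testing against continuous functions of the
partial sums of the differences and of their squares. -/
theorem tendsto_integral_exp_martingale {x : ℕ → Ω → ℝ} (hx : ∀ k, Measurable (x k)) {K : ℝ}
    (hK : ∀ k ω, |x k ω| ≤ K)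
    (hmd : ∀ k (F : ℝ × ℝ → ℂ), Continuous F → ∫ ω, x k ω •
      F (∑ j ∈ Finset.range k, x j ω, ∑ j ∈ Finset.range k, x j ω ^ 2) ∂P = 0)
    {v : ℝ} (hv : 0 ≤ v)
    (hQ : Tendsto (fun n : ℕ => ∫ ω, |(n : ℝ)⁻¹ * ∑ j ∈ Finset.range n, x j ω ^ 2 - v| ∂P)
      atTop (𝓝 0)) :
    Tendsto (fun n : ℕ => ∫ ω, cexp (I * ((√n)⁻¹ * ∑ j ∈ Finset.range n, x j ω : ℝ)) ∂P)
      atTop (𝓝 (cexp (-(v / 2 : ℝ)))) := by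
  obtain ⟨ω₀⟩ := nonempty_of_isProbabilityMeasure P
  have hK0 : 0 ≤ K := (abs_nonneg _).trans (hK 0 ω₀)
  set S : ℕ → Ω → ℝ := fun k ω => ∑ j ∈ Finset.range k, x j ω with hS
  set Q : ℕ → Ω → ℝ := fun k ω => ∑ j ∈ Finset.range k, x j ω ^ 2 with hQdef
  have hSm : ∀ k, Measurable (S k) := fun k => Finset.measurable_fun_sum _ fun j _ => hx j
  have hQm : ∀ k, Measurable (Q k) := fun k =>
    Finset.measurable_fun_sum _ fun j _ => (hx j).pow_const 2
  have hQ0 : ∀ k ω, 0 ≤ Q k ω := fun k ω => Finset.sum_nonneg fun j _ => sq_nonneg _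
  have hQK : ∀ k ω, Q k ω ≤ k * K ^ 2 := by
    intro k ω
    calc Q k ω ≤ ∑ j ∈ Finset.range k, K ^ 2 :=
          Finset.sum_le_sum fun j _ => sq_le_sq' (neg_le_of_abs_le (hK j ω)) (le_of_abs_le (hK j ω))
      _ = _ := by simp
  -- The exponential of the sum compensated by its quadratic variation. With `h = n^{-1/2}` and `k ≤
  -- n` its modulus is at most `exp(K²/2)`, and its mean is nearly constant in `k`.
  let V : ℝ → ℕ → Ω → ℂ := fun h k ω => cexp (I * (h * S k ω : ℝ) + ((h ^ 2 * Q k ω / 2 : ℝ) : ℂ))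
  have hVm : ∀ h k, Measurable (V h k) := fun h k => by fun_prop
  have hVnorm : ∀ h k ω, ‖V h k ω‖ = Real.exp (h ^ 2 * Q k ω / 2) := by
    intro h k ω
    rw [Complex.norm_exp]
    congr 1
    simp only [add_re, I_mul_re, ofReal_im, ofReal_re]
    ring
  set c₀ := Real.exp (K ^ 2 / 2) with hc₀
  set c₁ := 27 / 8 * Real.exp (3 / 2) + 1 with hc₁
  have hc₁0 : 0 ≤ c₁ := by positivity
  have hVle : ∀ n k : ℕ, k ≤ n → ∀ ω, ‖V (√n)⁻¹ k ω‖ ≤ c₀ := by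
    intro n k hk ω
    rw [hVnorm, hc₀, Real.exp_le_exp]
    rcases Nat.eq_zero_or_pos n with rfl | hn
    · simp; positivity
    have h1 := hQK k ω
    have h2 : (k : ℝ) ≤ n := by exact_mod_cast hk
    have h3 : (0 : ℝ) < n := by exact_mod_cast hn
    rw [inv_pow, Real.sq_sqrt h3.le]
    have h4 : (n : ℝ)⁻¹ * Q k ω ≤ (n : ℝ)⁻¹ * (n * K ^ 2) := by
      gcongr
      exact h1.trans (by gcongr)
    rw [inv_mul_cancel_left₀ h3.ne'] at h4
    linarith
  have hVint : ∀ n k : ℕ, k ≤ n → Integrable (V (√n)⁻¹ k) P := fun n k hk =>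
    (integrable_const c₀).mono' (hVm _ _).aestronglyMeasurable (ae_of_all _ (hVle n k hk))
  have hstep : ∀ n k : ℕ, k < n → (√n)⁻¹ * K ≤ 1 →
      ‖∫ ω, V (√n)⁻¹ (k + 1) ω ∂P - ∫ ω, V (√n)⁻¹ k ω ∂P‖ ≤ c₀ * (c₁ * ((√n)⁻¹ * K) ^ 3) := by
    intro n k hk hnK
    set h := (√(n : ℝ))⁻¹ with hh
    have hh0 : 0 ≤ h := by positivity
    -- The first-order term of the step has mean zero, because `V h k` is a continuous function of
    -- the two partial sums.
    have hmd' : ∫ ω, x k ω • (I * h * V h k ω) ∂P = 0 :=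
      hmd k (fun q => I * h * cexp (I * (h * q.1 : ℝ) + ((h ^ 2 * q.2 / 2 : ℝ) : ℂ))) (by fun_prop)
    have hint' : Integrable (fun ω => x k ω • (I * h * V h k ω)) P := by
      refine (integrable_const (K * (h * c₀))).mono' ?_ (ae_of_all _ fun ω => ?_)
      · exact ((hx k).smul ((hVm h k).const_mul _)).aestronglyMeasurable
      · rw [norm_smul, norm_mul, norm_mul, norm_I, one_mul, norm_real, Real.norm_eq_abs,
          Real.norm_eq_abs, abs_of_nonneg hh0]
        gcongr
        · exact hK k ω
        · exact hVle n k hk.le ω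
    have h1 : ∫ ω, V h (k + 1) ω ∂P - ∫ ω, V h k ω ∂P =
        ∫ ω, (V h (k + 1) ω - V h k ω - x k ω • (I * h * V h k ω)) ∂P := by
      have hsub : Integrable (fun ω => V h (k + 1) ω - V h k ω) P :=
        (hVint n (k + 1) hk).sub (hVint n k hk.le)
      rw [integral_sub hsub hint', hmd', sub_zero,
        integral_sub (hVint n (k + 1) hk) (hVint n k hk.le)]
    rw [h1]
    refine (norm_integral_le_of_norm_le_const (C := c₀ * (c₁ * (h * K) ^ 3))
      (ae_of_all _ fun ω => ?_)).trans (by simp)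
    have h2 : V h (k + 1) ω - V h k ω - x k ω • (I * h * V h k ω) =
        V h k ω * (cexp (I * ((h * x k ω : ℝ) : ℂ) + ((h * x k ω : ℝ) : ℂ) ^ 2 / 2) - 1
          - I * ((h * x k ω : ℝ) : ℂ)) := by
      have h3 : V h (k + 1) ω = V h k ω *
          cexp (I * ((h * x k ω : ℝ) : ℂ) + ((h * x k ω : ℝ) : ℂ) ^ 2 / 2) := by
        simp only [V, hS, hQdef, Finset.sum_range_succ]
        rw [← Complex.exp_add]
        congr 1
        push_cast
        ring
      rw [h3, real_smul]
      push_cast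
      ring
    have hxh : |h * x k ω| ≤ h * K := by
      rw [abs_mul, abs_of_nonneg hh0]
      gcongr
      exact hK k ω
    rw [h2, norm_mul]
    gcongr
    · exact hVle n k hk.le ω
    · refine (norm_exp_sub_one_sub_le (hxh.trans hnK)).trans ?_
      gcongr
  have hinv : Tendsto (fun n : ℕ => (√(n : ℝ))⁻¹) atTop (𝓝 0) :=
    tendsto_inv_atTop_zero.comp (Real.tendsto_sqrt_atTop.comp tendsto_natCast_atTop_atTop)
  -- The process starts at `1` and makes `n` steps, each changing the mean by `O(n^{-3/2})`.
  have hVlim : Tendsto (fun n : ℕ => ∫ ω, V (√n)⁻¹ n ω ∂P) atTop (𝓝 1) := by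
    rw [tendsto_iff_norm_sub_tendsto_zero]
    have hev : ∀ᶠ n : ℕ in atTop, (√(n : ℝ))⁻¹ * K ≤ 1 := by
      have : Tendsto (fun n : ℕ => (√(n : ℝ))⁻¹ * K) atTop (𝓝 0) := by
        simpa using hinv.mul_const K
      exact this.eventually_le_const one_pos
    have hb : Tendsto (fun n : ℕ => (√(n : ℝ))⁻¹ * (c₀ * c₁ * K ^ 3)) atTop (𝓝 0) := by
      simpa using hinv.mul_const (c₀ * c₁ * K ^ 3)
    refine squeeze_zero' (Eventually.of_forall fun n => norm_nonneg _) ?_ hb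
    filter_upwards [hev, eventually_gt_atTop 0] with n hn hn0
    have h1 : ∀ k : ℕ, k ≤ n → ‖∫ ω, V (√n)⁻¹ k ω ∂P - 1‖ ≤
        k * (c₀ * (c₁ * ((√n)⁻¹ * K) ^ 3)) := by
      intro k
      induction k with
      | zero => simp [V, hS, hQdef]
      | succ k ih =>
        intro hk
        have h2 := hstep n k hk hn
        have h3 := ih (by omega)
        have h4 := norm_add_le (∫ ω, V (√n)⁻¹ (k + 1) ω ∂P - ∫ ω, V (√n)⁻¹ k ω ∂P)
          (∫ ω, V (√n)⁻¹ k ω ∂P - 1)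
        rw [sub_add_sub_cancel] at h4
        push_cast
        linarith
    refine (h1 n le_rfl).trans (le_of_eq ?_)
    have h5 : (0 : ℝ) < n := by exact_mod_cast hn0
    have h6 : (n : ℝ) * (√(n : ℝ))⁻¹ ^ 2 = 1 := by
      rw [inv_pow, Real.sq_sqrt h5.le, mul_inv_cancel₀ h5.ne']
    linear_combination ((√(n : ℝ))⁻¹ * c₀ * c₁ * K ^ 3) * h6
  -- Replace the random compensator by its limit `v/2`. As `x ↦ exp(-x)` is 1-Lipschitz for `x ≥ 0`,
  -- the error is controlled by the law of large numbers `hQ`.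
  have hdiff : Tendsto (fun n : ℕ =>
      ∫ ω, cexp (I * ((√n)⁻¹ * S n ω : ℝ)) ∂P - cexp (-(v / 2 : ℝ)) * ∫ ω, V (√n)⁻¹ n ω ∂P)
      atTop (𝓝 0) := by
    have hb : Tendsto (fun n : ℕ => c₀ * ∫ ω, |(n : ℝ)⁻¹ * Q n ω - v| ∂P) atTop (𝓝 0) := by
      simpa using hQ.const_mul c₀
    refine squeeze_zero_norm (fun n => ?_) hb
    set h := (√(n : ℝ))⁻¹ with hh
    have hh2 : h ^ 2 = (n : ℝ)⁻¹ := by rw [hh, inv_pow, Real.sq_sqrt (Nat.cast_nonneg n)]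
    have hE : Integrable (fun ω => cexp (I * (h * S n ω : ℝ))) P := by
      refine (integrable_const (1 : ℝ)).mono' ?_ (ae_of_all _ fun ω => ?_)
      · exact Measurable.aestronglyMeasurable (by fun_prop)
      · rw [mul_comm, norm_exp_ofReal_mul_I]
    have hQi : Integrable (fun ω => |(n : ℝ)⁻¹ * Q n ω - v|) P := by
      refine (integrable_const ((n : ℝ)⁻¹ * (n * K ^ 2) + v)).mono' ?_ (ae_of_all _ fun ω => ?_)
      · exact Measurable.aestronglyMeasurable (by fun_prop)
      · rw [Real.norm_eq_abs, abs_abs]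
        have h1 : (n : ℝ)⁻¹ * Q n ω ≤ (n : ℝ)⁻¹ * (n * K ^ 2) := by gcongr; exact hQK n ω
        have h2 : 0 ≤ (n : ℝ)⁻¹ * Q n ω := mul_nonneg (by positivity) (hQ0 n ω)
        rw [abs_le]
        constructor <;> linarith
    rw [← integral_const_mul, ← integral_sub hE ((hVint n n le_rfl).const_mul _),
      ← integral_const_mul]
    refine norm_integral_le_of_norm_le (hQi.const_mul c₀) (ae_of_all _ fun ω => ?_)
    have h1 : cexp (I * (h * S n ω : ℝ)) - cexp (-(v / 2 : ℝ)) * V h n ω =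
        V h n ω * ((Real.exp (-((n : ℝ)⁻¹ * Q n ω / 2)) - Real.exp (-(v / 2)) : ℝ) : ℂ) := by
      have h2 : cexp (I * (h * S n ω : ℝ)) =
          V h n ω * (Real.exp (-((n : ℝ)⁻¹ * Q n ω / 2)) : ℂ) := by
        simp only [V]
        rw [ofReal_exp, ← Complex.exp_add, hh2]
        congr 1
        push_cast
        ring
      rw [h2, ofReal_sub]
      push_cast
      ring
    rw [h1, norm_mul, norm_real, Real.norm_eq_abs]
    have h3 : 0 ≤ (n : ℝ)⁻¹ * Q n ω := mul_nonneg (by positivity) (hQ0 n ω)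
    refine mul_le_mul (hVle n n le_rfl ω)
      ((abs_exp_neg_sub_exp_neg_le (by positivity) (by positivity)).trans ?_)
      (abs_nonneg _) (by positivity)
    rw [← sub_div, abs_div, abs_two]
    linarith [abs_nonneg ((n : ℝ)⁻¹ * Q n ω - v)]
  have := hdiff.add (hVlim.const_mul (cexp (-(v / 2 : ℝ))))
  simp only [sub_add_cancel, mul_one, zero_add] at this
  exact this

end BoundedMartingale

end RandomAffine

namespace RandomAffine

/-! ### Martingale approximation of the forward iterates -/

section CLT

open scoped RealInnerProductSpace

variable {Ω T H : Type*} [MeasurableSpace Ω] [MeasurableSpace T] [Fintype T]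
  [DiscreteMeasurableSpace T] [NormedAddCommGroup H] [InnerProductSpace ℝ H]
  [FiniteDimensional ℝ H] [CompleteSpace H] [MeasurableSpace H] [BorelSpace H]
  {η : ℤ → Ω → T} {w : T → ℝ} {P : Measure Ω} [IsProbabilityMeasure P]
  {M : T → H →L[ℝ] H} {e : T → H} {ρ : ℝ}

/-- The forward iterates, started at `v` at time `0`. -/
def fwd (M : T → H →L[ℝ] H) (e : T → H) (x : ℤ → T) (v : H) (k : ℕ) : H := bwd M e x k k v

lemma fwd_succ (x : ℤ → T) (v : H) (k : ℕ) :
    fwd M e x v (k + 1) = M (x ((k : ℤ) + 1)) (fwd M e x v k) + e (x ((k : ℤ) + 1)) := by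
  rw [fwd, bwd_succ]
  push_cast
  rw [add_sub_cancel_right]
  rfl

/-- The increments along the forward iterates. -/
def fwdIncr (M : T → H →L[ℝ] H) (e : T → H) (w : T → ℝ) (a v : H) (x : ℤ → T) (k : ℕ) : ℝ :=
  incr M e w a (x ((k : ℤ) + 1)) (fwd M e x v k)

/-- The increments with the memory truncated after `m` steps. -/
def truncIncr (M : T → H →L[ℝ] H) (e : T → H) (w : T → ℝ) (a : H) (m : ℕ) (x : ℤ → T) (k : ℕ) : ℝ :=
  incr M e w a (x ((k : ℤ) + 1)) (bwd M e x m k 0)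

/-- Writing `t = Rt - LRt`, the terms `⟪LRt, u_k⟫` telescope. The identity holds for every path and
isolates the martingale part. -/
lemma sum_inner_fwd (hL : ‖meanAdj M w‖ < 1) (x : ℤ → T) (v t : H) (n : ℕ) :
    ∑ k ∈ Finset.range n, ⟪t, fwd M e x v (k + 1)⟫ =
      ∑ k ∈ Finset.range n, fwdIncr M e w (resolvent M w t) v x k +
        ⟪meanAdj M w (resolvent M w t), v - fwd M e x v n⟫ := by
  induction n with
  | zero => simp [fwd]
  | succ n ih =>
    rw [Finset.sum_range_succ, Finset.sum_range_succ, ih, fwdIncr, incr, ← fwd_succ]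
    have h : ⟪t, fwd M e x v (n + 1)⟫ = ⟪resolvent M w t, fwd M e x v (n + 1)⟫ -
        ⟪meanAdj M w (resolvent M w t), fwd M e x v (n + 1)⟫ := by
      rw [← inner_sub_left, resolvent_sub hL]
    rw [h]
    simp only [inner_sub_right]
    ring

lemma exists_norm_bwd_le (M : T → H →L[ℝ] H) (e : T → H) (n : ℕ) (u : H) :
    ∃ B, 0 ≤ B ∧ ∀ x k, ‖bwd M e x n k u‖ ≤ B := by
  induction n with
  | zero => exact ⟨‖u‖, norm_nonneg _, fun x k => le_rfl⟩
  | succ n ih =>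
    obtain ⟨B, hB0, hB⟩ := ih
    refine ⟨(∑ t, ‖M t‖) * B + ∑ t, ‖e t‖, by positivity, fun x k => ?_⟩
    rw [bwd_succ]
    refine (norm_add_le _ _).trans (add_le_add (((M _).le_opNorm _).trans ?_) ?_)
    · gcongr
      · exact Finset.single_le_sum (f := fun t => ‖M t‖) (fun t _ => norm_nonneg _)
          (Finset.mem_univ _)
      · exact hB _ _
    · exact Finset.single_le_sum (f := fun t => ‖e t‖) (fun t _ => norm_nonneg _)
          (Finset.mem_univ _)

lemma exists_abs_truncIncr_le (M : T → H →L[ℝ] H) (e : T → H) (w : T → ℝ) (a : H) (m : ℕ) :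
    ∃ K, ∀ x k, |truncIncr M e w a m x k| ≤ K := by
  obtain ⟨B, hB0, hB⟩ := exists_norm_bwd_le M e m 0
  obtain ⟨c, hc0, hc⟩ := exists_abs_incr_le M e w a
  exact ⟨c * (1 + B), fun x k => (hc _ _).trans (by gcongr; exact hB _ _)⟩

lemma measurable_truncIncr_sigmaOn {S : Set ℤ} (a : H) {m k : ℕ}
    (hS : Set.Ioc ((k : ℤ) - m) (k + 1) ⊆ S) :
    Measurable[sigmaOn η S] fun ω => truncIncr M e w a m (η · ω) k := by
  refine measurable_incr a (measurable_sigmaOn (hS ?_))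
    (measurable_bwd_sigmaOn (fun i hi => hS ?_) measurable_const)
  · simp
  · simp at hi ⊢; omega

lemma measurable_fwd_sigmaOn {S : Set ℤ} (v : H) {k : ℕ} (hS : Set.Iic (k : ℤ) ⊆ S) :
    Measurable[sigmaOn η S] fun ω => fwd M e (η · ω) v k :=
  measurable_bwd_sigmaOn (fun _ hi => hS hi.2) measurable_const

lemma measurable_fwdIncr_sigmaOn {S : Set ℤ} (a v : H) {k : ℕ}
    (hS : Set.Iic ((k : ℤ) + 1) ⊆ S) :
    Measurable[sigmaOn η S] fun ω => fwdIncr M e w a v (η · ω) k :=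
  measurable_incr a (measurable_sigmaOn (hS (by simp)))
    (measurable_fwd_sigmaOn v ((Set.Iic_subset_Iic.2 (by omega)).trans hS))

lemma memLp_fwd (hη : IsIIDSeq η w P) (v : H) (k : ℕ) :
    MemLp (fun ω => fwd M e (η · ω) v k) 2 P :=
  memLp_bwd hη (memLp_const v)

lemma memLp_fwdIncr (hη : IsIIDSeq η w P) (a v : H) (k : ℕ) :
    MemLp (fun ω => fwdIncr M e w a v (η · ω) k) 2 P :=
  memLp_incr hη a (memLp_fwd hη v k)

lemma memLp_truncIncr (hη : IsIIDSeq η w P) (a : H) (m k : ℕ) :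
    MemLp (fun ω => truncIncr M e w a m (η · ω) k) 2 P :=
  memLp_incr hη a (memLp_bwd hη (memLp_const 0))

/-- For `k < m` the truncated memory reaches nonpositive indices. Since the noise is two-sided, the
truncated increments are stationary from `k = 0` on. -/
lemma integral_truncIncr_sq (hη : IsIIDSeq η w P) (a : H) (m k : ℕ) :
    ∫ ω, truncIncr M e w a m (η · ω) k ^ 2 ∂P = ∫ ω, truncIncr M e w a m (η · ω) 0 ^ 2 ∂P := by
  have hm : Measurable fun x : ℤ → T => truncIncr M e w a m x 0 ^ 2 :=
    (measurable_incr a (measurable_pi_apply _) (measurable_bwd_path m _ 0)).pow_const 2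
  rw [← hη.integral_shift k hm]
  refine integral_congr_ae (ae_of_all _ fun ω => ?_)
  have h1 := bwd_shift (M := M) (e := e) (x := (η · ω)) m 0 k 0
  simp only [truncIncr, Nat.cast_zero] at h1 ⊢
  rw [h1, zero_add, zero_add, add_comm (1 : ℤ)]

-- The noise space is finite and the memory has length `m`, so the increments are bounded, and their
-- squares are independent as soon as the windows are disjoint. Both hypotheses of the martingale
-- theorem follow.
open Complex in
lemma tendsto_integral_exp_truncIncr (hη : IsIIDSeq η w P) (he : ∑ t, w t • e t = 0) (a : H)
    (m : ℕ) :
    Tendsto (fun n : ℕ => ∫ ω, cexp (I * ((√n)⁻¹ *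
        ∑ k ∈ Finset.range n, truncIncr M e w a m (η · ω) k : ℝ)) ∂P) atTop
      (𝓝 (cexp (-((∫ ω, truncIncr M e w a m (η · ω) 0 ^ 2 ∂P) / 2 : ℝ)))) := by
  obtain ⟨K, hK⟩ := exists_abs_truncIncr_le M e w a m
  obtain ⟨B, hB0, hB⟩ := exists_norm_bwd_le M e m 0
  set v := ∫ ω, truncIncr M e w a m (η · ω) 0 ^ 2 ∂P with hv
  have hv0 : 0 ≤ v := integral_nonneg fun ω => by positivity
  have hle := fun S => hη.sigmaOn_le S
  have hx : ∀ k, Measurable fun ω => truncIncr M e w a m (η · ω) k := fun k =>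
    (measurable_truncIncr_sigmaOn a (Set.subset_univ _)).mono (hle _) le_rfl
  have hx2 : ∀ k ω, truncIncr M e w a m (η · ω) k ^ 2 ≤ K ^ 2 := fun k ω =>
    sq_le_sq' (neg_le_of_abs_le (hK _ k)) (le_of_abs_le (hK _ k))
  refine tendsto_integral_exp_martingale (x := fun k ω => truncIncr M e w a m (η · ω) k) hx
    (fun k ω => hK _ k) ?_ hv0 ?_
  · intro k F hF
    have hSm : Measurable[sigmaOn η (Set.Iic (k : ℤ))] fun ω =>
        F (∑ j ∈ Finset.range k, truncIncr M e w a m (η · ω) j,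
          ∑ j ∈ Finset.range k, truncIncr M e w a m (η · ω) j ^ 2) := by
      have hj : ∀ j ∈ Finset.range k, Measurable[sigmaOn η (Set.Iic (k : ℤ))] fun ω =>
          truncIncr M e w a m (η · ω) j := fun j hj =>
        measurable_truncIncr_sigmaOn a fun i hi => by
          have := Finset.mem_range.1 hj
          have h2 := hi.2
          simp only [Set.mem_Iic]
          omega
      exact hF.measurable.comp ((Finset.measurable_fun_sum _ hj).prodMk
        (Finset.measurable_fun_sum _ fun j h => (hj j h).pow_const 2))
    -- The partial sums stay in a compact box, so the continuous test function is bounded along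
    -- them.
    obtain ⟨C, hC⟩ := ((isCompact_closedBall (0 : ℝ) (k * K)).prod
      (isCompact_closedBall (0 : ℝ) (k * K ^ 2))).exists_bound_of_continuousOn hF.continuousOn
    have hFC : ∀ ω, ‖F (∑ j ∈ Finset.range k, truncIncr M e w a m (η · ω) j,
          ∑ j ∈ Finset.range k, truncIncr M e w a m (η · ω) j ^ 2)‖ ≤ C := by
      intro ω
      refine hC _ ⟨?_, ?_⟩
      · simp only [mem_closedBall_zero_iff, Real.norm_eq_abs]
        refine (Finset.abs_sum_le_sum_abs _ _).trans ?_
        refine (Finset.sum_le_sum fun j _ => hK _ j).trans ?_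
        simp
      · simp only [mem_closedBall_zero_iff, Real.norm_eq_abs]
        rw [abs_of_nonneg (Finset.sum_nonneg fun j _ => sq_nonneg _)]
        refine (Finset.sum_le_sum fun j _ => hx2 j ω).trans ?_
        simp
    have hWm : Measurable[sigmaOn η (Set.Iic (k : ℤ))] fun ω => bwd M e (η · ω) m k 0 :=
      measurable_bwd_sigmaOn (fun i hi => hi.2) measurable_const
    have hYi := (integrable_const C).mono' ((hSm.mono (hle _) le_rfl).aestronglyMeasurable (μ := P))
      (ae_of_all _ hFC)
    refine integral_incr_smul_eq_zero hη he (S := Set.Iic (k : ℤ)) (by simp) a hWm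
      hSm.stronglyMeasurable hYi ?_
    refine (integrable_const (B * C)).mono' (μ := P) ?_ (ae_of_all _ fun ω => ?_)
    · exact ((hWm.mono (hle _) le_rfl).norm.smul (hSm.mono (hle _) le_rfl)).aestronglyMeasurable
    · rw [norm_smul, norm_norm]
      exact mul_le_mul (hB _ _) (hFC ω) (norm_nonneg _) hB0
  · have hzm : ∀ k, Measurable fun ω => truncIncr M e w a m (η · ω) k ^ 2 - v := fun k =>
      ((hx k).pow_const 2).sub_const v
    have hi : ∀ k, Integrable (fun ω => truncIncr M e w a m (η · ω) k ^ 2) P := fun k =>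
      (memLp_truncIncr hη a m k).integrable_sq
    have hzb : ∀ k ω, |truncIncr M e w a m (η · ω) k ^ 2 - v| ≤ K ^ 2 + v := by
      intro k ω
      have h1 := hx2 k ω
      have h2 := sq_nonneg (truncIncr M e w a m (η · ω) k)
      have h3 := sq_nonneg K
      rw [abs_le]
      constructor <;> linarith
    have hzS : ∀ k : ℕ, Measurable[sigmaOn η (Set.Ioc ((k : ℤ) - m) (k + 1))]
        fun ω => truncIncr M e w a m (η · ω) k ^ 2 - v := fun k =>
      ((measurable_truncIncr_sigmaOn a subset_rfl).pow_const 2).sub_const v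
    have hz0 : ∀ k, ∫ ω, (truncIncr M e w a m (η · ω) k ^ 2 - v) ∂P = 0 := by
      intro k
      rw [integral_sub (hi k) (integrable_const v), integral_truncIncr_sq hη a m k, ← hv]
      simp
    have hcov : ∀ j k : ℕ, j + m < k → ∫ ω, (truncIncr M e w a m (η · ω) j ^ 2 - v) *
        (truncIncr M e w a m (η · ω) k ^ 2 - v) ∂P = 0 := by
      intro j k hjk
      -- The increment `j` uses the noise with indices in `(j - m, j + 1]`; the condition `j + m <
      -- k` makes the two windows disjoint.
      have hdisj : Disjoint (Set.Ioc ((j : ℤ) - m) (j + 1)) (Set.Ioc ((k : ℤ) - m) (k + 1)) := by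
        rw [Set.disjoint_left]
        intro i hi hi'
        have h1 := hi.2
        have h2 := hi'.1
        omega
      have hind : IndepFun (fun ω => truncIncr M e w a m (η · ω) j ^ 2 - v)
          (fun ω => truncIncr M e w a m (η · ω) k ^ 2 - v) P := by
        rw [IndepFun_iff_Indep]
        exact indep_of_indep_of_le_left (indep_of_indep_of_le_right (hη.indep_sigmaOn hdisj)
          (hzS k).comap_le) (hzS j).comap_le
      rw [hind.integral_fun_mul_eq_mul_integral (hzm j).aestronglyMeasurable
        (hzm k).aestronglyMeasurable, hz0 j, zero_mul]
    have hlln := tendsto_integral_abs_average (P := P)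
      (z := fun k ω => truncIncr M e w a m (η · ω) k ^ 2 - v) hzm hzb hcov
    refine hlln.congr' ?_
    filter_upwards [eventually_gt_atTop 0] with n hn
    have hn' : (n : ℝ) ≠ 0 := by exact_mod_cast hn.ne'
    refine integral_congr_ae (ae_of_all _ fun ω => ?_)
    simp only [Finset.sum_sub_distrib, Finset.sum_const, Finset.card_range, nsmul_eq_mul]
    rw [mul_sub, inv_mul_cancel_left₀ hn']

/-- Both increments at time `k` use the same fresh noise and are centred given the past, so their
differences are orthogonal and Pythagoras applies. -/
lemma integral_sq_sum_fwdIncr_sub (hη : IsIIDSeq η w P) (he : ∑ t, w t • e t = 0) (a v : H)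
    (m n : ℕ) :
    ∫ ω, (∑ k ∈ Finset.range n,
        (fwdIncr M e w a v (η · ω) k - truncIncr M e w a m (η · ω) k)) ^ 2 ∂P =
      ∑ k ∈ Finset.range n,
        ∫ ω, (fwdIncr M e w a v (η · ω) k - truncIncr M e w a m (η · ω) k) ^ 2 ∂P := by
  set d : ℕ → Ω → ℝ := fun k ω =>
    fwdIncr M e w a v (η · ω) k - truncIncr M e w a m (η · ω) k with hd
  have hdL : ∀ k, MemLp (d k) 2 P := fun k =>
    (memLp_fwdIncr hη a v k).sub (memLp_truncIncr hη a m k)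
  have hSL : ∀ n, MemLp (fun ω => ∑ k ∈ Finset.range n, d k ω) 2 P := fun n =>
    memLp_finsetSum _ fun k _ => hdL k
  have hSm : ∀ n : ℕ, Measurable[sigmaOn η (Set.Iic (n : ℤ))]
      fun ω => ∑ k ∈ Finset.range n, d k ω := fun n =>
    Finset.measurable_fun_sum _ fun k hk => by
      have := Finset.mem_range.1 hk
      refine (measurable_fwdIncr_sigmaOn a v (Set.Iic_subset_Iic.2 (by omega))).sub
        (measurable_truncIncr_sigmaOn a fun i hi => ?_)
      have h2 := hi.2
      simp only [Set.mem_Iic]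
      omega
  have horth : ∀ n : ℕ, ∫ ω, (∑ k ∈ Finset.range n, d k ω) * d n ω ∂P = 0 := by
    intro n
    have key : ∀ W : Ω → H, Measurable[sigmaOn η (Set.Iic (n : ℤ))] W → MemLp W 2 P →
        ∫ ω, incr M e w a (η ((n : ℤ) + 1) ω) (W ω) * ∑ k ∈ Finset.range n, d k ω ∂P = 0 :=
      fun W hWm hW => integral_incr_smul_eq_zero hη he (S := Set.Iic (n : ℤ)) (by simp) a hWm
        (hSm n).stronglyMeasurable ((hSL n).integrable (by norm_num))
        (hW.norm.integrable_mul (hSL n))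
    have h1 := key (fun ω => fwd M e (η · ω) v n) (measurable_fwd_sigmaOn v subset_rfl)
      (memLp_fwd hη v n)
    have h2 := key (fun ω => bwd M e (η · ω) m n 0)
      (measurable_bwd_sigmaOn (fun i hi => hi.2) measurable_const) (memLp_bwd hη (memLp_const 0))
    have i1 : Integrable (fun ω => fwdIncr M e w a v (η · ω) n * ∑ k ∈ Finset.range n, d k ω) P :=
      (memLp_fwdIncr hη a v n).integrable_mul (hSL n)
    have i2 : Integrable
        (fun ω => truncIncr M e w a m (η · ω) n * ∑ k ∈ Finset.range n, d k ω) P :=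
      (memLp_truncIncr hη a m n).integrable_mul (hSL n)
    calc _ = ∫ ω, (fwdIncr M e w a v (η · ω) n * ∑ k ∈ Finset.range n, d k ω -
          truncIncr M e w a m (η · ω) n * ∑ k ∈ Finset.range n, d k ω) ∂P := by
          congr 1; ext ω; rw [hd]; ring
      _ = 0 := by
          rw [integral_sub i1 i2]
          exact sub_eq_zero.2 (h1.trans h2.symm)
  change ∫ ω, (∑ k ∈ Finset.range n, d k ω) ^ 2 ∂P = ∑ k ∈ Finset.range n, ∫ ω, d k ω ^ 2 ∂P
  induction n with
  | zero => simp
  | succ n ih =>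
    have i1 : Integrable (fun ω => (∑ k ∈ Finset.range n, d k ω) ^ 2) P := (hSL n).integrable_sq
    have i2 : Integrable (fun ω => d n ω ^ 2) P := (hdL n).integrable_sq
    have i3 : Integrable (fun ω => (∑ k ∈ Finset.range n, d k ω) * d n ω) P :=
      (hSL n).integrable_mul (hdL n)
    have i4 : Integrable (fun ω => (∑ k ∈ Finset.range n, d k ω) ^ 2 +
      2 * ((∑ k ∈ Finset.range n, d k ω) * d n ω)) P := i1.add (i3.const_mul 2)
    rw [Finset.sum_range_succ, ← ih]
    calc _ = ∫ ω, ((∑ k ∈ Finset.range n, d k ω) ^ 2 +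
          2 * ((∑ k ∈ Finset.range n, d k ω) * d n ω) + d n ω ^ 2) ∂P := by
          congr 1; ext ω; rw [Finset.sum_range_succ]; ring
      _ = _ := by
          rw [integral_add i4 i2, integral_add i1 (i3.const_mul 2), integral_const_mul, horth n]
          ring

/-- The increment is Lipschitz in the state uniformly over masks, so the error is that of comparing
`k` steps from `v` with `m` steps from `0`. -/
lemma exists_integral_sq_fwdIncr_sub_le (hη : IsIIDSeq η w P) (hM : IsMeanContractive M w ρ)
    (e : T → H) (a v : H) :
    ∃ C, 0 ≤ C ∧ ∀ k m : ℕ,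
      ∫ ω, (fwdIncr M e w a v (η · ω) k - truncIncr M e w a m (η · ω) k) ^ 2 ∂P ≤
        C * (ρ ^ k + ρ ^ m) := by
  obtain ⟨c, hc0, hc⟩ := exists_abs_incr_sub_le M e w a
  obtain ⟨C, hC0, hC⟩ := exists_integral_norm_bwd_sub_sq_le hη hM e v 0
  refine ⟨c ^ 2 * C, by positivity, fun k m => ?_⟩
  rw [mul_assoc]
  refine le_trans ?_ (mul_le_mul_of_nonneg_left (hC k m k) (sq_nonneg c))
  rw [← integral_const_mul]
  have i2 : Integrable (fun ω => c ^ 2 *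
      ‖bwd M e (η · ω) k k v - bwd M e (η · ω) m k 0‖ ^ 2) P :=
    (((memLp_fwd hη v k).sub (memLp_bwd hη (memLp_const 0))).integrable_norm_pow
      (by simp)).const_mul _
  refine integral_mono
    ((memLp_fwdIncr hη a v k).sub (memLp_truncIncr hη a m k)).integrable_sq i2 fun ω => ?_
  have h := hc (η ((k : ℤ) + 1) ω) (bwd M e (η · ω) k k v) (bwd M e (η · ω) m k 0)
  have h2 := pow_le_pow_left₀ (abs_nonneg _) h 2
  rwa [sq_abs, mul_pow] at h2

lemma exists_integral_sq_inner_sub_fwd_le (hη : IsIIDSeq η w P) (hM : IsMeanContractive M w ρ)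
    (e : T → H) (b v : H) :
    ∃ C, 0 ≤ C ∧ ∀ n : ℕ, ∫ ω, ⟪b, v - fwd M e (η · ω) v n⟫ ^ 2 ∂P ≤ C := by
  obtain ⟨C', hC0', hC'⟩ := exists_integral_norm_bwd_sub_sq_le hη hM e v v
  refine ⟨‖b‖ ^ 2 * (C' * 2), by positivity, fun n => ?_⟩
  have hrL : MemLp (fun ω => v - fwd M e (η · ω) v n) 2 P := (memLp_const v).sub (memLp_fwd hη v n)
  have h1 : ∫ ω, ‖v - fwd M e (η · ω) v n‖ ^ 2 ∂P ≤ C' * 2 := by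
    refine (hC' 0 n n).trans ?_
    have : ρ ^ n ≤ 1 := pow_le_one₀ hM.pos.le hM.lt_one.le
    rw [pow_zero]
    gcongr
    linarith
  refine le_trans ?_ (mul_le_mul_of_nonneg_left h1 (sq_nonneg _))
  rw [← integral_const_mul]
  refine integral_mono (hrL.const_inner b).integrable_sq
    ((hrL.integrable_norm_pow (by simp)).const_mul _) fun ω => ?_
  have h2 := pow_le_pow_left₀ (abs_nonneg _) (abs_real_inner_le_norm b (v - fwd M e (η · ω) v n)) 2
  rwa [sq_abs, mul_pow] at h2

/-- The effect of the initial value is summable in `k` and stays bounded, while truncation costs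
`ρ^m` at each of the `n` times. -/
lemma exists_integral_sq_sum_fwdIncr_sub_le (hη : IsIIDSeq η w P) (hM : IsMeanContractive M w ρ)
    (he : ∑ t, w t • e t = 0) (a v : H) :
    ∃ C, 0 ≤ C ∧ ∀ n m : ℕ, ∫ ω, (∑ k ∈ Finset.range n,
      (fwdIncr M e w a v (η · ω) k - truncIncr M e w a m (η · ω) k)) ^ 2 ∂P ≤
        C * (1 + n * ρ ^ m) := by
  obtain ⟨hρ0, hρ1⟩ := hM.pos, hM.lt_one
  obtain ⟨C, hC0, hC⟩ := exists_integral_sq_fwdIncr_sub_le hη hM e a v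
  have h1ρ : 1 ≤ (1 - ρ)⁻¹ := (one_le_inv₀ (sub_pos.2 hρ1)).2 (by linarith)
  refine ⟨C * (1 - ρ)⁻¹, by positivity, fun n m => ?_⟩
  rw [integral_sq_sum_fwdIncr_sub hη he]
  refine (Finset.sum_le_sum fun k _ => hC k m).trans ?_
  have h1 : ∑ k ∈ Finset.range n, ρ ^ k ≤ (1 - ρ)⁻¹ := by
    rw [← tsum_geometric_of_lt_one hρ0.le hρ1]
    exact (summable_geometric_of_lt_one hρ0.le hρ1).sum_le_tsum _ fun k _ => by positivity
  rw [← Finset.mul_sum, mul_assoc]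
  gcongr
  rw [Finset.sum_add_distrib, mul_add, mul_one]
  refine add_le_add h1 ?_
  simp only [Finset.sum_const, Finset.card_range, nsmul_eq_mul]
  exact le_mul_of_one_le_left (by positivity) h1ρ

lemma memLp_const_mul_sum_inner_fwd (hη : IsIIDSeq η w P) (v t : H) (n : ℕ) (c : ℝ) :
    MemLp (fun ω => c * ∑ k ∈ Finset.range n, ⟪t, fwd M e (η · ω) v (k + 1)⟫) 2 P := by
  have h : ∀ k ∈ Finset.range n, MemLp (fun ω => ⟪t, fwd M e (η · ω) v (k + 1)⟫) 2 P :=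
    fun k _ => (memLp_fwd hη v (k + 1)).const_inner t
  exact (memLp_finsetSum _ h).const_mul c

lemma memLp_const_mul_sum_truncIncr (hη : IsIIDSeq η w P) (a : H) (m n : ℕ) (c : ℝ) :
    MemLp (fun ω => c * ∑ k ∈ Finset.range n, truncIncr M e w a m (η · ω) k) 2 P := by
  have h : ∀ k ∈ Finset.range n, MemLp (fun ω => truncIncr M e w a m (η · ω) k) 2 P :=
    fun k _ => memLp_truncIncr hη a m k
  exact (memLp_finsetSum _ h).const_mul c

/-- The normalized sums of the forward iterates are close to sums of truncated increments. -/
lemma exists_integral_sq_sub_le (hη : IsIIDSeq η w P) (hM : IsMeanContractive M w ρ)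
    (he : ∑ t, w t • e t = 0) (v t : H) :
    ∃ G, 0 ≤ G ∧ ∀ n m : ℕ, 0 < n → ∫ ω, ((√n)⁻¹ * ∑ k ∈ Finset.range n,
        ⟪t, fwd M e (η · ω) v (k + 1)⟫ - (√n)⁻¹ * ∑ k ∈ Finset.range n,
        truncIncr M e w (resolvent M w t) m (η · ω) k) ^ 2 ∂P ≤ G * ((n : ℝ)⁻¹ + ρ ^ m) := by
  have hL := norm_meanAdj_lt_one hη hM
  have hρ0 := hM.pos
  obtain ⟨C, hC0, hC⟩ := exists_integral_sq_sum_fwdIncr_sub_le hη hM he (resolvent M w t) v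
  obtain ⟨C', hC0', hC'⟩ :=
    exists_integral_sq_inner_sub_fwd_le hη hM e (meanAdj M w (resolvent M w t)) v
  have hsum := fun x n => sum_inner_fwd (e := e) hL x v t n
  generalize resolvent M w t = a at *
  generalize meanAdj M w a = b at *
  refine ⟨2 * C + 2 * C', by positivity, fun n m hn => ?_⟩
  have hn' : (0 : ℝ) < n := by exact_mod_cast hn
  have hS := hC n m
  have hr := hC' n
  have i1 : Integrable (fun ω => (∑ k ∈ Finset.range n,
      (fwdIncr M e w a v (η · ω) k - truncIncr M e w a m (η · ω) k)) ^ 2) P :=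
    (memLp_finsetSum _ fun k _ =>
      (memLp_fwdIncr hη a v k).sub (memLp_truncIncr hη a m k)).integrable_sq
  have i2 : Integrable (fun ω => ⟪b, v - fwd M e (η · ω) v n⟫ ^ 2) P :=
    (((memLp_const v).sub (memLp_fwd hη v n)).const_inner b).integrable_sq
  have i0 : Integrable (fun ω => ((√n)⁻¹ * ∑ k ∈ Finset.range n,
        ⟪t, fwd M e (η · ω) v (k + 1)⟫ - (√n)⁻¹ * ∑ k ∈ Finset.range n,
        truncIncr M e w a m (η · ω) k) ^ 2) P :=
    ((memLp_const_mul_sum_inner_fwd hη v t n _).sub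
      (memLp_const_mul_sum_truncIncr hη a m n _)).integrable_sq
  have hdecomp : ∀ ω, ((√n)⁻¹ * ∑ k ∈ Finset.range n,
        ⟪t, fwd M e (η · ω) v (k + 1)⟫ - (√n)⁻¹ * ∑ k ∈ Finset.range n,
        truncIncr M e w a m (η · ω) k) ^ 2 ≤ (n : ℝ)⁻¹ *
        (2 * (∑ k ∈ Finset.range n,
          (fwdIncr M e w a v (η · ω) k - truncIncr M e w a m (η · ω) k)) ^ 2 +
          2 * ⟪b, v - fwd M e (η · ω) v n⟫ ^ 2) := by
    intro ω
    rw [hsum, Finset.sum_sub_distrib, ← mul_sub, mul_pow, inv_pow, Real.sq_sqrt hn'.le]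
    gcongr
    generalize ∑ k ∈ Finset.range n, fwdIncr M e w a v (η · ω) k = A
    generalize ∑ k ∈ Finset.range n, truncIncr M e w a m (η · ω) k = B
    generalize ⟪b, v - fwd M e (η · ω) v n⟫ = R
    linarith [sq_nonneg (A - B - R)]
  refine (integral_mono i0 (((i1.const_mul 2).add (i2.const_mul 2)).const_mul _) hdecomp).trans ?_
  simp only [Pi.add_apply]
  rw [integral_const_mul, integral_add (i1.const_mul 2) (i2.const_mul 2), integral_const_mul,
    integral_const_mul]
  have hfin : (n : ℝ)⁻¹ * (2 * (C * (1 + n * ρ ^ m)) + 2 * C') =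
      (2 * C + 2 * C') * (n : ℝ)⁻¹ + 2 * C * ρ ^ m := by field_simp; ring
  refine le_trans (by gcongr) (hfin.trans_le ?_)
  have h2 : 0 ≤ 2 * C' * ρ ^ m := by positivity
  linarith

/-- The variances of the truncated increments converge to the long-run variance. -/
lemma tendsto_integral_truncIncr_sq (hη : IsIIDSeq η w P) (hM : IsMeanContractive M w ρ)
    (he : ∑ t, w t • e t = 0) (t : H) :
    Tendsto (fun m => ∫ ω, truncIncr M e w (resolvent M w t) m (η · ω) 0 ^ 2 ∂P) atTop
      (𝓝 (longRunForm hη hM e t t)) := by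
  obtain ⟨hρ0, hρ1⟩ := hM.pos, hM.lt_one
  set a := resolvent M w t with ha
  obtain ⟨c, hc0, hc⟩ := exists_abs_incr_sub_le M e w a
  obtain ⟨C, hC0, hC⟩ := exists_integral_norm_stat_sub_sq_le hη hM e 0
  set g : Ω → ℝ := fun ω => incr M e w a (η ((0 : ℤ) + 1) ω) (stat M e (η · ω) 0) with hg
  have hgL : MemLp g 2 P := memLp_incr hη a (memLp_stat hη hM e 0)
  have hV : ∫ ω, g ω ^ 2 ∂P = longRunForm hη hM e t t :=
    integral_incr_resolvent_sq hη hM he 1 t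
  -- The weight in the splitting of `f² - g²` below is `r^m`: as `E(g - f)²` is of order `r^{2m}`,
  -- dividing it by `r^m` still leaves `r^m`.
  set r := √ρ with hr
  have hr0 : 0 < r := Real.sqrt_pos.2 hρ0
  have hr1 : r < 1 := by rw [hr, Real.sqrt_lt' one_pos]; simpa using hρ1
  have hrρ : r ^ 2 = ρ := Real.sq_sqrt hρ0.le
  set V := longRunForm hη hM e t t
  have hbound : ∀ m : ℕ, |∫ ω, truncIncr M e w a m (η · ω) 0 ^ 2 ∂P - V| ≤
      r ^ m * (V + 2 * (c ^ 2 * C)) := by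
    intro m
    set f : Ω → ℝ := fun ω => truncIncr M e w a m (η · ω) 0 with hf
    have hfL : MemLp f 2 P := memLp_truncIncr hη a m 0
    have hdL : MemLp (fun ω => g ω - f ω) 2 P := hgL.sub hfL
    have hd2 : ∫ ω, (g ω - f ω) ^ 2 ∂P ≤ c ^ 2 * (C * ρ ^ m) := by
      refine le_trans ?_ (mul_le_mul_of_nonneg_left (hC m 0) (sq_nonneg c))
      rw [← integral_const_mul]
      refine integral_mono hdL.integrable_sq (Integrable.const_mul
        (((memLp_stat hη hM e 0).sub (memLp_bwd hη (memLp_const 0))).integrable_norm_pow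
          (by simp)) _) fun ω => ?_
      simp only
      rw [← mul_pow, ← sq_abs]
      gcongr
      exact hc _ _ _
    rw [← hV, ← integral_sub hfL.integrable_sq hgL.integrable_sq]
    refine (abs_integral_le_integral_abs).trans ?_
    have hrm : 0 < r ^ m := by positivity
    have hpt : ∀ ω, |f ω ^ 2 - g ω ^ 2| ≤ r ^ m * g ω ^ 2 + (1 + (r ^ m)⁻¹) * (g ω - f ω) ^ 2 := by
      intro ω
      have h1 : 0 ≤ (r ^ m)⁻¹ * (r ^ m * g ω - (g ω - f ω)) ^ 2 := by positivity
      have h2 : 0 ≤ (r ^ m)⁻¹ * (r ^ m * g ω + (g ω - f ω)) ^ 2 := by positivity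
      have e1 : (r ^ m)⁻¹ * (r ^ m * g ω - (g ω - f ω)) ^ 2 = r ^ m * g ω ^ 2 -
          2 * g ω * (g ω - f ω) + (r ^ m)⁻¹ * (g ω - f ω) ^ 2 := by field_simp; ring
      have e2 : (r ^ m)⁻¹ * (r ^ m * g ω + (g ω - f ω)) ^ 2 = r ^ m * g ω ^ 2 +
          2 * g ω * (g ω - f ω) + (r ^ m)⁻¹ * (g ω - f ω) ^ 2 := by field_simp; ring
      have h3 := sq_nonneg (g ω - f ω)
      rw [abs_le]
      constructor <;> nlinarith
    have i1 : Integrable (fun ω => r ^ m * g ω ^ 2) P := hgL.integrable_sq.const_mul _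
    have i2 : Integrable (fun ω => (1 + (r ^ m)⁻¹) * (g ω - f ω) ^ 2) P :=
      hdL.integrable_sq.const_mul _
    refine (integral_mono (hfL.integrable_sq.sub hgL.integrable_sq).abs (i1.add i2) hpt).trans ?_
    simp only [Pi.add_apply]
    rw [integral_add i1 i2, integral_const_mul, integral_const_mul]
    have h4 : (1 + (r ^ m)⁻¹) * ∫ ω, (g ω - f ω) ^ 2 ∂P ≤
        (1 + (r ^ m)⁻¹) * (c ^ 2 * (C * ρ ^ m)) := by gcongr
    have h5 : (1 + (r ^ m)⁻¹) * (c ^ 2 * (C * ρ ^ m)) =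
        c ^ 2 * C * (r ^ m * r ^ m) + c ^ 2 * C * r ^ m := by
      rw [← hrρ, ← pow_mul, mul_comm 2 m, pow_mul]
      field_simp
    have h6 : r ^ m * r ^ m ≤ r ^ m := by
      have : r ^ m ≤ 1 := pow_le_one₀ hr0.le hr1.le
      nlinarith
    have h7 : c ^ 2 * C * (r ^ m * r ^ m) ≤ c ^ 2 * C * r ^ m := by gcongr
    linarith
  rw [tendsto_iff_norm_sub_tendsto_zero]
  refine squeeze_zero (fun m => norm_nonneg _) hbound ?_
  simpa using (tendsto_pow_atTop_nhds_zero_of_lt_one hr0.le hr1).mul_const (V + 2 * (c ^ 2 * C))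

-- The map `x ↦ exp(ix)` is 1-Lipschitz, and an `L¹` norm is at most the `L²` norm on a probability
-- space.
open Complex in
lemma norm_integral_exp_sub_le {f g : Ω → ℝ} (hf : MemLp f 2 P) (hg : MemLp g 2 P) :
    ‖∫ ω, cexp (I * (f ω : ℝ)) ∂P - ∫ ω, cexp (I * (g ω : ℝ)) ∂P‖ ≤
      √(∫ ω, (f ω - g ω) ^ 2 ∂P) := by
  have hi : ∀ {f : Ω → ℝ}, MemLp f 2 P → Integrable (fun ω => cexp (I * (f ω : ℝ))) P := by
    intro f hf
    refine (integrable_const (1 : ℝ)).mono' ?_ (ae_of_all _ fun ω => ?_)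
    · have hc : Continuous fun x : ℝ => cexp (I * (x : ℝ)) := by fun_prop
      exact hc.comp_aestronglyMeasurable hf.1
    · rw [mul_comm, norm_exp_ofReal_mul_I]
  rw [← integral_sub (hi hf) (hi hg)]
  refine le_trans ?_ (integral_abs_le_sqrt (hf.sub hg))
  refine norm_integral_le_of_norm_le ((hf.sub hg).integrable (by norm_num)).abs
    (ae_of_all _ fun ω => ?_)
  have h1 : cexp (I * (f ω : ℝ)) - cexp (I * (g ω : ℝ)) =
      cexp (I * (g ω : ℝ)) * (cexp (I * ((f ω - g ω : ℝ) : ℂ)) - 1) := by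
    rw [mul_sub, ← Complex.exp_add, mul_one]
    congr 2
    push_cast
    ring
  rw [h1, norm_mul, mul_comm I (g ω : ℂ), norm_exp_ofReal_mul_I, one_mul]
  exact Real.norm_exp_I_mul_ofReal_sub_one_le

open Complex in
/-- The central limit theorem for the forward iterates, in terms of characteristic functions. -/
theorem tendsto_integral_exp_inner_fwd (hη : IsIIDSeq η w P) (hM : IsMeanContractive M w ρ)
    (he : ∑ t, w t • e t = 0) (v t : H) :
    Tendsto (fun n : ℕ => ∫ ω, cexp (I * ((√n)⁻¹ *
        ∑ k ∈ Finset.range n, ⟪t, fwd M e (η · ω) v (k + 1)⟫ : ℝ)) ∂P) atTop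
      (𝓝 (cexp (-(longRunForm hη hM e t t / 2 : ℝ)))) := by
  obtain ⟨hρ0, hρ1⟩ := hM.pos, hM.lt_one
  obtain ⟨G, hG0, hG⟩ := exists_integral_sq_sub_le hη hM he v t
  set a := resolvent M w t with ha
  have hlim : Tendsto (fun m : ℕ =>
      cexp (-((∫ ω, truncIncr M e w a m (η · ω) 0 ^ 2 ∂P) / 2 : ℝ))) atTop
      (𝓝 (cexp (-(longRunForm hη hM e t t / 2 : ℝ)))) := by
    have hc : Continuous fun x : ℝ => cexp (-(x / 2 : ℝ)) := by fun_prop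
    exact (hc.tendsto _).comp (tendsto_integral_truncIncr_sq hη hM he t)
  rw [Metric.tendsto_atTop]
  intro ε hε
  have hsmall : Tendsto (fun m : ℕ => √(G * (ρ ^ m + ρ ^ m))) atTop (𝓝 0) := by
    have h1 := tendsto_pow_atTop_nhds_zero_of_lt_one hρ0.le hρ1
    have h2 := (Real.continuous_sqrt.tendsto 0).comp (by simpa using (h1.add h1).const_mul G)
    rwa [Real.sqrt_zero] at h2
  -- Fix the truncation level first. Once `1/n ≤ ρ^m`, the approximation error is at most `√(G(ρ^m +
  -- ρ^m))`, whatever the value of `n`.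
  obtain ⟨m, hm1, hm2⟩ := ((hsmall.eventually_lt_const (show (0 : ℝ) < ε / 3 by positivity)).and
    (Metric.tendsto_nhds.1 hlim (ε / 3) (by positivity))).exists
  have hn1 : ∀ᶠ n : ℕ in atTop, (n : ℝ)⁻¹ ≤ ρ ^ m :=
    (tendsto_inv_atTop_nhds_zero_nat (𝕜 := ℝ)).eventually_le_const (by positivity)
  have hn2 := Metric.tendsto_nhds.1 (tendsto_integral_exp_truncIncr (M := M) hη he a m) (ε / 3)
    (by positivity)
  rw [← eventually_atTop]
  filter_upwards [hn1, hn2, eventually_gt_atTop 0] with n h1 h2 h3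
  have h4 := (norm_integral_exp_sub_le (P := P)
    (f := fun ω => (√n)⁻¹ * ∑ k ∈ Finset.range n, ⟪t, fwd M e (η · ω) v (k + 1)⟫)
    (g := fun ω => (√n)⁻¹ * ∑ k ∈ Finset.range n, truncIncr M e w a m (η · ω) k)
    (memLp_const_mul_sum_inner_fwd hη v t n _) (memLp_const_mul_sum_truncIncr hη a m n _)).trans
    (Real.sqrt_le_sqrt ((hG n m h3).trans (by gcongr : _ ≤ G * (ρ ^ m + ρ ^ m))))
  rw [← dist_eq_norm] at h4
  refine (dist_triangle4 _ _ _ _).trans_lt ((add_lt_add (add_lt_add (h4.trans_lt hm1) h2)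
    hm2).trans_eq (by ring))

end CLT

end RandomAffine

namespace DropoutGD

open RandomAffine

/-! ### From dropout matrices to finitely many masks -/

section Masks

variable {Ω : Type*} [MeasurableSpace Ω] {d : ℕ} {p : unitInterval} {P : Measure Ω}

/-- The `0`-`1` vector of a mask. -/
def maskVec (t : Fin d → Bool) (i : Fin d) : ℝ := if t i then 1 else 0

/-- The `0`-`1` diagonal matrix of a mask. -/
def maskMatrix (t : Fin d → Bool) : Matrix (Fin d) (Fin d) ℝ := Matrix.diagonal (maskVec t)

lemma maskMatrix_mulVec (t : Fin d → Bool) (v : Fin d → ℝ) (i : Fin d) :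
    (maskMatrix t *ᵥ v) i = maskVec t i * v i := Matrix.mulVec_diagonal _ _ _

lemma maskVec_mul_self (t : Fin d → Bool) (i : Fin d) :
    maskVec t i * maskVec t i = maskVec t i := by
  unfold maskVec; split_ifs <;> simp

/-- The probability of a mask. -/
def maskWeight (p : ℝ) (t : Fin d → Bool) : ℝ := ∏ i, if t i then p else 1 - p

/-- The mask of the entries of a vector that are equal to `1`. -/
def toMask (v : Fin d → ℝ) (i : Fin d) : Bool := decide (v i = 1)

lemma measurable_toMask : Measurable (toMask (d := d)) := by
  refine measurable_pi_lambda _ fun i => measurable_to_bool ?_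
  have : (fun v : Fin d → ℝ => toMask v i) ⁻¹' {true} = (fun v => v i) ⁻¹' {1} := by
    ext v; simp [toMask]
  rw [this]
  exact measurable_pi_apply i (measurableSet_singleton 1)

lemma ae_bernoulli (p : unitInterval) :
    ∀ᵐ x ∂(bernoulliMeasure (1 : ℝ) 0 p), x = 1 ∨ x = 0 := by
  rw [ae_iff]
  have h := bernoulliMeasure_apply_of_notMem_of_notMem (x := (1 : ℝ)) (y := 0) p
    (s := {x | ¬(x = 1 ∨ x = 0)})
  exact h ((measurableSet_singleton (1 : ℝ)).union (measurableSet_singleton 0)).compl (by simp)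
    (by simp)

namespace IsDropoutMatrix

variable {D : Ω → Matrix (Fin d) (Fin d) ℝ}

lemma ae_eq_maskMatrix (hD : IsDropoutMatrix p D P) :
    ∀ᵐ ω ∂P, D ω = maskMatrix (toMask (D ω).diag) := by
  have h : ∀ᵐ ω ∂P, ∀ i, D ω i i = 1 ∨ D ω i i = 0 := by
    refine ae_all_iff.2 fun i => ?_
    have h1 := ae_bernoulli p
    rw [← (hD.law i).map_eq] at h1
    exact ae_of_ae_map (hD.law i).aemeasurable h1
  filter_upwards [h] with ω hω
  ext i j
  rcases eq_or_ne i j with rfl | hij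
  · rcases hω i with h1 | h1 <;> simp [maskMatrix, maskVec, toMask, h1]
  · rw [hD.isDiag ω hij, maskMatrix, Matrix.diagonal_apply_ne _ hij]

lemma measureReal_toMask [IsProbabilityMeasure P] (hD : IsDropoutMatrix p D P)
    (t : Fin d → Bool) : P.real {ω | toMask (D ω).diag = t} = maskWeight p t := by
  have h1 : {ω | toMask (D ω).diag = t} =
      ⋂ i ∈ Finset.univ, (fun ω => D ω i i) ⁻¹' {x | decide (x = 1) = t i} := by
    ext ω
    simp only [Set.mem_ofPred_eq, funext_iff, toMask, Finset.mem_univ, Set.iInter_true, Set.mem_iInter,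
      Set.mem_preimage]
    exact Iff.rfl
  have hms : ∀ b : Bool, MeasurableSet {x : ℝ | decide (x = 1) = b} := by
    intro b
    cases b
    · have h : {x : ℝ | decide (x = 1) = false} = {1}ᶜ := by ext; simp
      rw [h]
      exact (measurableSet_singleton (1 : ℝ)).compl
    · simp
  have h2 := hD.indep.measure_inter_preimage_eq_mul Finset.univ
    (sets := fun i => {x | decide (x = 1) = t i}) fun i _ => hms (t i)
  rw [h1, measureReal_def, h2, ENNReal.toReal_prod, maskWeight]
  refine Finset.prod_congr rfl fun i _ => ?_
  rw [← Measure.map_apply_of_aemeasurable (hD.law i).aemeasurable (hms (t i)), (hD.law i).map_eq,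
    ← measureReal_def, bernoulliMeasure_real_apply p (hms (t i))]
  cases t i <;> simp

lemma integral_diag (hD : IsDropoutMatrix p D P) (i : Fin d) : ∫ ω, D ω i i ∂P = p := by
  rw [(hD.law i).integral_eq, integral_bernoulliMeasure]
  simp

lemma integral_diag_mul [IsProbabilityMeasure P] (hD : IsDropoutMatrix p D P) (i j : Fin d) :
    ∫ ω, D ω i i * D ω j j ∂P = if i = j then (p : ℝ) else (p : ℝ) ^ 2 := by
  split_ifs with hij
  · subst hij
    rw [← integral_diag hD i]
    refine integral_congr_ae ?_
    filter_upwards [hD.ae_eq_maskMatrix] with ω hω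
    rw [hω]
    simp [maskMatrix, maskVec_mul_self]
  · rw [(hD.indep.indepFun hij).integral_fun_mul_eq_mul_integral
      (hD.law i).aemeasurable.aestronglyMeasurable (hD.law j).aemeasurable.aestronglyMeasurable,
      hD.integral_diag, hD.integral_diag, sq]

end IsDropoutMatrix

lemma _root_.RandomAffine.IsIIDSeq.integral_comp {T : Type*} [MeasurableSpace T] [Fintype T]
    [DiscreteMeasurableSpace T] [IsProbabilityMeasure P] {η : ℤ → Ω → T} {w : T → ℝ}
    (hη : IsIIDSeq η w P) (k : ℤ) (f : T → ℝ) : ∫ ω, f (η k ω) ∂P = ∑ t, w t * f t := by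
  rw [hη.integral_freeze (S := ∅) (g := fun t _ => f t) (by simp)
    (fun t => stronglyMeasurable_const) fun t => integrable_const _]
  simp

/-- An i.i.d. sequence of dropout matrices is almost surely given by an i.i.d. sequence of
masks. -/
lemma IsIIDDropout.exists_mask [IsProbabilityMeasure P]
    {D : ℤ → Ω → Matrix (Fin d) (Fin d) ℝ} (hD : IsIIDDropout p D P) :
    ∃ η : ℤ → Ω → Fin d → Bool, IsIIDSeq η (maskWeight p) P ∧
      ∀ᵐ ω ∂P, ∀ k, D k ω = maskMatrix (η k ω) := by
  have hm : ∀ k, AEMeasurable (fun ω => (D k ω).diag) P := fun k =>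
    aemeasurable_pi_lambda _ fun i => ((hD.isDropoutMatrix k).law i).aemeasurable
  -- The diagonals are only almost everywhere measurable, so the masks are read off measurable
  -- modifications.
  set η : ℤ → Ω → Fin d → Bool := fun k ω => toMask ((hm k).mk _ ω) with hη
  have hae : ∀ k, (fun ω => toMask (D k ω).diag) =ᵐ[P] η k := fun k => by
    filter_upwards [(hm k).ae_eq_mk] with ω hω
    simp only [hη]
    rw [← hω]
  refine ⟨η, ⟨fun k => measurable_toMask.comp (hm k).measurable_mk, ?_, fun k t => ?_⟩, ?_⟩
  · exact (iIndepFun_congr hae).1 (hD.indep.comp (fun _ => toMask) fun _ => measurable_toMask)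
  · rw [← (hD.isDropoutMatrix k).measureReal_toMask t]
    refine measureReal_congr ?_
    filter_upwards [hae k] with ω hω
    change (η k ω = t) = (toMask (D k ω).diag = t)
    rw [hω]
  · refine ae_all_iff.2 fun k => ?_
    filter_upwards [hae k, (hD.isDropoutMatrix k).ae_eq_maskMatrix] with ω h1 h2
    rw [← h1]
    exact h2

/-- The moments of the explicit weights are read off the law of `D` instead of being computed from
the product formula. -/
lemma sum_maskWeight_mul [IsProbabilityMeasure P] {D : ℤ → Ω → Matrix (Fin d) (Fin d) ℝ}
    (hD : IsIIDDropout p D P) (i : Fin d) : ∑ t, maskWeight p t * maskVec t i = (p : ℝ) := by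
  obtain ⟨η, hη, hDη⟩ := hD.exists_mask
  rw [← hη.integral_comp 0 (fun t => maskVec t i), ← (hD.isDropoutMatrix 0).integral_diag i]
  refine integral_congr_ae ?_
  filter_upwards [hDη] with ω hω
  simp [hω, maskMatrix]

lemma sum_maskWeight_mul_mul [IsProbabilityMeasure P] {D : ℤ → Ω → Matrix (Fin d) (Fin d) ℝ}
    (hD : IsIIDDropout p D P) (i j : Fin d) :
    ∑ t, maskWeight p t * (maskVec t i * maskVec t j) = if i = j then (p : ℝ) else (p : ℝ) ^ 2 := by
  obtain ⟨η, hη, hDη⟩ := hD.exists_mask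
  rw [← hη.integral_comp 0 (fun t => maskVec t i * maskVec t j),
    ← (hD.isDropoutMatrix 0).integral_diag_mul i j]
  refine integral_congr_ae ?_
  filter_upwards [hDη] with ω hω
  simp [hω, maskMatrix]

end Masks

/-! ### Moments of masks and the rescaled Gram matrix -/

section Algebra

variable {N d s : ℕ} {X : Matrix (Fin N) (Fin d) ℝ} {p : ℝ}

/-- The factors are the second moments of a mask, so this is the entrywise form of `E[D A D] = p
A_p`. -/
lemma rescale_apply (A : Matrix (Fin d) (Fin d) ℝ) (i j : Fin d) :
    p * rescale p A i j = (if i = j then p else p ^ 2) * A i j := by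
  simp only [rescale, diagPart, Matrix.add_apply, Matrix.smul_apply, smul_eq_mul]
  rcases eq_or_ne i j with rfl | h
  · rw [Matrix.diagonal_apply_eq, Matrix.diag_apply, if_pos rfl]
    ring
  · rw [Matrix.diagonal_apply_ne _ h, if_neg h]
    ring

lemma dotProduct_gram_mulVec (u v : Fin d → ℝ) :
    u ⬝ᵥ (Xᵀ * X) *ᵥ v = (X *ᵥ u) ⬝ᵥ (X *ᵥ v) := by
  rw [← Matrix.mulVec_mulVec, Matrix.dotProduct_mulVec, Matrix.vecMul_transpose]

/-- The weights have the first and second moments of a mask with independent entries. -/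
structure HasMaskMoments (p : ℝ) (w : (Fin d → Bool) → ℝ) : Prop where
  first : ∀ i, ∑ t, w t * maskVec t i = p
  second : ∀ i j, ∑ t, w t * (maskVec t i * maskVec t j) = if i = j then p else p ^ 2

variable {w : (Fin d → Bool) → ℝ}

lemma HasMaskMoments.sum_mul_mulVec (hw : HasMaskMoments p w) (A : Matrix (Fin d) (Fin d) ℝ)
    (v : Fin d → ℝ) (i : Fin d) :
    ∑ t, w t * (maskVec t i * (A *ᵥ (maskMatrix t *ᵥ v)) i) = p * (rescale p A *ᵥ v) i := by
  calc ∑ t, w t * (maskVec t i * (A *ᵥ (maskMatrix t *ᵥ v)) i)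
      = ∑ t, ∑ j, A i j * v j * (w t * (maskVec t i * maskVec t j)) := by
        refine Finset.sum_congr rfl fun t _ => ?_
        have h : (A *ᵥ (maskMatrix t *ᵥ v)) i = ∑ j, A i j * (maskMatrix t *ᵥ v) j := rfl
        rw [h, Finset.mul_sum, Finset.mul_sum]
        refine Finset.sum_congr rfl fun j _ => ?_
        rw [maskMatrix_mulVec]
        ring
    _ = ∑ j, A i j * v j * (if i = j then p else p ^ 2) := by
        rw [Finset.sum_comm]
        simp_rw [← Finset.mul_sum, hw.second]
    _ = p * (rescale p A *ᵥ v) i := by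
        simp only [Matrix.mulVec, dotProduct, Finset.mul_sum]
        refine Finset.sum_congr rfl fun j _ => ?_
        rw [← mul_assoc, rescale_apply]
        ring

lemma HasMaskMoments.sum_dotProduct (hw : HasMaskMoments p w) (A : Matrix (Fin d) (Fin d) ℝ)
    (u v : Fin d → ℝ) :
    ∑ t, w t * ((maskMatrix t *ᵥ u) ⬝ᵥ A *ᵥ (maskMatrix t *ᵥ v)) = p * (u ⬝ᵥ rescale p A *ᵥ v) := by
  calc _ = ∑ t, ∑ i, u i * (w t * (maskVec t i * (A *ᵥ (maskMatrix t *ᵥ v)) i)) := by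
        refine Finset.sum_congr rfl fun t _ => ?_
        rw [dotProduct, Finset.mul_sum]
        refine Finset.sum_congr rfl fun i _ => ?_
        rw [maskMatrix_mulVec]
        ring
    _ = ∑ i, u i * (p * (rescale p A *ᵥ v) i) := by
        rw [Finset.sum_comm]
        simp_rw [← Finset.mul_sum, hw.sum_mul_mulVec]
    _ = _ := by
        rw [dotProduct, Finset.mul_sum]
        exact Finset.sum_congr rfl fun i _ => by ring

lemma HasMaskMoments.sum_linear (hw : HasMaskMoments p w) (u v : Fin d → ℝ) :
    ∑ t, w t * (u ⬝ᵥ maskMatrix t *ᵥ v) = p * (u ⬝ᵥ v) := by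
  calc _ = ∑ t, ∑ i, u i * v i * (w t * maskVec t i) := by
        refine Finset.sum_congr rfl fun t _ => ?_
        rw [dotProduct, Finset.mul_sum]
        refine Finset.sum_congr rfl fun i _ => ?_
        rw [maskMatrix_mulVec]
        ring
    _ = _ := by
        rw [Finset.sum_comm]
        simp_rw [← Finset.mul_sum, hw.first]
        rw [dotProduct, Finset.mul_sum]
        exact Finset.sum_congr rfl fun i _ => by ring

lemma gram_apply_self_pos (hX : ∀ j, ∃ i, X i j ≠ 0) (j : Fin d) : 0 < (Xᵀ * X) j j := by
  obtain ⟨i, hi⟩ := hX j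
  rw [Matrix.mul_apply]
  refine Finset.sum_pos' (fun i _ => ?_) ⟨i, Finset.mem_univ i, ?_⟩
  · exact mul_self_nonneg (X i j)
  · exact mul_self_pos.2 hi

/-- The rescaled Gram matrix is coercive. -/
lemma exists_mul_dotProduct_le (hX : ∀ j, ∃ i, X i j ≠ 0) (hp : p ∈ Set.Ioo (0 : ℝ) 1) :
    ∃ c, 0 < c ∧ ∀ v : Fin d → ℝ, c * (v ⬝ᵥ v) ≤ v ⬝ᵥ rescale p (Xᵀ * X) *ᵥ v := by
  obtain ⟨c, hc0, hc⟩ : ∃ c, 0 < c ∧ ∀ j, c ≤ (Xᵀ * X) j j := by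
    have := (Set.finite_range fun j => (Xᵀ * X) j j).bddBelow
    rcases isEmpty_or_nonempty (Fin d) with h | h
    · exact ⟨1, one_pos, fun j => (h.false j).elim⟩
    · obtain ⟨j, hj⟩ := Finite.exists_min fun j => (Xᵀ * X) j j
      exact ⟨_, gram_apply_self_pos hX j, hj⟩
  -- Only the diagonal part of the rescaled matrix is used, with `c` a lower bound of the Gram
  -- diagonal; the part `p XᵀX` is positive semidefinite and is dropped.
  refine ⟨(1 - p) * c, mul_pos (sub_pos.2 hp.2) hc0, fun v => ?_⟩
  rw [rescale, Matrix.add_mulVec, dotProduct_add, Matrix.smul_mulVec, Matrix.smul_mulVec,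
    dotProduct_smul, dotProduct_smul, dotProduct_gram_mulVec, smul_eq_mul, smul_eq_mul, mul_assoc]
  have h1 : 0 ≤ p * ((X *ᵥ v) ⬝ᵥ (X *ᵥ v)) :=
    mul_nonneg hp.1.le (Finset.sum_nonneg fun i _ => mul_self_nonneg _)
  have h2 : c * (v ⬝ᵥ v) ≤ v ⬝ᵥ diagPart (Xᵀ * X) *ᵥ v := by
    rw [dotProduct, dotProduct, Finset.mul_sum]
    refine Finset.sum_le_sum fun j _ => ?_
    rw [diagPart, Matrix.mulVec_diagonal, Matrix.diag_apply]
    have := mul_le_mul_of_nonneg_right (hc j) (mul_self_nonneg (v j))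
    linarith
  have h3 := mul_le_mul_of_nonneg_left h2 (sub_pos.2 hp.2).le
  linarith

/-- Coercivity makes the matrix injective, so the inverse in the definition of the estimator is a
genuine one. -/
lemma rescale_mulVec_regEstimator (hX : ∀ j, ∃ i, X i j ≠ 0) (hp : p ∈ Set.Ioo (0 : ℝ) 1)
    (y : Fin N → ℝ) : rescale p (Xᵀ * X) *ᵥ regEstimator p X y = Xᵀ *ᵥ y := by
  obtain ⟨c, hc0, hc⟩ := exists_mul_dotProduct_le hX hp
  have hu : IsUnit (rescale p (Xᵀ * X)) := by
    rw [← Matrix.mulVec_injective_iff_isUnit]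
    intro u v huv
    have h1 := hc (u - v)
    have h2 : rescale p (Xᵀ * X) *ᵥ (u - v) = 0 := by
      rw [Matrix.mulVec_sub, sub_eq_zero]
      exact huv
    rw [h2, dotProduct_zero] at h1
    have h3 : 0 ≤ (u - v) ⬝ᵥ (u - v) := Finset.sum_nonneg fun i _ => mul_self_nonneg _
    have h4 : (u - v) ⬝ᵥ (u - v) = 0 := by nlinarith
    exact sub_eq_zero.1 (dotProduct_self_eq_zero.1 h4)
  rw [regEstimator, Matrix.mulVec_mulVec,
    Matrix.mul_nonsing_inv _ ((Matrix.isUnit_iff_isUnit_det _).1 hu), Matrix.one_mulVec]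

lemma norm_toLp_sq {n : Type*} [Fintype n] (v : n → ℝ) : ‖WithLp.toLp 2 v‖ ^ 2 = v ⬝ᵥ v := by
  rw [EuclideanSpace.norm_sq_eq, dotProduct]
  exact Finset.sum_congr rfl fun i _ => by rw [Real.norm_eq_abs, sq_abs, sq]

/-- This is `A² ≤ ‖A‖ A` for `A = XᵀX`, from `‖Xᵀ(Xu)‖ ≤ ‖Xᵀ‖ ‖Xu‖` and `‖XᵀX‖ = ‖Xᵀ‖²`. It is what
turns `α < 2/‖XᵀX‖` into a decrease of the length. -/
lemma gram_mulVec_sq_le (u : Fin d → ℝ) :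
    ((Xᵀ * X) *ᵥ u) ⬝ᵥ ((Xᵀ * X) *ᵥ u) ≤ ‖Xᵀ * X‖ * (u ⬝ᵥ (Xᵀ * X) *ᵥ u) := by
  have h1 : ‖Xᵀ * X‖ = ‖Xᵀ‖ * ‖Xᵀ‖ := by
    have h2 := Matrix.l2_opNorm_conjTranspose_mul_self X
    have h3 := Matrix.l2_opNorm_conjTranspose X
    rw [Matrix.conjTranspose_eq_transpose_of_trivial] at h2 h3
    rw [h2, h3]
  have h2 := Matrix.l2_opNorm_mulVec Xᵀ (WithLp.toLp 2 (X *ᵥ u))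
  have h3 := pow_le_pow_left₀ (norm_nonneg _) h2 2
  rw [mul_pow, norm_toLp_sq] at h3
  rw [dotProduct_gram_mulVec u u, ← Matrix.mulVec_mulVec, h1, ← norm_toLp_sq (X *ᵥ u), ← sq]
  exact h3

/-- The squared length after one homogeneous gradient step with a mask. -/
lemma step_dotProduct_self_le (t : Fin d → Bool) {α : ℝ} (v : Fin d → ℝ) :
    (v - α • (maskMatrix t *ᵥ ((Xᵀ * X) *ᵥ (maskMatrix t *ᵥ v)))) ⬝ᵥ
        (v - α • (maskMatrix t *ᵥ ((Xᵀ * X) *ᵥ (maskMatrix t *ᵥ v)))) ≤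
      v ⬝ᵥ v - α * (2 - α * ‖Xᵀ * X‖) *
        ((maskMatrix t *ᵥ v) ⬝ᵥ (Xᵀ * X) *ᵥ (maskMatrix t *ᵥ v)) := by
  set u := maskMatrix t *ᵥ v with hu
  set z := (Xᵀ * X) *ᵥ u with hz
  have h1 : v ⬝ᵥ (maskMatrix t *ᵥ z) = u ⬝ᵥ z := by
    simp only [hu, dotProduct, maskMatrix_mulVec]
    exact Finset.sum_congr rfl fun i _ => by ring
  -- The outer mask only deletes coordinates.
  have h2 : (maskMatrix t *ᵥ z) ⬝ᵥ (maskMatrix t *ᵥ z) ≤ z ⬝ᵥ z := by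
    simp only [dotProduct, maskMatrix_mulVec]
    refine Finset.sum_le_sum fun i _ => ?_
    unfold maskVec
    split_ifs
    · simp
    · simpa using mul_self_nonneg (z i)
  have h3 : z ⬝ᵥ z ≤ ‖Xᵀ * X‖ * (u ⬝ᵥ z) := gram_mulVec_sq_le u
  have h4 : α ^ 2 * ((maskMatrix t *ᵥ z) ⬝ᵥ (maskMatrix t *ᵥ z)) ≤
      α ^ 2 * (‖Xᵀ * X‖ * (u ⬝ᵥ z)) := mul_le_mul_of_nonneg_left (h2.trans h3) (sq_nonneg α)
  simp only [sub_dotProduct, dotProduct_sub, smul_dotProduct, dotProduct_smul, smul_eq_mul]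
  rw [dotProduct_comm (maskMatrix t *ᵥ z) v, h1]
  linarith

end Algebra

end DropoutGD

namespace DropoutGD

open RandomAffine

/-! ### All runs as one affine recursion -/

section System

variable {N d s : ℕ}

lemma vecs_apply (u : Fin s → Fin d → ℝ) (a : Fin s × Fin d) : vecs u a = u a.1 a.2 := rfl

/-- The stacked vector of deviations from `c`. -/
def centre (c : Fin d → ℝ) (u : Fin s → Fin d → ℝ) : EuclideanSpace ℝ (Fin s × Fin d) :=
  WithLp.toLp 2 (vecs fun l => u l - c)

lemma centre_apply (c : Fin d → ℝ) (u : Fin s → Fin d → ℝ) (a : Fin s × Fin d) :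
    centre c u a = u a.1 a.2 - c a.2 := rfl

/-- The `l`-th block of a stacked vector. -/
def block (v : EuclideanSpace ℝ (Fin s × Fin d)) (l : Fin s) (i : Fin d) : ℝ := v (l, i)

lemma block_centre (c : Fin d → ℝ) (u : Fin s → Fin d → ℝ) (l : Fin s) :
    block (centre c u) l = u l - c := rfl

lemma norm_sq_eq_sum_block (v : EuclideanSpace ℝ (Fin s × Fin d)) :
    ‖v‖ ^ 2 = ∑ l, block v l ⬝ᵥ block v l := by
  rw [EuclideanSpace.norm_sq_eq, Fintype.sum_prod_type]
  refine Finset.sum_congr rfl fun l _ => Finset.sum_congr rfl fun i _ => ?_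
  rw [Real.norm_eq_abs, sq_abs, sq]
  rfl

/-- The linear part of a simultaneous gradient step of all runs. -/
def stepLin (X : Matrix (Fin N) (Fin d) ℝ) (α : Fin s → ℝ) (t : Fin d → Bool) :
    EuclideanSpace ℝ (Fin s × Fin d) →L[ℝ] EuclideanSpace ℝ (Fin s × Fin d) :=
  LinearMap.toContinuousLinearMap
    { toFun := fun v => WithLp.toLp 2 (vecs fun l =>
        block v l - α l • (maskMatrix t *ᵥ ((Xᵀ * X) *ᵥ (maskMatrix t *ᵥ block v l))))
      map_add' := fun u v => by
        have h : ∀ l, block (u + v) l = block u l + block v l := fun l => rfl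
        simp only [h, Matrix.mulVec_add, smul_add]
        ext a
        simp only [vecs_apply, Pi.add_apply, Pi.sub_apply, PiLp.add_apply]
        ring
      map_smul' := fun c v => by
        have h : ∀ l, block (c • v) l = c • block v l := fun l => rfl
        simp only [h, Matrix.mulVec_smul]
        ext a
        simp only [vecs_apply, Pi.sub_apply, Pi.smul_apply, PiLp.smul_apply, smul_eq_mul,
          RingHom.id_apply]
        ring }

lemma block_stepLin (X : Matrix (Fin N) (Fin d) ℝ) (α : Fin s → ℝ) (t : Fin d → Bool)
    (v : EuclideanSpace ℝ (Fin s × Fin d)) (l : Fin s) :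
    block (stepLin X α t v) l =
      block v l - α l • (maskMatrix t *ᵥ ((Xᵀ * X) *ᵥ (maskMatrix t *ᵥ block v l))) := rfl

/-- The additive part of a simultaneous gradient step, relative to `c`. -/
def stepNoise (X : Matrix (Fin N) (Fin d) ℝ) (y : Fin N → ℝ) (α : Fin s → ℝ) (c : Fin d → ℝ)
    (t : Fin d → Bool) : EuclideanSpace ℝ (Fin s × Fin d) :=
  centre c fun l => gdStep X y (α l) (maskMatrix t) c

variable {X : Matrix (Fin N) (Fin d) ℝ} {y : Fin N → ℝ} {α : Fin s → ℝ} {c : Fin d → ℝ}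

lemma centre_gdStep (t : Fin d → Bool) (u : Fin s → Fin d → ℝ) :
    centre c (fun l => gdStep X y (α l) (maskMatrix t) (u l)) =
      stepLin X α t (centre c u) + stepNoise X y α c t := by
  have h : ∀ l, gdStep X y (α l) (maskMatrix t) (u l) - c =
      (u l - c) - α l • (maskMatrix t *ᵥ ((Xᵀ * X) *ᵥ (maskMatrix t *ᵥ (u l - c)))) +
        (gdStep X y (α l) (maskMatrix t) c - c) := by
    intro l
    simp only [gdStep, Matrix.mulVec_sub, ← Matrix.mulVec_mulVec, smul_sub]
    abel
  ext a
  exact congrFun (h a.1) a.2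

/-- `backwardIterate` recurses at the innermost map and `bwd` at the outermost; `bwd_add` reconciles
them. The index `m` of the former counts `m + 1` maps. -/
lemma centre_backwardIterate (x : ℤ → Fin d → Bool) (k : ℤ) (m : ℕ) (u : Fin s → Fin d → ℝ) :
    centre c (fun l => backwardIterate X y (α l) (fun j => maskMatrix (x j)) k m (u l)) =
      bwd (stepLin X α) (stepNoise X y α c) x (m + 1) k (centre c u) := by
  induction m generalizing u with
  | zero => exact centre_gdStep (x k) u
  | succ m ih =>
    rw [bwd_add]
    refine (ih fun l => gdStep X y (α l) (maskMatrix (x (k - ((m : ℤ) + 1)))) (u l)).trans ?_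
    rw [centre_gdStep]
    push_cast
    rfl

lemma centre_gdIterate (x : ℤ → Fin d → Bool) (β₀ : Fin s → Fin d → ℝ) (k : ℕ) :
    centre c (fun l => gdIterate X y (α l) (fun j => maskMatrix (x j)) (β₀ l) k) =
      fwd (stepLin X α) (stepNoise X y α c) x (centre c β₀) k := by
  induction k with
  | zero => rfl
  | succ k ih =>
    rw [fwd_succ, ← ih]
    exact centre_gdStep _ _

lemma tendsto_backwardIterate {x : ℤ → Fin d → Bool} {k : ℤ}
    (h : ∀ v, Tendsto (fun n => bwd (stepLin X α) (stepNoise X y α c) x n k v) atTop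
      (𝓝 (stat (stepLin X α) (stepNoise X y α c) x k))) (l : Fin s) (b : Fin d → ℝ) :
    Tendsto (fun m => backwardIterate X y (α l) (fun j => maskMatrix (x j)) k m b) atTop
      (𝓝 (block (stat (stepLin X α) (stepNoise X y α c) x k) l + c)) := by
  have h1 := (h (centre c fun _ => b)).comp (tendsto_add_atTop_nat 1)
  have h2 : ∀ m, backwardIterate X y (α l) (fun j => maskMatrix (x j)) k m b =
      block (bwd (stepLin X α) (stepNoise X y α c) x (m + 1) k (centre c fun _ => b)) l + c := by
    intro m
    rw [← centre_backwardIterate, block_centre, sub_add_cancel]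
  simp_rw [h2]
  refine Tendsto.add_const c (tendsto_pi_nhds.2 fun i => ?_)
  exact ((EuclideanSpace.proj (𝕜 := ℝ) (l, i)).continuous.tendsto _).comp h1

lemma stationaryIterate_eq {x : ℤ → Fin d → Bool} {k : ℤ}
    (h : ∀ v, Tendsto (fun n => bwd (stepLin X α) (stepNoise X y α c) x n k v) atTop
      (𝓝 (stat (stepLin X α) (stepNoise X y α c) x k))) (l : Fin s) :
    stationaryIterate X y (α l) (fun j => maskMatrix (x j)) k =
      block (stat (stepLin X α) (stepNoise X y α c) x k) l + c :=
  (tendsto_backwardIterate h l 0).limUnder_eq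

variable {p : ℝ} {w : (Fin d → Bool) → ℝ}

/-- In each block the squared length drops by at least `α_l (2 - α_l ‖XᵀX‖)` times a quadratic form
whose mean is `p ⟪v, (XᵀX)_p v⟫`, and this is coercive. The blocks share the masks, but the squared
norm adds over blocks. -/
lemma exists_isMeanContractive (hX : ∀ j, ∃ i, X i j ≠ 0) (hp : p ∈ Set.Ioo (0 : ℝ) 1)
    (hα : ∀ l, α l ∈ Set.Ioo (0 : ℝ) (2 / ‖Xᵀ * X‖)) (hw0 : ∀ t, 0 ≤ w t) (hw1 : ∑ t, w t = 1)
    (hw : HasMaskMoments p w) : ∃ ρ, IsMeanContractive (stepLin X α) w ρ := by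
  obtain ⟨c, hc0, hc⟩ := exists_mul_dotProduct_le hX hp
  set κ : Fin s → ℝ := fun l => α l * (2 - α l * ‖Xᵀ * X‖) with hκ
  have hκ0 : ∀ l, 0 < κ l := by
    intro l
    obtain ⟨h1, h2⟩ := hα l
    have h3 : 0 < ‖Xᵀ * X‖ := by
      -- If the norm were zero, `2 / 0 = 0` would leave no admissible step size.
      rcases (norm_nonneg (Xᵀ * X)).eq_or_lt with h | h
      · rw [← h, div_zero] at h2
        linarith
      · exact h
    rw [lt_div_iff₀ h3] at h2
    exact mul_pos h1 (by linarith)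
  obtain ⟨κ₀, hκ₀, hκle⟩ : ∃ κ₀, 0 < κ₀ ∧ ∀ l, κ₀ ≤ κ l := by
    rcases isEmpty_or_nonempty (Fin s) with h | h
    · exact ⟨1, one_pos, fun l => (h.false l).elim⟩
    · obtain ⟨l, hl⟩ := Finite.exists_min κ
      exact ⟨κ l, hκ0 l, hl⟩
  have hq0 : 0 < κ₀ * (p * c) := mul_pos hκ₀ (mul_pos hp.1 hc0)
  -- The maximum with `1/2` is there because the rate must be positive, which is not known of `1 -
  -- κ₀ p c`.
  refine ⟨max (1 / 2) (1 - κ₀ * (p * c)), lt_max_of_lt_left (by norm_num),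
    max_lt (by norm_num) (by linarith), fun v => ?_⟩
  calc ∑ t, w t * ‖stepLin X α t v‖ ^ 2
      ≤ ∑ t, w t * ∑ l, (block v l ⬝ᵥ block v l - κ l *
          ((maskMatrix t *ᵥ block v l) ⬝ᵥ (Xᵀ * X) *ᵥ (maskMatrix t *ᵥ block v l))) := by
        refine Finset.sum_le_sum fun t _ => mul_le_mul_of_nonneg_left ?_ (hw0 t)
        rw [norm_sq_eq_sum_block]
        refine Finset.sum_le_sum fun l _ => ?_
        rw [block_stepLin]
        exact step_dotProduct_self_le (X := X) (α := α l) t (block v l)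
    _ = ∑ l, (block v l ⬝ᵥ block v l -
          κ l * (p * (block v l ⬝ᵥ rescale p (Xᵀ * X) *ᵥ block v l))) := by
        simp_rw [Finset.mul_sum]
        rw [Finset.sum_comm]
        refine Finset.sum_congr rfl fun l _ => ?_
        rw [← hw.sum_dotProduct, Finset.mul_sum]
        simp_rw [mul_sub]
        rw [Finset.sum_sub_distrib, ← Finset.sum_mul, hw1, one_mul]
        congr 1
        exact Finset.sum_congr rfl fun t _ => by ring
    _ ≤ ∑ l, (1 - κ₀ * (p * c)) * (block v l ⬝ᵥ block v l) := by
        refine Finset.sum_le_sum fun l _ => ?_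
        have h0 : 0 ≤ block v l ⬝ᵥ block v l := Finset.sum_nonneg fun i _ => mul_self_nonneg _
        have h1 : κ₀ * (p * (c * (block v l ⬝ᵥ block v l))) ≤
            κ l * (p * (block v l ⬝ᵥ rescale p (Xᵀ * X) *ᵥ block v l)) :=
          mul_le_mul (hκle l) (mul_le_mul_of_nonneg_left (hc _) hp.1.le)
            (mul_nonneg hp.1.le (mul_nonneg hc0.le h0)) (hκ0 l).le
        linarith
    _ = (1 - κ₀ * (p * c)) * ‖v‖ ^ 2 := by rw [← Finset.mul_sum, norm_sq_eq_sum_block]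
    _ ≤ _ := by gcongr; exact le_max_right _ _

/-- In block `l` the mean noise is `α_l p (Xᵀy - (XᵀX)_p b)`, which vanishes by the normal
equations. This is why averaging is centred at the regularized estimator. -/
lemma sum_stepNoise (hX : ∀ j, ∃ i, X i j ≠ 0) (hp : p ∈ Set.Ioo (0 : ℝ) 1)
    (hw : HasMaskMoments p w) : ∑ t, w t • stepNoise X y α (regEstimator p X y) t = 0 := by
  ext a
  obtain ⟨l, i⟩ := a
  set b := regEstimator p X y with hb
  have h1 : ∀ t, (w t • stepNoise X y α b t) (l, i) =
      α l * ((Xᵀ *ᵥ y) i * (w t * maskVec t i)) -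
        α l * (w t * (maskVec t i * ((Xᵀ * X) *ᵥ (maskMatrix t *ᵥ b)) i)) := by
    intro t
    have h2 : stepNoise X y α b t (l, i) =
        α l * (maskMatrix t *ᵥ (Xᵀ *ᵥ (y - X *ᵥ (maskMatrix t *ᵥ b)))) i := by
      rw [stepNoise, centre_apply, gdStep]
      simp
    rw [PiLp.smul_apply, h2, maskMatrix_mulVec, Matrix.mulVec_sub, Matrix.mulVec_mulVec, smul_eq_mul,
      Pi.sub_apply]
    ring
  have h3 : (∑ t, w t • stepNoise X y α b t) (l, i) = ∑ t, (w t • stepNoise X y α b t) (l, i) := by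
    simp
  rw [h3]
  simp_rw [h1]
  rw [Finset.sum_sub_distrib, ← Finset.mul_sum, ← Finset.mul_sum, ← Finset.mul_sum, hw.first,
    hw.sum_mul_mulVec, hb, rescale_mulVec_regEstimator hX hp]
  simp only [PiLp.zero_apply]
  ring

lemma sq_norm_residual (t : Fin d → Bool) (b : Fin d → ℝ) :
    ‖WithLp.toLp 2 (y - X *ᵥ (maskMatrix t *ᵥ b))‖ ^ 2 = y ⬝ᵥ y -
      2 * ((Xᵀ *ᵥ y) ⬝ᵥ maskMatrix t *ᵥ b) +
      (maskMatrix t *ᵥ b) ⬝ᵥ (Xᵀ * X) *ᵥ (maskMatrix t *ᵥ b) := by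
  have h : (Xᵀ *ᵥ y) ⬝ᵥ maskMatrix t *ᵥ b = y ⬝ᵥ X *ᵥ (maskMatrix t *ᵥ b) := by
    rw [Matrix.mulVec_transpose, Matrix.dotProduct_mulVec y]
  rw [norm_toLp_sq, h, dotProduct_gram_mulVec]
  generalize X *ᵥ (maskMatrix t *ᵥ b) = z
  simp only [sub_dotProduct, dotProduct_sub]
  rw [dotProduct_comm z y]
  ring

lemma HasMaskMoments.sum_loss (hw1 : ∑ t, w t = 1) (hw : HasMaskMoments p w) (b : Fin d → ℝ) :
    ∑ t, w t * ((1 / 2 : ℝ) * ‖WithLp.toLp 2 (y - X *ᵥ (maskMatrix t *ᵥ b))‖ ^ 2) =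
      1 / 2 * (y ⬝ᵥ y) - p * ((Xᵀ *ᵥ y) ⬝ᵥ b) + 1 / 2 * p * (b ⬝ᵥ rescale p (Xᵀ * X) *ᵥ b) := by
  simp_rw [sq_norm_residual]
  calc _ = ∑ t, (1 / 2 * (y ⬝ᵥ y) * w t - w t * ((Xᵀ *ᵥ y) ⬝ᵥ maskMatrix t *ᵥ b) +
        1 / 2 * (w t * ((maskMatrix t *ᵥ b) ⬝ᵥ (Xᵀ * X) *ᵥ (maskMatrix t *ᵥ b)))) :=
        Finset.sum_congr rfl fun t _ => by ring
    _ = _ := by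
        rw [Finset.sum_add_distrib, Finset.sum_sub_distrib, ← Finset.mul_sum, ← Finset.mul_sum, hw1,
          hw.sum_linear, hw.sum_dotProduct]
        ring

lemma rescale_symm (v u : Fin d → ℝ) :
    u ⬝ᵥ rescale p (Xᵀ * X) *ᵥ v = v ⬝ᵥ rescale p (Xᵀ * X) *ᵥ u := by
  have h : (rescale p (Xᵀ * X))ᵀ = rescale p (Xᵀ * X) := by
    simp [rescale, diagPart, Matrix.transpose_mul]
  rw [Matrix.dotProduct_mulVec, dotProduct_comm, ← Matrix.mulVec_transpose, h]

/-- The regularized estimator is the strict minimizer of the averaged loss. -/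
lemma HasMaskMoments.sum_loss_lt (hX : ∀ j, ∃ i, X i j ≠ 0) (hp : p ∈ Set.Ioo (0 : ℝ) 1)
    (hw1 : ∑ t, w t = 1) (hw : HasMaskMoments p w) {b : Fin d → ℝ} (hb : b ≠ regEstimator p X y) :
    ∑ t, w t * ((1 / 2 : ℝ) *
        ‖WithLp.toLp 2 (y - X *ᵥ (maskMatrix t *ᵥ regEstimator p X y))‖ ^ 2) <
      ∑ t, w t * ((1 / 2 : ℝ) * ‖WithLp.toLp 2 (y - X *ᵥ (maskMatrix t *ᵥ b))‖ ^ 2) := by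
  obtain ⟨c, hc0, hc⟩ := exists_mul_dotProduct_le hX hp
  rw [hw.sum_loss hw1, hw.sum_loss hw1]
  have hβ := rescale_mulVec_regEstimator hX hp y
  have hsymm := rescale_symm (X := X) (p := p)
  set β := regEstimator p X y
  have h1 := hc (b - β)
  have h2 : 0 < (b - β) ⬝ᵥ (b - β) :=
    lt_of_le_of_ne (Finset.sum_nonneg fun i _ => mul_self_nonneg _) fun h =>
      hb (sub_eq_zero.1 (dotProduct_self_eq_zero.1 h.symm))
  -- By the normal equations the excess loss of `b` over `β` is half of this quantity.
  have h3 : 0 < p * ((b - β) ⬝ᵥ rescale p (Xᵀ * X) *ᵥ (b - β)) :=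
    mul_pos hp.1 ((mul_pos hc0 h2).trans_le h1)
  rw [Matrix.mulVec_sub, sub_dotProduct, dotProduct_sub, dotProduct_sub, hsymm b β, hβ] at h3
  rw [hβ, dotProduct_comm _ b, dotProduct_comm _ β]
  linarith

lemma avgIterate_eq (x : ℤ → Fin d → Bool) (β₀ : Fin s → Fin d → ℝ) (n : ℕ) :
    WithLp.toLp 2 (√(n : ℝ) • vecs fun l =>
        avgIterate X y (α l) (fun j => maskMatrix (x j)) (β₀ l) n - c) =
      (√(n : ℝ))⁻¹ • ∑ k ∈ Finset.range n,
        fwd (stepLin X α) (stepNoise X y α c) x (centre c β₀) (k + 1) := by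
  rcases Nat.eq_zero_or_pos n with rfl | hn
  -- For `n = 0` both sides vanish: `√0 = 0` on the left and an empty sum on the right.
  · simp
  have hn' : (0 : ℝ) < n := by exact_mod_cast hn
  simp_rw [← centre_gdIterate]
  ext a
  have h1 : ∑ k ∈ Finset.Icc 1 n, gdIterate X y (α a.1) (fun j => maskMatrix (x j)) (β₀ a.1) k a.2 =
      ∑ k ∈ Finset.range n, gdIterate X y (α a.1) (fun j => maskMatrix (x j)) (β₀ a.1) (k + 1) a.2 := by
    rw [Finset.range_eq_Ico, Finset.sum_Ico_add' (fun k =>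
      gdIterate X y (α a.1) (fun j => maskMatrix (x j)) (β₀ a.1) k a.2) 0 n 1]
    rfl
  have h2 : (∑ k ∈ Finset.range n, centre c (fun l =>
      gdIterate X y (α l) (fun j => maskMatrix (x j)) (β₀ l) (k + 1))) a =
      ∑ k ∈ Finset.range n,
        (gdIterate X y (α a.1) (fun j => maskMatrix (x j)) (β₀ a.1) (k + 1) a.2 - c a.2) := by
    simp [centre_apply]
  rw [PiLp.smul_apply, h2, Finset.sum_sub_distrib, ← h1]
  simp only [Pi.smul_apply, vecs_apply, Pi.sub_apply, avgIterate, Finset.sum_apply, smul_eq_mul,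
    Finset.sum_const, Finset.card_range, nsmul_eq_mul]
  have h3 : √(n : ℝ) * √(n : ℝ) = n := Real.mul_self_sqrt hn'.le
  have h4 : √(n : ℝ) ≠ 0 := (Real.sqrt_pos.2 hn').ne'
  have h5 : √(n : ℝ) * (n : ℝ)⁻¹ = (√(n : ℝ))⁻¹ := by
    rw [← h3, Real.sqrt_mul_self (Real.sqrt_nonneg _)]
    field_simp
  have h6 : (√(n : ℝ))⁻¹ * n = √(n : ℝ) := by
    rw [← h5, mul_assoc, inv_mul_cancel₀ hn'.ne', mul_one]
  rw [mul_sub, ← mul_assoc, h5, mul_sub, ← mul_assoc, h6]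

end System

end DropoutGD

namespace RandomAffine

/-! ### Convergence in distribution to the Gaussian limit -/

section Euclidean

variable {Ω T ι : Type*} [MeasurableSpace Ω] [MeasurableSpace T] [Fintype T]
  [DiscreteMeasurableSpace T] [Fintype ι] [DecidableEq ι] {η : ℤ → Ω → T} {w : T → ℝ}
  {P : Measure Ω} [IsProbabilityMeasure P]
  {M : T → EuclideanSpace ℝ ι →L[ℝ] EuclideanSpace ℝ ι} {e : T → EuclideanSpace ℝ ι} {ρ : ℝ}

/-- The matrix of the long-run covariance form in the standard basis. -/
def longRunMatrix (hη : IsIIDSeq η w P) (hM : IsMeanContractive M w ρ)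
    (e : T → EuclideanSpace ℝ ι) : Matrix ι ι ℝ :=
  Matrix.of fun a b => longRunForm hη hM e (EuclideanSpace.single a 1) (EuclideanSpace.single b 1)

lemma dotProduct_longRunMatrix_mulVec (hη : IsIIDSeq η w P) (hM : IsMeanContractive M w ρ)
    (x : EuclideanSpace ℝ ι) :
    x ⬝ᵥ longRunMatrix hη hM e *ᵥ x = longRunForm hη hM e x x := by
  have hx : x = ∑ a, x a • EuclideanSpace.single a (1 : ℝ) := by
    ext b
    simp [Pi.single_apply]
  conv_rhs => rw [hx]
  simp only [map_sum, map_smul, LinearMap.sum_apply, LinearMap.smul_apply, smul_eq_mul, dotProduct,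
    Matrix.mulVec, longRunMatrix, Matrix.of_apply, Finset.mul_sum]
  rw [Finset.sum_comm]
  exact Finset.sum_congr rfl fun b _ => Finset.sum_congr rfl fun a _ => by ring

lemma posSemidef_longRunMatrix (hη : IsIIDSeq η w P) (hM : IsMeanContractive M w ρ)
    (he : ∑ t, w t • e t = 0) : (longRunMatrix hη hM e).PosSemidef := by
  refine .of_dotProduct_mulVec_nonneg ?_ fun x => ?_
  · ext a b
    exact longRunForm_comm hη hM _ _
  · have h := dotProduct_longRunMatrix_mulVec (e := e) hη hM (WithLp.toLp 2 x)
    exact (longRunForm_self_nonneg hη hM he (WithLp.toLp 2 x)).trans_eq h.symm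

lemma aemeasurable_smul_sum_fwd (hη : IsIIDSeq η w P) (v : EuclideanSpace ℝ ι) (n : ℕ) :
    AEMeasurable
      (fun ω => (√(n : ℝ))⁻¹ • ∑ k ∈ Finset.range n, fwd M e (η · ω) v (k + 1)) P := by
  have h : ∀ k, Measurable fun ω => fwd M e (η · ω) v (k + 1) := fun k =>
    hη.measurable_bwd _ _ _
  have h' : Measurable fun ω => ∑ k ∈ Finset.range n, fwd M e (η · ω) v (k + 1) :=
    Finset.measurable_fun_sum _ fun k _ => h k
  exact (h'.const_smul (√(n : ℝ))⁻¹).aemeasurable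

/-- The central limit theorem for the forward iteration. -/
theorem tendstoInDistribution_fwd (hη : IsIIDSeq η w P) (hM : IsMeanContractive M w ρ)
    (he : ∑ t, w t • e t = 0) (v : EuclideanSpace ℝ ι) :
    TendstoInDistribution
      (fun (n : ℕ) ω => (√(n : ℝ))⁻¹ • ∑ k ∈ Finset.range n, fwd M e (η · ω) v (k + 1))
      atTop id (fun _ => P) (multivariateGaussian 0 (longRunMatrix hη hM e)) where
  forall_aemeasurable := aemeasurable_smul_sum_fwd hη v
  tendsto := by
    -- Lévy's continuity theorem reduces the vector statement to the scalar limits for each `t`.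
    refine ProbabilityMeasure.tendsto_iff_tendsto_charFun.2 fun t => ?_
    have h := tendsto_integral_exp_inner_fwd hη hM he v t
    have hlim : charFun ((multivariateGaussian 0 (longRunMatrix hη hM e)).map id) t =
        Complex.exp (-(longRunForm hη hM e t t / 2 : ℝ)) := by
      rw [Measure.map_id, charFun_multivariateGaussian (posSemidef_longRunMatrix hη hM he),
        dotProduct_longRunMatrix_mulVec]
      congr 1
      push_cast
      simp
    have hseq : ∀ n : ℕ, charFun (P.map fun ω =>
        (√(n : ℝ))⁻¹ • ∑ k ∈ Finset.range n, fwd M e (η · ω) v (k + 1)) t =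
        ∫ ω, Complex.exp (Complex.I * ((√n)⁻¹ *
          ∑ k ∈ Finset.range n, inner ℝ t (fwd M e (η · ω) v (k + 1)) : ℝ)) ∂P := by
      intro n
      rw [charFun_apply, integral_map (aemeasurable_smul_sum_fwd hη v n) (by fun_prop)]
      refine integral_congr_ae (ae_of_all _ fun ω => ?_)
      simp only
      rw [real_inner_comm, inner_smul_right, inner_sum, mul_comm]
    simp only [ProbabilityMeasure.coe_mk]
    rw [hlim]
    exact h.congr fun n => (hseq n).symm

end Euclidean

end RandomAffine

namespace DropoutGD

open RandomAffine

/-! ### Transfer to the dropout iterates -/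

section Main

variable {Ω : Type*} [MeasurableSpace Ω] {P : Measure Ω} [IsProbabilityMeasure P] {N d s : ℕ}
  {X : Matrix (Fin N) (Fin d) ℝ} {y : Fin N → ℝ} {α : Fin s → ℝ} {c : Fin d → ℝ}
  {D : ℤ → Ω → Matrix (Fin d) (Fin d) ℝ} {η : ℤ → Ω → Fin d → Bool} {w : (Fin d → Bool) → ℝ}
  {ρ : ℝ}

lemma dropoutLoss_eq_sum (hη : IsIIDSeq η w P) (hDη : ∀ᵐ ω ∂P, ∀ k, D k ω = maskMatrix (η k ω))
    (k : ℤ) (b : Fin d → ℝ) :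
    dropoutLoss P X y (D k) b =
      ∑ t, w t * ((1 / 2 : ℝ) * ‖WithLp.toLp 2 (y - X *ᵥ (maskMatrix t *ᵥ b))‖ ^ 2) := by
  rw [← hη.integral_comp k fun t =>
    (1 / 2 : ℝ) * ‖WithLp.toLp 2 (y - X *ᵥ (maskMatrix t *ᵥ b))‖ ^ 2]
  refine integral_congr_ae ?_
  filter_upwards [hDη] with ω hω
  rw [hω k]

lemma ae_tendsto_backwardIterate (hη : IsIIDSeq η w P)
    (hDη : ∀ᵐ ω ∂P, ∀ k, D k ω = maskMatrix (η k ω))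
    (hM : IsMeanContractive (stepLin X α) w ρ) (y : Fin N → ℝ) (l : Fin s) (k : ℤ) :
    ∀ᵐ ω ∂P, ∀ b, Tendsto (fun m => backwardIterate X y (α l) (fun j => D j ω) k m b) atTop
      (𝓝 (stationaryIterate X y (α l) (fun j => D j ω) k)) := by
  -- Convergence does not need centred noise, so the origin serves as centre.
  filter_upwards [hDη, ae_tendsto_bwd hη hM (stepNoise X y α 0) k] with ω h1 h2 b
  rw [funext h1, stationaryIterate_eq h2]
  exact tendsto_backwardIterate h2 l b

lemma ae_stationaryVec_eq (hη : IsIIDSeq η w P)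
    (hDη : ∀ᵐ ω ∂P, ∀ k, D k ω = maskMatrix (η k ω))
    (hM : IsMeanContractive (stepLin X α) w ρ) (y : Fin N → ℝ) (c : Fin d → ℝ) (k : ℤ)
    (a : Fin s × Fin d) :
    (fun ω => stationaryVec X y α (fun j => D j ω) k a) =ᵐ[P] fun ω =>
      inner ℝ (EuclideanSpace.single a (1 : ℝ))
        (stat (stepLin X α) (stepNoise X y α c) (η · ω) k) + c a.2 := by
  filter_upwards [hDη, ae_tendsto_bwd hη hM (stepNoise X y α c) k] with ω h1 h2
  rw [funext h1, stationaryVec, vecs_apply, stationaryIterate_eq h2,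
    EuclideanSpace.inner_single_left]
  simp [block]

lemma memLp_stationaryVec (hη : IsIIDSeq η w P)
    (hDη : ∀ᵐ ω ∂P, ∀ k, D k ω = maskMatrix (η k ω))
    (hM : IsMeanContractive (stepLin X α) w ρ) (y : Fin N → ℝ) (k : ℤ) (a : Fin s × Fin d) :
    MemLp (fun ω => stationaryVec X y α (fun j => D j ω) k a) 2 P := by
  refine MemLp.ae_eq (ae_stationaryVec_eq hη hDη hM y 0 k a).symm ?_
  have h : MemLp (fun ω => inner ℝ (EuclideanSpace.single a (1 : ℝ))
      (stat (stepLin X α) (stepNoise X y α 0) (η · ω) k)) 2 P :=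
    (memLp_stat hη hM _ k).const_inner _
  exact h.add (memLp_const ((0 : Fin d → ℝ) a.2))

/-- Centred noise makes `c` the mean of every stationary iterate, so the covariances are the plain
second moments of the recursion centred at `c`. -/
lemma crossCov_stationaryVec (hη : IsIIDSeq η w P)
    (hDη : ∀ᵐ ω ∂P, ∀ k, D k ω = maskMatrix (η k ω))
    (hM : IsMeanContractive (stepLin X α) w ρ) (he : ∑ t, w t • stepNoise X y α c t = 0) (k : ℤ)
    (a b : Fin s × Fin d) :
    crossCov P (fun ω => stationaryVec X y α (fun j => D j ω) 0)
        (fun ω => stationaryVec X y α (fun j => D j ω) k) a b =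
      ∫ ω, inner ℝ (EuclideanSpace.single a (1 : ℝ))
          (stat (stepLin X α) (stepNoise X y α c) (η · ω) 0) *
        inner ℝ (EuclideanSpace.single b (1 : ℝ))
          (stat (stepLin X α) (stepNoise X y α c) (η · ω) k) ∂P := by
  have hmean : ∀ k a, ∫ ω, stationaryVec X y α (fun j => D j ω) k a ∂P = c a.2 := by
    intro k a
    have hi : Integrable (fun ω => inner ℝ (EuclideanSpace.single a (1 : ℝ))
        (stat (stepLin X α) (stepNoise X y α c) (η · ω) k)) P :=
      ((memLp_stat hη hM _ k).const_inner _).integrable one_le_two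
    rw [integral_congr_ae (ae_stationaryVec_eq hη hDη hM y c k a),
      integral_add hi (integrable_const _), integral_inner_stat hη hM he]
    simp
  simp only [crossCov, Matrix.of_apply, covariance]
  rw [hmean, hmean]
  refine integral_congr_ae ?_
  filter_upwards [ae_stationaryVec_eq hη hDη hM y c 0 a,
    ae_stationaryVec_eq hη hDη hM y c k b] with ω h1 h2
  rw [h1, h2, add_sub_cancel_right, add_sub_cancel_right]

lemma hasSum_crossCov_stationaryVec (hη : IsIIDSeq η w P)
    (hDη : ∀ᵐ ω ∂P, ∀ k, D k ω = maskMatrix (η k ω))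
    (hM : IsMeanContractive (stepLin X α) w ρ) (he : ∑ t, w t • stepNoise X y α c t = 0)
    (a b : Fin s × Fin d) :
    HasSum (fun k : ℤ => crossCov P (fun ω => stationaryVec X y α (fun j => D j ω) 0)
        (fun ω => stationaryVec X y α (fun j => D j ω) k) a b)
      (longRunMatrix hη hM (stepNoise X y α c) a b) := by
  simp_rw [crossCov_stationaryVec hη hDη hM he]
  exact hasSum_longRunForm hη hM he _ _

lemma longRunCov_stationaryVec (hη : IsIIDSeq η w P)
    (hDη : ∀ᵐ ω ∂P, ∀ k, D k ω = maskMatrix (η k ω))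
    (hM : IsMeanContractive (stepLin X α) w ρ) (he : ∑ t, w t • stepNoise X y α c t = 0) :
    longRunCov P (fun k ω => stationaryVec X y α (fun j => D j ω) k) =
      longRunMatrix hη hM (stepNoise X y α c) :=
  Matrix.ext fun a b => (hasSum_crossCov_stationaryVec hη hDη hM he a b).tsum_eq

end Main

end DropoutGD

end

theorem mainTheorem11 {Ω : Type*} [MeasurableSpace Ω] (P : Measure Ω) [IsProbabilityMeasure P]
    {N d s : ℕ} (hs : 1 ≤ s)
    (X : Matrix (Fin N) (Fin d) ℝ) (hX : ∀ j, ∃ i, X i j ≠ 0)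
    (y : Fin N → ℝ)
    (p : unitInterval) (hp : (p : ℝ) ∈ Set.Ioo (0 : ℝ) 1)
    (D : ℤ → Ω → Matrix (Fin d) (Fin d) ℝ) (hD : DropoutGD.IsIIDDropout p D P)
    (α : Fin s → ℝ) (hα : ∀ l, α l ∈ Set.Ioo (0 : ℝ) (2 / ‖Xᵀ * X‖))
    (β₀ : Fin s → Fin d → ℝ) :
    let βt : Fin d → ℝ := DropoutGD.regEstimator p X y
    let Z : ℤ → Ω → Fin s × Fin d → ℝ :=
      fun k ω => DropoutGD.stationaryVec X y α (fun j => D j ω) k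
    let S : Matrix (Fin s × Fin d) (Fin s × Fin d) ℝ := DropoutGD.longRunCov P Z
    -- the centering vector is the unique minimizer of the marginalized dropout loss
    (∀ k, ∀ b, b ≠ βt →
      DropoutGD.dropoutLoss P X y (D k) βt < DropoutGD.dropoutLoss P X y (D k) b) ∧
    -- the limits defining the stationary iterates exist almost surely, for every starting point
    (∀ l, ∀ k : ℤ, ∀ᵐ ω ∂P, ∀ b : Fin d → ℝ,
      Tendsto (fun m : ℕ => DropoutGD.backwardIterate X y (α l) (fun j => D j ω) k m b) atTop
        (𝓝 (DropoutGD.stationaryIterate X y (α l) (fun j => D j ω) k))) ∧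
    -- the long-run covariance matrix is well defined
    (∀ k a, MemLp (fun ω => Z k ω a) 2 P) ∧
    (∀ a b, Summable fun k : ℤ => DropoutGD.crossCov P (Z 0) (Z k) a b) ∧
    S.PosSemidef ∧
    -- the central limit theorem
    TendstoInDistribution
      (fun (n : ℕ) ω => WithLp.toLp 2 (√(n : ℝ) • DropoutGD.vecs fun l =>
        DropoutGD.avgIterate X y (α l) (fun j => D j ω) (β₀ l) n - βt))
      atTop id (fun _ => P) (multivariateGaussian 0 S) := by

  intro βt Z S
  obtain ⟨η, hη, hDη⟩ := hD.exists_mask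
  have hw : DropoutGD.HasMaskMoments (p : ℝ) (DropoutGD.maskWeight (d := d) p) :=
    ⟨DropoutGD.sum_maskWeight_mul hD, DropoutGD.sum_maskWeight_mul_mul hD⟩
  obtain ⟨ρ, hM⟩ :=
    DropoutGD.exists_isMeanContractive hX hp hα hη.weight_nonneg hη.sum_weight hw
  have he : ∑ t, DropoutGD.maskWeight p t • DropoutGD.stepNoise X y α βt t = 0 :=
    DropoutGD.sum_stepNoise hX hp hw
  have hS : S = RandomAffine.longRunMatrix hη hM (DropoutGD.stepNoise X y α βt) :=
    DropoutGD.longRunCov_stationaryVec hη hDη hM he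
  refine ⟨fun k b hb => ?_, DropoutGD.ae_tendsto_backwardIterate hη hDη hM y,
    DropoutGD.memLp_stationaryVec hη hDη hM y,
    fun a b => (DropoutGD.hasSum_crossCov_stationaryVec hη hDη hM he a b).summable, ?_, ?_⟩
  · rw [DropoutGD.dropoutLoss_eq_sum hη hDη, DropoutGD.dropoutLoss_eq_sum hη hDη]
    exact hw.sum_loss_lt hX hp hη.sum_weight hb
  · rw [hS]
    exact RandomAffine.posSemidef_longRunMatrix hη hM he
  · rw [hS]
    refine (RandomAffine.tendstoInDistribution_fwd hη hM he
      (DropoutGD.centre βt β₀)).congr (fun n => ?_) (ae_eq_refl _)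
    filter_upwards [hDη] with ω hω
    rw [funext hω, DropoutGD.avgIterate_eq]
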